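/- Theorem 4.4. A characteristic function (ChF) is the ChF of a probability law on $\mathbb{R}$. Let $\varphi(z)=\int_{[0,\infty)}e^{-zx}\,d\mu(x)$, $\operatorname{Re}z\ge 0$, be the Laplace transform of a probability measure $\mu$ on $[0,\infty)$ other than the unit mass at $0$. Let $\psi:\mathbb{R}\to\mathbb{C}$ be continuous with $\psi(0)=0$ and such that $\omega(t)=e^{-\psi(t)}$ is the ChF of a stable law, that is, $\omega$ is a ChF and for all $a,b>0$ there are $c>0$ and $d\in\mathbb{R}$ with $\omega(at)\,\omega(bt)=\omega(ct)\,e^{itd}$ for all $t\in\mathbb{R}$ (so that $\varphi\{\psi(t)\}$ is the ChF of a $\varphi$-stable law). Then the domain of $\varphi$-attraction of $\varphi\{\psi(t)\}$ coincides with the classical domain of attraction of $\omega$. That is, for every ChF $g$, there are $a_n>0$ and $b_n\in\mathbb{R}$ such that $$\varphi\bigl\{n\bigl(1-g(t/a_n)e^{-itb_n}\bigr)\bigr\}\longrightarrow\varphi\{\psi(t)\}\quad (n\to\infty)\quad\text{for all }t\in\mathbb{R}$$ if and only if there are (possibly different) $a_n>0$ and $b_n\in\mathbb{R}$ such that $$\bigl\{g(t/a_n)e^{-itb_n}\bigr\}^n\longrightarrow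 e^{-\psi(t)}\quad (n\to\infty)\quad\text{for all }t\in\mathbb{R}.$$ -/

import Mathlib

open MeasureTheory Filter Topology

/-- The Laplace transform `φ(z) = ∫ e^{-z x} dμ(x)` of a measure `μ` carried by `[0, ∞)`, on the
closed half-plane `Re z ≥ 0`, where the integral converges. -/
noncomputable def laplaceTransform (μ : Measure ℝ) (z : ℂ) : ℂ :=
  ∫ x : ℝ, Complex.exp (-(z * (x : ℂ))) ∂μ

/-- `g` is the characteristic function of a probability law on the real line. -/
def IsCharFun (g : ℝ → ℂ) : Prop :=
  ∃ ν : Measure ℝ, IsProbabilityMeasure ν ∧ g = charFun ν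

/-- `ω` is the characteristic function of a stable law: for independent copies `X₁`, `X₂` of `X`
and `a, b > 0`, the variable `a X₁ + b X₂` has the law of `c X + d` for some `c > 0`, `d ∈ ℝ`. -/
def IsStableCharFun (ω : ℝ → ℂ) : Prop :=
  IsCharFun ω ∧ ∀ a b : ℝ, 0 < a → 0 < b → ∃ c d : ℝ, 0 < c ∧
    ∀ t : ℝ, ω (a * t) * ω (b * t) = ω (c * t) * Complex.exp (Complex.I * (t * d : ℝ))

/-- The normed and centred characteristic function `g(t / a) e^{-i t b}`. -/
noncomputable def normalizedCharFun (g : ℝ → ℂ) (a b t : ℝ) : ℂ :=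
  g (t / a) * Complex.exp (-(Complex.I * (t * b : ℝ)))

/-- The classical domain of attraction of `ω`: the characteristic functions `g` such that
`{g(t / a_n) e^{-i t b_n}}^n → ω(t)` for all `t`, for some `a_n > 0` and `b_n ∈ ℝ`. -/
def domainOfAttraction (ω : ℝ → ℂ) : Set (ℝ → ℂ) :=
  {g | IsCharFun g ∧ ∃ a b : ℕ → ℝ, (∀ n, 0 < a n) ∧
    ∀ t : ℝ, Tendsto (fun n : ℕ => normalizedCharFun g (a n) (b n) t ^ n) atTop (𝓝 (ω t))}

/-- The domain of `φ`-attraction of `f`: the characteristic functions `g` such that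
`φ{n (1 - g_n(t))} → f(t)` for all `t`, where `g_n(t) = g(t / a_n) e^{-i t b_n}`, for some
`a_n > 0` and `b_n ∈ ℝ`. As `s ↦ φ{n (1 - s)}` is the probability generating function of some `N`,
`φ{n (1 - g_n(t))}` is the characteristic function of the sum of `N` variables with
characteristic function `g_n`, all of them independent of each other and of `N`. -/
def domainOfPhiAttraction (φ : ℂ → ℂ) (f : ℝ → ℂ) : Set (ℝ → ℂ) :=
  {g | IsCharFun g ∧ ∃ a b : ℕ → ℝ, (∀ n, 0 < a n) ∧
    ∀ t : ℝ, Tendsto (fun n : ℕ => φ ((n : ℂ) * (1 - normalizedCharFun g (a n) (b n) t)))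
      atTop (𝓝 (f t))}

set_option linter.unusedSectionVars false


/-! ### The Laplace transform on the closed right half-plane. -/

section Laplace

variable {μ : Measure ℝ} [IsProbabilityMeasure μ]

/-! Write φ for `laplaceTransform μ` and z_n(t) = n(1 - g_n(t)) for the exponents `rowExponent`.
Since g_n^n is close to e^{-z_n} as long as z_n stays bounded, and a continuous logarithm vanishing
at 0 is unique, classical convergence to e^{-ψ} is the same as z_n → ψ
(`IsCharFun.tendsto_pow_of_row`, `IsCharFun.tendsto_row_of_pow`). From z_n → ψ the φ-convergence
follows by continuity of φ. The converse must recover ψ from φ(ψ), although φ is known to be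
injective only on [0, ∞) and may fail to be so on the half-plane. If Re ψ vanishes identically, then
ψ(t) = iDt and every ChF lies in both domains. Otherwise the same a_n, b_n serve on both sides, by
the following argument (`IsCharFun.tendsto_row_of_laplace`).

Compactness. Near 0 in the closed half-plane φ takes the value 1 only at 0, so z_n cannot cross a
small circle while φ(z_n) is close to 1. Hence the z_n are uniformly small near t = 0, and a
Cauchy–Schwarz inequality for ChFs turns this into asymptotic equicontinuity. It remains to show χ =
ψ for every subsequential limit χ; all that is known at first is φ(χ) = φ(ψ).

Self-similarity of χ. Passing from indices n to ⌊sn⌋ and using convergence of types, every s > 0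
yields another subsequential limit of the form s χ(ct) + iDt (`exists_isSubLimit_scale`). All these
functions are lifts of the single curve φ(ψ) through φ. For s = k^{1/N} with N → ∞ they converge
along a subsequence to a lift that is itself χ up to scale and drift. As critical points of φ are
isolated, convergent lifts coincide eventually with their limit on compact intervals
(`eventually_eqOn_of_tendsto`). So χ satisfies exact scaling relations for s = k^{1/N}, and by
iteration for s = k (`exists_scale_of_subLimit`). Solving the functional equations gives χ(t) = ζ
t^α + idt or ζ t + iβ t log t for t > 0 (`IsSelfSimilar.form`).

Extension. Positivity of a suitable Fourier transform bounds arg ζ, respectively β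
(`IsCharExponentLimit.abs_arg_le`, `IsCharExponentLimit.abs_mul_pi_le`). The bounds say that the
formulas extend to holomorphic Q on the right half-plane with Re Q' > 0 and Re(Q(t)/t) ≥ 0; the same
holds for ψ, with extension P.

Uniqueness. φ∘P = φ∘Q near the positive axis. Where Im P and Im Q had strictly opposite signs,
gluing φ∘P above the axis to φ∘Q below it would give a bounded holomorphic function with real
boundary values, hence a real one, contradicting the open mapping theorem (`not_im_neg_and_im_pos`).
So Im Q vanishes wherever Im P does, and there P = Q because φ is injective on [0, ∞). If Im P has
no zero, the comparison is made on half of the imaginary axis instead. Either way P = Q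
(`IsHalfPlaneExponent.eq_of_agree`). The same argument excludes a degenerate χ
(`IsHalfPlaneExponent.not_agree_linear`), which convergence of types requires beforehand. -/

lemma ae_nonneg_of_Iio (hμ : μ (Set.Iio 0) = 0) : ∀ᵐ x ∂μ, 0 ≤ x := by
  rw [ae_iff]
  convert hμ using 2
  ext x
  simp

lemma norm_exp_neg_mul_ofReal (z : ℂ) (x : ℝ) :
    ‖Complex.exp (-(z * (x : ℂ)))‖ = Real.exp (-(z.re * x)) := by
  rw [Complex.norm_exp]; simp

lemma norm_exp_neg_mul_le_one {z : ℂ} {x : ℝ} (hz : 0 ≤ z.re) (hx : 0 ≤ x) :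
    ‖Complex.exp (-(z * (x : ℂ)))‖ ≤ 1 := by
  rw [norm_exp_neg_mul_ofReal, Real.exp_le_one_iff]
  nlinarith [mul_nonneg hz hx]

lemma integrable_laplace (hμ : μ (Set.Iio 0) = 0) {z : ℂ} (hz : 0 ≤ z.re) :
    Integrable (fun x : ℝ => Complex.exp (-(z * (x : ℂ)))) μ := by
  refine (integrable_const (1 : ℝ)).mono' (by fun_prop) ?_
  filter_upwards [ae_nonneg_of_Iio hμ] with x hx using norm_exp_neg_mul_le_one hz hx

lemma laplace_zero : laplaceTransform μ 0 = 1 := by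
  simp [laplaceTransform]

lemma laplace_ofReal (u : ℝ) :
    laplaceTransform μ u = ((∫ x, Real.exp (-(u * x)) ∂μ : ℝ) : ℂ) := by
  rw [laplaceTransform, ← integral_complex_ofReal]
  congr 1; ext x; push_cast; rfl

lemma laplace_im_ofReal (u : ℝ) : (laplaceTransform μ u).im = 0 := by
  rw [laplace_ofReal, Complex.ofReal_im]

lemma laplace_conj (z : ℂ) :
    laplaceTransform μ (starRingEnd ℂ z) = starRingEnd ℂ (laplaceTransform μ z) := by
  rw [laplaceTransform, laplaceTransform, ← integral_conj]
  congr 1; ext x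
  rw [← Complex.exp_conj]; simp

lemma norm_laplace_le (z : ℂ) :
    ‖laplaceTransform μ z‖ ≤ (laplaceTransform μ (z.re : ℂ)).re := by
  rw [laplace_ofReal, Complex.ofReal_re, laplaceTransform]
  refine (norm_integral_le_integral_norm _).trans (le_of_eq ?_)
  congr 1; ext x
  rw [norm_exp_neg_mul_ofReal]

lemma continuousOn_laplace (hμ : μ (Set.Iio 0) = 0) :
    ContinuousOn (laplaceTransform μ) {z : ℂ | 0 ≤ z.re} := by
  unfold laplaceTransform
  apply continuousOn_of_dominated (bound := fun _ => (1 : ℝ))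
  · intro z _; fun_prop
  · intro z hz
    filter_upwards [ae_nonneg_of_Iio hμ] with x hx using norm_exp_neg_mul_le_one hz hx
  · exact integrable_const _
  · refine Eventually.of_forall fun x => ?_
    fun_prop

lemma differentiableOn_laplace (hμ : μ (Set.Iio 0) = 0) :
    DifferentiableOn ℂ (laplaceTransform μ) {z : ℂ | 0 < z.re} := by
  have h1 : laplaceTransform μ = fun z => ProbabilityTheory.complexMGF id μ (-z) := by
    ext z
    simp only [laplaceTransform, ProbabilityTheory.complexMGF, id, neg_mul]
  have h2 : Set.Iio (0 : ℝ) ⊆ interior (ProbabilityTheory.integrableExpSet id μ) := by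
    apply interior_maximal _ isOpen_Iio
    intro u hu
    have := (integrable_laplace (z := ((-u : ℝ) : ℂ)) hμ (by simpa using le_of_lt hu)).norm
    simp only [norm_exp_neg_mul_ofReal] at this
    simpa [ProbabilityTheory.integrableExpSet] using this
  rw [h1]
  refine ProbabilityTheory.differentiableOn_complexMGF.comp (by fun_prop) ?_
  intro z hz
  exact h2 (by simpa using hz)

/-- The upper end M is what matters: for 0 < x ≤ M and ‖z‖ < 1 / M the number z x is too small to be
a nonzero multiple of 2πi. -/
lemma exists_pos_of_ne_dirac (hμ : μ (Set.Iio 0) = 0) (hμ0 : μ ≠ Measure.dirac 0) :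
    ∃ M : ℝ, 0 < M ∧ 0 < μ (Set.Ioc 0 M) := by
  by_contra! h
  apply hμ0
  have h1 : μ (Set.Ioi 0) = 0 := by
    have : Set.Ioi (0 : ℝ) = ⋃ n : ℕ, Set.Ioc (0 : ℝ) (n + 1) := by
      ext x
      simp only [Set.mem_Ioi, Set.mem_iUnion, Set.mem_Ioc]
      constructor
      · intro hx
        obtain ⟨n, hn⟩ := exists_nat_ge x
        exact ⟨n, hx, by linarith⟩
      · rintro ⟨n, hx, _⟩; exact hx
    rw [this, measure_iUnion_null_iff]
    intro n
    exact le_antisymm (h _ (by positivity)) (zero_le)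
  have h2 : ∀ᵐ x ∂μ, x = 0 := by
    rw [ae_iff]
    refine measure_mono_null (t := Set.Iio 0 ∪ Set.Ioi 0) ?_ (measure_union_null hμ h1)
    intro x hx
    exact lt_or_gt_of_ne hx
  ext s hs
  rw [Measure.dirac_apply' _ hs]
  by_cases h0 : (0 : ℝ) ∈ s
  · rw [Set.indicator_of_mem h0]
    have : s =ᵐ[μ] Set.univ := by
      filter_upwards [h2] with x hx
      subst hx
      exact propext ⟨fun _ => trivial, fun _ => h0⟩
    rw [measure_congr this]; simp
  · rw [Set.indicator_of_notMem h0]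
    have : s =ᵐ[μ] (∅ : Set ℝ) := by
      filter_upwards [h2] with x hx
      subst hx
      exact propext ⟨fun h => h0 h, fun h => h.elim⟩
    rw [measure_congr this]; simp

lemma laplace_strictAnti (hμ : μ (Set.Iio 0) = 0) (hμ0 : μ ≠ Measure.dirac 0) {u v : ℝ}
    (hu : 0 ≤ u) (huv : u < v) :
    (laplaceTransform μ v).re < (laplaceTransform μ u).re := by
  rw [laplace_ofReal, laplace_ofReal, Complex.ofReal_re, Complex.ofReal_re]
  have hi : ∀ w : ℝ, 0 ≤ w → Integrable (fun x => Real.exp (-(w * x))) μ := by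
    intro w hw
    have := (integrable_laplace (z := (w : ℂ)) hμ (by simpa using hw)).norm
    simpa only [norm_exp_neg_mul_ofReal, Complex.ofReal_re] using this
  rw [← sub_pos, ← integral_sub (hi u hu) (hi v (hu.trans huv.le))]
  rw [integral_pos_iff_support_of_nonneg_ae]
  · obtain ⟨M, _, hM⟩ := exists_pos_of_ne_dirac hμ hμ0
    refine hM.trans_le (measure_mono ?_)
    intro x hx
    have : Real.exp (-(v * x)) < Real.exp (-(u * x)) := by
      apply Real.exp_lt_exp.2; nlinarith [hx.1]
    simp only [Function.mem_support]
    linarith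
  · filter_upwards [ae_nonneg_of_Iio hμ] with x hx
    have : Real.exp (-(v * x)) ≤ Real.exp (-(u * x)) := by
      apply Real.exp_le_exp.2; nlinarith
    simp only [Pi.zero_apply]
    linarith
  · exact (hi u hu).sub (hi v (hu.trans huv.le))

/-- This is the only global injectivity of φ that is used; every identification of exponents is
brought back to points where both have real values. -/
lemma laplace_injOn_real (hμ : μ (Set.Iio 0) = 0) (hμ0 : μ ≠ Measure.dirac 0) {z w : ℂ}
    (hz : 0 ≤ z.re) (hw : 0 ≤ w.re) (hzi : z.im = 0) (hwi : w.im = 0)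
    (h : laplaceTransform μ z = laplaceTransform μ w) : z = w := by
  have hz' : z = (z.re : ℂ) := Complex.ext (by simp) (by simp [hzi])
  have hw' : w = (w.re : ℂ) := Complex.ext (by simp) (by simp [hwi])
  rw [hz', hw'] at h
  rcases lt_trichotomy z.re w.re with hlt | heq | hlt
  · exact absurd (congrArg Complex.re h) (laplace_strictAnti hμ hμ0 hz hlt).ne'
  · rw [hz', hw', heq]
  · exact absurd (congrArg Complex.re h) (laplace_strictAnti hμ hμ0 hw hlt).ne

lemma laplace_re_le_one (hμ : μ (Set.Iio 0) = 0) {u : ℝ} (hu : 0 ≤ u) :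
    (laplaceTransform μ u).re ≤ 1 := by
  rw [laplace_ofReal, Complex.ofReal_re]
  calc ∫ x, Real.exp (-(u * x)) ∂μ ≤ ∫ _, (1 : ℝ) ∂μ := by
        apply integral_mono_of_nonneg
        · exact Eventually.of_forall fun x => (Real.exp_pos _).le
        · exact integrable_const _
        · filter_upwards [ae_nonneg_of_Iio hμ] with x hx
          rw [Real.exp_le_one_iff]; nlinarith [mul_nonneg hu hx]
    _ = 1 := by simp

lemma norm_laplace_le_one (hμ : μ (Set.Iio 0) = 0) {z : ℂ} (hz : 0 ≤ z.re) :
    ‖laplaceTransform μ z‖ ≤ 1 :=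
  (norm_laplace_le z).trans (laplace_re_le_one hμ hz)

lemma norm_laplace_lt_one (hμ : μ (Set.Iio 0) = 0) (hμ0 : μ ≠ Measure.dirac 0) {z : ℂ}
    (hz : 0 < z.re) : ‖laplaceTransform μ z‖ < 1 := by
  refine (norm_laplace_le z).trans_lt ?_
  have := laplace_strictAnti hμ hμ0 le_rfl hz
  simpa [laplace_zero] using this

/-- Near the origin of the closed right half-plane a nontrivial Laplace transform takes the value
`1` only at the origin. -/
lemma exists_laplace_ne_one (hμ : μ (Set.Iio 0) = 0) (hμ0 : μ ≠ Measure.dirac 0) :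
    ∃ r₀ : ℝ, 0 < r₀ ∧ ∀ z : ℂ, 0 ≤ z.re → z ≠ 0 → ‖z‖ < r₀ → laplaceTransform μ z ≠ 1 := by
  obtain ⟨M, hM0, hM⟩ := exists_pos_of_ne_dirac hμ hμ0
  refine ⟨1 / M, by positivity, ?_⟩
  intro z hz hz0 hzr h1
  have hint := integrable_laplace hμ hz
  -- If φ(z) = 1, the nonnegative function 1 - Re e^{-zx} has mean zero. Hence e^{-zx} = 1 almost
  -- everywhere, which is impossible on (0, M].
  have h2 : ∫ x, (1 - (Complex.exp (-(z * (x : ℂ)))).re) ∂μ = 0 := by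
    have hre : Integrable (fun x : ℝ => (Complex.exp (-(z * (x : ℂ)))).re) μ := hint.re
    rw [integral_sub (integrable_const _) hre]
    have : ∫ x, (Complex.exp (-(z * (x : ℂ)))).re ∂μ = (laplaceTransform μ z).re := by
      rw [laplaceTransform]
      exact integral_re hint
    rw [this, h1]; simp
  rw [integral_eq_zero_iff_of_nonneg_ae] at h2
  · have h3 : ∀ᵐ x ∂μ, x ∉ Set.Ioc 0 M := by
      filter_upwards [h2] with x hx hxM
      simp only [Pi.zero_apply, sub_eq_zero] at hx
      have hn : ‖Complex.exp (-(z * (x : ℂ)))‖ ≤ 1 := norm_exp_neg_mul_le_one hz hxM.1.le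
      have h4 : Complex.exp (-(z * (x : ℂ))) = 1 := by
        have hsq := Complex.sq_norm (Complex.exp (-(z * (x : ℂ))))
        rw [Complex.normSq_apply, ← hx] at hsq
        have him : (Complex.exp (-(z * (x : ℂ)))).im = 0 := by
          have : ‖Complex.exp (-(z * (x : ℂ)))‖ ^ 2 ≤ 1 := pow_le_one₀ (norm_nonneg _) hn
          nlinarith [mul_self_nonneg (Complex.exp (-(z * (x : ℂ)))).im]
        exact Complex.ext (by simp [← hx]) (by simp [him])
      rw [Complex.exp_eq_one_iff] at h4
      obtain ⟨n, hn⟩ := h4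
      have h5 : ‖z‖ * x < 1 := by
        calc ‖z‖ * x ≤ ‖z‖ * M := by gcongr; exact hxM.2
          _ < 1 / M * M := by gcongr
          _ = 1 := by field_simp
      have h6 : ‖z‖ * x = |(n : ℝ)| * (2 * Real.pi) := by
        have := congrArg norm hn
        simp only [norm_neg, norm_mul, Complex.norm_real, Complex.norm_intCast, Complex.norm_I,
          mul_one, Real.norm_eq_abs, abs_of_pos hxM.1] at this
        rw [this]; simp [abs_of_pos Real.pi_pos]
      have h7 : n = 0 := by
        by_contra hn0
        have : (1 : ℝ) ≤ |(n : ℝ)| := by exact_mod_cast Int.one_le_abs hn0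
        nlinarith [Real.pi_gt_three]
      rw [h7] at h6
      simp only [Int.cast_zero, abs_zero, zero_mul, mul_eq_zero, norm_eq_zero] at h6
      rcases h6 with h6 | h6
      · exact hz0 h6
      · exact hxM.1.ne' h6
    have : μ (Set.Ioc 0 M) = 0 := by
      have := ae_iff.1 h3
      simpa only [not_not, Set.ofPred_mem_eq] using this
    exact hM.ne' this
  · filter_upwards [ae_nonneg_of_Iio hμ] with x hx
    have := (Complex.re_le_norm _).trans (norm_exp_neg_mul_le_one hz hx)
    simp only [Pi.zero_apply]; linarith
  · exact (integrable_const _).sub hint.re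

/-- Compactness of the half-circle turns φ ≠ 1 into a uniform gap. A continuous exponent starting at
0 cannot cross ‖z‖ = r while φ of it stays within κ of 1. -/
lemma exists_laplace_barrier (hμ : μ (Set.Iio 0) = 0) (hμ0 : μ ≠ Measure.dirac 0) :
    ∃ r₀ : ℝ, 0 < r₀ ∧ ∀ r : ℝ, 0 < r → r < r₀ → ∃ κ : ℝ, 0 < κ ∧
      ∀ z : ℂ, 0 ≤ z.re → ‖z‖ = r → κ ≤ ‖1 - laplaceTransform μ z‖ := by
  obtain ⟨r₀, hr₀, h⟩ := exists_laplace_ne_one hμ hμ0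
  refine ⟨r₀, hr₀, fun r hr hrr => ?_⟩
  let K : Set ℂ := {z | 0 ≤ z.re} ∩ Metric.sphere 0 r
  have hK : IsCompact K :=
    (isCompact_sphere _ _).inter_left (isClosed_le continuous_const Complex.continuous_re)
  have hne : K.Nonempty := ⟨(r : ℂ), by simpa using hr.le, by simp [abs_of_pos hr]⟩
  have hc : ContinuousOn (fun z => ‖1 - laplaceTransform μ z‖) K :=
    (continuousOn_const.sub ((continuousOn_laplace hμ).mono Set.inter_subset_left)).norm
  obtain ⟨z₀, hz₀, hmin⟩ := hK.exists_isMinOn hne hc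
  refine ⟨‖1 - laplaceTransform μ z₀‖, ?_, fun z hz hzr => hmin ⟨hz, by simpa using hzr⟩⟩
  rw [norm_pos_iff, sub_ne_zero]
  have hzn : ‖z₀‖ = r := by simpa using hz₀.2
  refine (h z₀ hz₀.1 ?_ (by rw [hzn]; exact hrr)).symm
  rw [← norm_pos_iff, hzn]; exact hr

end Laplace


/-! ### Maximum principles on the half-plane. -/

section HalfPlane

/-- The argument of t^y is at most (π/2)(1/2) = π/4 in modulus, below π/3, where the cosine is 1/2.
-/
lemma half_rpow_le_re_cpow {t : ℂ} (ht : 0 ≤ t.re) {y : ℝ} (hy : |y| ≤ 1 / 2) :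
    ‖t‖ ^ y / 2 ≤ (t ^ (y : ℂ)).re := by
  rw [Complex.cpow_ofReal_re]
  have h1 : |t.arg| ≤ Real.pi / 2 := Complex.abs_arg_le_pi_div_two_iff.2 ht
  have h2 : (1 : ℝ) / 2 ≤ Real.cos (t.arg * y) := by
    rw [← Real.cos_abs, ← Real.cos_pi_div_three]
    apply Real.cos_le_cos_of_nonneg_of_le_pi (abs_nonneg _)
    · linarith [Real.pi_pos]
    · rw [abs_mul]
      have := mul_le_mul h1 hy (abs_nonneg _) (by positivity)
      linarith [Real.pi_pos]
  have := Real.rpow_nonneg (norm_nonneg t) y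
  nlinarith

/-- A Phragmén–Lindelöf principle on open subsets of the right half-plane: the origin and infinity
may be neglected for bounded functions. -/
lemma im_nonpos_of_frontier {B : Set ℂ} (hB : IsOpen B) (hsub : B ⊆ {t | 0 < t.re}) {E : ℂ → ℂ}
    (hd : DifferentiableOn ℂ E B) (hc : ContinuousOn E (closure B \ {0})) {M : ℝ}
    (hM : ∀ t ∈ B, ‖E t‖ ≤ M) (hf : ∀ t ∈ frontier B, t ≠ 0 → (E t).im ≤ 0) :
    ∀ t ∈ B, (E t).im ≤ 0 := by
  intro t₀ ht₀
  have ht₀0 : 0 < ‖t₀‖ := by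
    rw [norm_pos_iff]; rintro rfl; simpa using hsub ht₀
  -- The barrier function: Re w tends to infinity both at 0 and at infinity, so ε w dominates the
  -- bounded E at the two neglected points.
  set w : ℂ → ℂ := fun t => t ^ ((1 / 2 : ℝ) : ℂ) + t ^ ((-(1 / 2) : ℝ) : ℂ) with hw
  have hclre : closure B ⊆ {t | 0 ≤ t.re} :=
    closure_minimal (fun t ht => (show 0 < t.re from hsub ht).le)
      (isClosed_le continuous_const Complex.continuous_re)
  have hwre : ∀ t : ℂ, 0 ≤ t.re → ‖t‖ ^ (1 / 2 : ℝ) / 2 + ‖t‖ ^ (-(1 / 2) : ℝ) / 2 ≤ (w t).re := by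
    intro t ht
    rw [hw, Complex.add_re]
    exact add_le_add (half_rpow_le_re_cpow ht (by norm_num [abs_of_pos]))
      (half_rpow_le_re_cpow ht (by rw [abs_neg]; norm_num [abs_of_pos]))
  have hslit : ∀ t : ℂ, 0 ≤ t.re → t ≠ 0 → t ∈ Complex.slitPlane := by
    intro t ht h0
    rw [Complex.mem_slitPlane_iff]
    by_contra! h
    exact h0 (Complex.ext (le_antisymm h.1 ht) h.2)
  have key : ∀ ε : ℝ, 0 < ε → (E t₀).im ≤ ε * (w t₀).re := by
    intro ε hε
    obtain ⟨R, hR1, hRt, hRt', hRM⟩ : ∃ R : ℝ, 1 < R ∧ ‖t₀‖ < R ∧ R⁻¹ < ‖t₀‖ ∧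
        M ≤ ε * (R ^ (1 / 2 : ℝ) / 2) := by
      have h1 : ∀ᶠ R : ℝ in atTop, M ≤ ε * (R ^ (1 / 2 : ℝ) / 2) := by
        have : Tendsto (fun R : ℝ => ε * (R ^ (1 / 2 : ℝ) / 2)) atTop atTop :=
          ((tendsto_rpow_atTop (by norm_num)).atTop_div_const (by norm_num)).const_mul_atTop hε
        exact this.eventually_ge_atTop M
      have h2 : ∀ᶠ R : ℝ in atTop, R⁻¹ < ‖t₀‖ :=
        tendsto_inv_atTop_zero.eventually_lt_const ht₀0
      obtain ⟨R, h⟩ := ((eventually_gt_atTop 1).and ((eventually_gt_atTop ‖t₀‖).and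
        (h2.and h1))).exists
      exact ⟨R, h⟩
    have hR0 : 0 < R := by linarith
    set V : Set ℂ := B ∩ {t | R⁻¹ < ‖t‖ ∧ ‖t‖ < R} with hV
    have hVo : IsOpen V := hB.inter
      ((isOpen_lt continuous_const continuous_norm).inter
        (isOpen_lt continuous_norm continuous_const))
    have hVb : Bornology.IsBounded V :=
      (Metric.isBounded_ball (x := (0 : ℂ)) (r := R)).subset fun t ht => by
        simpa using ht.2.2
    have hVcl : closure V ⊆ closure B ∩ {t | R⁻¹ ≤ ‖t‖ ∧ ‖t‖ ≤ R} := by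
      refine Set.subset_inter (closure_mono Set.inter_subset_left) ?_
      refine closure_minimal (fun t ht => ⟨ht.2.1.le, ht.2.2.le⟩) ?_
      exact (isClosed_le continuous_const continuous_norm).inter
        (isClosed_le continuous_norm continuous_const)
    have hVcl0 : closure V ⊆ closure B \ {0} := by
      intro t ht
      refine ⟨(hVcl ht).1, ?_⟩
      rintro rfl
      have := (hVcl ht).2.1
      rw [norm_zero] at this
      exact absurd this (not_le.2 (by positivity))
    -- Its modulus is exp(Im E - ε Re w), so the maximum modulus principle for G bounds Im E by ε Re
    -- w.
    set G : ℂ → ℂ := fun t => Complex.exp (-(Complex.I * E t) - ε * w t) with hG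
    have hGn : ∀ t, ‖G t‖ = Real.exp ((E t).im - ε * (w t).re) := by
      intro t
      rw [hG, Complex.norm_exp]; simp
    have hwd : ∀ t ∈ Complex.slitPlane, DifferentiableAt ℂ w t := by
      intro t ht
      rw [hw]
      exact (differentiableAt_id.cpow_const ht).add (differentiableAt_id.cpow_const ht)
    have hGd : DiffContOnCl ℂ G V := by
      constructor
      · intro t ht
        have h1 : DifferentiableAt ℂ E t := hd.differentiableAt (hB.mem_nhds ht.1)
        have ht' : 0 < t.re := hsub ht.1
        have h2 := hwd t (hslit t ht'.le (by rintro rfl; simp at ht'))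
        exact (((h1.const_mul _).neg.sub (h2.const_mul _)).cexp).differentiableWithinAt
      · have h1 : ContinuousOn E (closure V) := hc.mono hVcl0
        have h2 : ContinuousOn w (closure V) := fun t ht =>
          (hwd t (hslit t (hclre (hVcl0 ht).1) (hVcl0 ht).2)).continuousAt.continuousWithinAt
        exact ((continuousOn_const.mul h1).neg.sub (continuousOn_const.mul h2)).cexp
    have hbd : ∀ t ∈ frontier V, ‖G t‖ ≤ 1 := by
      intro t ht
      rw [hGn, Real.exp_le_one_iff]
      have htV : t ∉ V := by
        rw [hVo.frontier_eq] at ht; exact ht.2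
      have htc := frontier_subset_closure ht
      have h0 := hVcl0 htc
      have hre := hwre t (hclre h0.1)
      have hp1 := Real.rpow_nonneg (norm_nonneg t) (1 / 2)
      have hp2 := Real.rpow_nonneg (norm_nonneg t) (-(1 / 2))
      by_cases htB : t ∈ B
      · have hMt := ((Complex.abs_im_le_norm (E t)).trans (hM t htB))
        have hMt' := (le_abs_self _).trans hMt
        have hor : ‖t‖ = R⁻¹ ∨ ‖t‖ = R := by
          by_contra! h
          exact htV ⟨htB, lt_of_le_of_ne (hVcl htc).2.1 h.1.symm,
            lt_of_le_of_ne (hVcl htc).2.2 h.2⟩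
        have hlow : R ^ (1 / 2 : ℝ) / 2 ≤ (w t).re := by
          rcases hor with h | h
          · have : ‖t‖ ^ (-(1 / 2) : ℝ) = R ^ (1 / 2 : ℝ) := by
              rw [h, Real.inv_rpow hR0.le, ← Real.rpow_neg hR0.le, neg_neg]
            linarith
          · rw [h] at hre hp2; linarith
        nlinarith
      · have : t ∈ frontier B := by
          rw [hB.frontier_eq]; exact ⟨h0.1, htB⟩
        have h1 := hf t this h0.2
        have : 0 ≤ (w t).re := by linarith
        nlinarith
    have := Complex.norm_le_of_forall_mem_frontier_norm_le hVb hGd hbd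
      (subset_closure (⟨ht₀, hRt', hRt⟩ : t₀ ∈ V))
    rw [hGn, Real.exp_le_one_iff] at this
    linarith
  have hlim : Tendsto (fun ε : ℝ => ε * (w t₀).re) (𝓝[>] 0) (𝓝 0) := by
    have : Tendsto (fun ε : ℝ => ε * (w t₀).re) (𝓝 0) (𝓝 (0 * (w t₀).re)) :=
      (continuous_id.mul continuous_const).tendsto 0
    rw [zero_mul] at this
    exact this.mono_left nhdsWithin_le_nhds
  exact ge_of_tendsto hlim (eventually_mem_nhdsWithin.mono fun ε hε => key ε hε)

/-- Boundary uniqueness for holomorphic functions on a half-disc. -/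
lemma eq_zero_of_boundary {h : ℂ → ℂ} {x ε : ℝ}
    (hd : DifferentiableOn ℂ h {t | ‖t - x‖ < ε ∧ 0 < t.im})
    (hc : ContinuousOn h {t | ‖t - x‖ < ε ∧ 0 ≤ t.im})
    (h0 : ∀ s : ℝ, |s - x| < ε → h s = 0) {p : ℂ} (hp : ‖p - x‖ < ε / 4) (hpi : 0 ≤ p.im) :
    h p = 0 := by
  rcases hpi.eq_or_lt with hpi | hpi
  · have hp' : p = (p.re : ℂ) := Complex.ext (by simp) (by simp [← hpi])
    rw [hp']
    apply h0
    have : ‖p - x‖ = |p.re - x| := by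
      rw [hp', ← Complex.ofReal_sub, Complex.norm_real]; simp
    rw [← this]
    linarith [norm_nonneg (p - x)]
  set d := p.im with hdef
  have hdε : d < ε / 4 := by
    have : |(p - x).im| ≤ ‖p - x‖ := Complex.abs_im_le_norm _
    simp only [Complex.sub_im, Complex.ofReal_im, sub_zero] at this
    linarith [le_abs_self p.im]
  -- The open square centred at p of half-side d = Im p: its lower side lies on the real axis.
  set W : Set ℂ := {w | |(w - p).re| < d ∧ |(w - p).im| < d} with hW
  have hcre : Continuous fun w : ℂ => |(w - p).re| := by fun_prop
  have hcim : Continuous fun w : ℂ => |(w - p).im| := by fun_prop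
  have hWo : IsOpen W :=
    (isOpen_lt hcre continuous_const).inter (isOpen_lt hcim continuous_const)
  have hWcl : closure W ⊆ {w | |(w - p).re| ≤ d ∧ |(w - p).im| ≤ d} := by
    refine closure_minimal (fun w hw => ⟨hw.1.le, hw.2.le⟩) ?_
    exact (isClosed_le hcre continuous_const).inter (isClosed_le hcim continuous_const)
  have hWn : ∀ w ∈ closure W, ‖w - p‖ ≤ 2 * d := by
    intro w hw
    have := hWcl hw
    calc ‖w - p‖ ≤ |(w - p).re| + |(w - p).im| := Complex.norm_le_abs_re_add_abs_im _
      _ ≤ 2 * d := by linarith [this.1, this.2]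
  have hball : ∀ u : ℂ, ‖u‖ = 1 → ∀ w ∈ closure W, ‖p + u * (w - p) - x‖ < ε := by
    intro u hu w hw
    calc ‖p + u * (w - p) - x‖ = ‖(p - x) + u * (w - p)‖ := by ring_nf
      _ ≤ ‖p - x‖ + ‖u * (w - p)‖ := norm_add_le _ _
      _ = ‖p - x‖ + ‖w - p‖ := by rw [norm_mul, hu, one_mul]
      _ < ε := by linarith [hWn w hw]
  have him : ∀ u : ℂ, (u = 1 ∨ u = -1 ∨ u = Complex.I ∨ u = -Complex.I) →
      (∀ w ∈ W, 0 < (p + u * (w - p)).im) ∧ (∀ w ∈ closure W, 0 ≤ (p + u * (w - p)).im) ∧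
      ‖u‖ = 1 := by
    intro u hu
    refine ⟨fun w hw => ?_, fun w hw => ?_, ?_⟩
    · have h1 := abs_lt.1 hw.1
      have h2 := abs_lt.1 hw.2
      rcases hu with rfl | rfl | rfl | rfl <;> simp at h1 h2 ⊢ <;> linarith
    · have h1 := abs_le.1 (hWcl hw).1
      have h2 := abs_le.1 (hWcl hw).2
      rcases hu with rfl | rfl | rfl | rfl <;> simp at h1 h2 ⊢ <;> linarith
    · rcases hu with rfl | rfl | rfl | rfl <;> simp
  have hcomp : ∀ u : ℂ, (u = 1 ∨ u = -1 ∨ u = Complex.I ∨ u = -Complex.I) →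
      DiffContOnCl ℂ (fun w => h (p + u * (w - p))) W := by
    intro u hu
    obtain ⟨h1, h2, h3⟩ := him u hu
    constructor
    · refine hd.comp (by fun_prop) fun w hw => ⟨hball u h3 w (subset_closure hw), h1 w hw⟩
    · refine hc.comp (by fun_prop) fun w hw => ⟨hball u h3 w hw, h2 w hw⟩
  have hzero : ∀ u : ℂ, (u = 1 ∨ u = -1 ∨ u = Complex.I ∨ u = -Complex.I) → ∀ w ∈ closure W,
      (p + u * (w - p)).im = 0 → h (p + u * (w - p)) = 0 := by
    intro u hu w hw hz
    set q := p + u * (w - p) with hq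
    have hqr : q = (q.re : ℂ) := Complex.ext (by simp) (by simp [hz])
    have hb := hball u (him u hu).2.2 w hw
    rw [← hq, hqr, ← Complex.ofReal_sub, Complex.norm_real] at hb
    rw [hqr]; exact h0 _ hb
  -- The product of h over the four quarter-turns of the square about p. Each side is carried to the
  -- lower side by one of them, so the product vanishes on the whole frontier, while its value at p
  -- is h(p)^4.
  have H := (((hcomp 1 (by simp)).smul (hcomp (-1) (by simp))).smul
    (hcomp Complex.I (by simp))).smul (hcomp (-Complex.I) (by simp))
  have hbd : Bornology.IsBounded W := (Metric.isBounded_closedBall (x := p) (r := 2 * d)).subset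
    fun w hw => by simpa [dist_eq_norm] using hWn w (subset_closure hw)
  have hpW : p ∈ W := by simp [hW, hpi]
  have := Complex.norm_le_of_forall_mem_frontier_norm_le hbd H (C := 0) ?_ (subset_closure hpW)
  · simpa [← pow_two, ← pow_succ, norm_le_zero_iff] using
      (show ‖h p‖ ^ 4 ≤ 0 by simpa [pow_succ] using this).antisymm (by positivity)
  intro w hw
  have hwc := frontier_subset_closure hw
  have hwn : w ∉ W := by rw [hWo.frontier_eq] at hw; exact hw.2
  have hcl := hWcl hwc
  simp only [smul_eq_mul, norm_mul]
  have hor : |(w - p).re| = d ∨ |(w - p).im| = d := by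
    by_contra! hne
    exact hwn ⟨lt_of_le_of_ne hcl.1 hne.1, lt_of_le_of_ne hcl.2 hne.2⟩
  rcases hor with hr | hi
  · rcases eq_or_eq_neg_of_abs_eq hr with hr | hr
    · have := hzero (-Complex.I) (by simp) w hwc (by simp at hr ⊢; linarith)
      rw [this]; simp
    · have := hzero Complex.I (by simp) w hwc (by simp at hr ⊢; linarith)
      rw [this]; simp
  · rcases eq_or_eq_neg_of_abs_eq hi with hr | hr
    · have := hzero (-1) (by simp) w hwc (by simp at hr ⊢; linarith)
      rw [this]; simp
    · have := hzero 1 (by simp) w hwc (by simp at hr ⊢; linarith)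
      rw [this]; simp

end HalfPlane


/-! ### Half-plane exponents and the zero lines of their imaginary parts. -/

section Spine

/-- Holomorphic functions on the right half-plane with the analytic properties of exponents of
stable laws. -/
structure IsHalfPlaneExponent (P : ℂ → ℂ) : Prop where
  diff : DifferentiableOn ℂ P {t | 0 < t.re}
  cont : ContinuousOn P ({t | 0 ≤ t.re} \ {0})
  quot : ∀ t : ℂ, 0 ≤ t.re → t ≠ 0 → 0 ≤ t.re * (P t).re + t.im * (P t).im
  deriv_re : ∀ t : ℂ, 0 < t.re → 0 ≤ (deriv P t).re
  deriv_ne_zero : ∀ t : ℂ, 0 < t.re → deriv P t ≠ 0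
  ne_zero : ∀ t : ℂ, 0 < t.re → P t ≠ 0

/-- Reflection of a function in the real axis. -/
noncomputable def conjReflect (P : ℂ → ℂ) : ℂ → ℂ :=
  fun t => starRingEnd ℂ (P (starRingEnd ℂ t))

lemma isOpen_rightHalf : IsOpen {t : ℂ | 0 < t.re} :=
  isOpen_lt continuous_const Complex.continuous_re

namespace IsHalfPlaneExponent

variable {P Q : ℂ → ℂ}

lemma differentiableAt (hP : IsHalfPlaneExponent P) {t : ℂ} (ht : 0 < t.re) :
    DifferentiableAt ℂ P t :=
  hP.diff.differentiableAt (isOpen_rightHalf.mem_nhds ht)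

lemma conjReflect (hP : IsHalfPlaneExponent P) : IsHalfPlaneExponent (conjReflect P) where
  diff := by
    intro t ht
    have h : DifferentiableAt ℂ P (starRingEnd ℂ t) := hP.differentiableAt (by simpa using ht)
    have h2 := (h.hasDerivAt.conj_conj).differentiableAt
    rw [Complex.conj_conj] at h2
    exact h2.differentiableWithinAt
  cont := by
    unfold _root_.conjReflect
    apply Complex.continuous_conj.comp_continuousOn
    refine hP.cont.comp Complex.continuous_conj.continuousOn ?_
    intro t ht
    simpa using ht
  quot := by
    intro t ht h0
    have := hP.quot (starRingEnd ℂ t) (by simpa using ht) (by simpa using h0)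
    simpa [_root_.conjReflect] using this
  deriv_re := by
    intro t ht
    have h : DifferentiableAt ℂ P (starRingEnd ℂ t) := hP.differentiableAt (by simpa using ht)
    have h2 := h.hasDerivAt.conj_conj.deriv
    rw [Complex.conj_conj] at h2
    have h3 : deriv (_root_.conjReflect P) t = starRingEnd ℂ (deriv P (starRingEnd ℂ t)) := by
      rw [← h2]; rfl
    rw [h3, Complex.conj_re]
    exact hP.deriv_re _ (by simpa using ht)
  deriv_ne_zero := by
    intro t ht
    have h : DifferentiableAt ℂ P (starRingEnd ℂ t) := hP.differentiableAt (by simpa using ht)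
    have h2 := h.hasDerivAt.conj_conj.deriv
    rw [Complex.conj_conj] at h2
    have h3 : deriv (_root_.conjReflect P) t = starRingEnd ℂ (deriv P (starRingEnd ℂ t)) := by
      rw [← h2]; rfl
    rw [h3]
    simpa using hP.deriv_ne_zero (starRingEnd ℂ t) (by simpa using ht)
  ne_zero := by
    intro t ht
    simpa [_root_.conjReflect] using hP.ne_zero (starRingEnd ℂ t) (by simpa using ht)

lemma deriv_conjReflect (hP : IsHalfPlaneExponent P) {t : ℂ} (ht : 0 < t.re) :
    (deriv (_root_.conjReflect P) t).re = (deriv P (starRingEnd ℂ t)).re := by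
  have h : DifferentiableAt ℂ P (starRingEnd ℂ t) := hP.differentiableAt (by simpa using ht)
  have h2 := h.hasDerivAt.conj_conj.deriv
  rw [Complex.conj_conj] at h2
  have h3 : deriv (_root_.conjReflect P) t = starRingEnd ℂ (deriv P (starRingEnd ℂ t)) := by
    rw [← h2]; rfl
  rw [h3, Complex.conj_re]

lemma hasDerivAt_im_vertical (hP : IsHalfPlaneExponent P) {ξ : ℝ} (hξ : 0 < ξ) (η : ℝ) :
    HasDerivAt (fun η : ℝ => (P (ξ + η * Complex.I)).im)
      (deriv P (ξ + η * Complex.I)).re η := by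
  have h1 : HasDerivAt (fun y : ℂ => P (ξ + y * Complex.I))
      (deriv P (ξ + η * Complex.I) * Complex.I) (η : ℂ) := by
    have h2 : HasDerivAt P (deriv P (ξ + η * Complex.I)) (ξ + (η : ℂ) * Complex.I) :=
      (hP.differentiableAt (by simpa using hξ)).hasDerivAt
    have h3 : HasDerivAt (fun y : ℂ => (ξ : ℂ) + y * Complex.I) Complex.I (η : ℂ) := by
      simpa using ((hasDerivAt_id (η : ℂ)).mul_const Complex.I).const_add (ξ : ℂ)
    exact h2.comp (η : ℂ) h3
  have h4 := (Complex.imCLM.hasFDerivAt.comp_hasDerivAt η h1.comp_ofReal)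
  simpa [Function.comp_def] using h4

/-- By Cauchy–Riemann, Re P' is the derivative of Im P along vertical lines. Signs of Im P therefore
propagate vertically. -/
lemma monotone_im (hP : IsHalfPlaneExponent P) {ξ : ℝ} (hξ : 0 < ξ) :
    Monotone (fun η : ℝ => (P (ξ + η * Complex.I)).im) :=
  monotone_of_hasDerivAt_nonneg (fun η => hP.hasDerivAt_im_vertical hξ η)
    (fun η => hP.deriv_re _ (by simpa using hξ))

lemma strictMono_im (hP : IsHalfPlaneExponent P)
    (hs : ∀ t : ℂ, 0 < t.re → 0 < (deriv P t).re) {ξ : ℝ} (hξ : 0 < ξ) :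
    StrictMono (fun η : ℝ => (P (ξ + η * Complex.I)).im) := by
  refine strictMono_of_deriv_pos fun η => ?_
  rw [(hP.hasDerivAt_im_vertical hξ η).deriv]
  exact hs _ (by simpa using hξ)

lemma re_nonneg_ofReal (hP : IsHalfPlaneExponent P) {x : ℝ} (hx : 0 < x) : 0 ≤ (P x).re := by
  have := hP.quot x (by simpa using hx.le) (by exact_mod_cast hx.ne')
  simp only [Complex.ofReal_re, Complex.ofReal_im, zero_mul, add_zero] at this
  exact nonneg_of_mul_nonneg_right this hx

/-- The field `quot` says Re(P(t)/t) ≥ 0. For t in the open first quadrant, P(t) cannot then lie in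
the closed third quadrant, apart from 0, which `ne_zero` excludes. This puts P(t) in the domain of
analyticity of φ. -/
lemma re_pos_of_im_nonpos (hP : IsHalfPlaneExponent P) {t : ℂ} (ht : 0 < t.re) (hi : 0 < t.im)
    (h : (P t).im ≤ 0) : 0 < (P t).re := by
  have h1 := hP.quot t ht.le (by rintro rfl; simp at ht)
  rcases h.eq_or_lt with h | h
  · rw [h, mul_zero, add_zero] at h1
    refine lt_of_le_of_ne (nonneg_of_mul_nonneg_right h1 ht) fun h2 => hP.ne_zero t ht ?_
    exact Complex.ext h2.symm h
  · by_contra! h2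
    nlinarith [mul_nonneg ht.le (neg_nonneg.2 h2), mul_pos hi (neg_pos.2 h)]

lemma re_pos_of_im_nonneg (hP : IsHalfPlaneExponent P) {t : ℂ} (ht : 0 < t.re) (hi : t.im < 0)
    (h : 0 ≤ (P t).im) : 0 < (P t).re := by
  have := hP.conjReflect.re_pos_of_im_nonpos (t := starRingEnd ℂ t) (by simpa using ht)
    (by simpa using hi) (by simpa [_root_.conjReflect] using h)
  simpa [_root_.conjReflect] using this

end IsHalfPlaneExponent

variable {μ : Measure ℝ} [IsProbabilityMeasure μ] {P Q : ℂ → ℂ}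

/-- `φ ∘ P` and `φ ∘ Q` agree near the positive real axis, as far as both are defined. -/
def AgreeNearReal (μ : Measure ℝ) (P Q : ℂ → ℂ) : Prop :=
  ∀ x : ℝ, 0 < x → ∀ᶠ t in 𝓝 (x : ℂ), 0 ≤ (P t).re → 0 ≤ (Q t).re →
    laplaceTransform μ (P t) = laplaceTransform μ (Q t)

lemma AgreeNearReal.conjReflect (h : AgreeNearReal μ P Q) :
    AgreeNearReal μ (conjReflect P) (conjReflect Q) := by
  intro x hx
  have h1 : Tendsto (starRingEnd ℂ) (𝓝 (x : ℂ)) (𝓝 (x : ℂ)) := by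
    have := Complex.continuous_conj.tendsto (x : ℂ)
    rwa [Complex.conj_ofReal] at this
  filter_upwards [h1.eventually (h x hx)] with t ht hp hq
  simp only [_root_.conjReflect, Complex.conj_re] at hp hq ⊢
  rw [laplace_conj, laplace_conj, ht hp hq]

lemma differentiableAt_laplace_comp (hμ : μ (Set.Iio 0) = 0) {t : ℂ}
    (hd : DifferentiableAt ℂ P t) (hp : 0 < (P t).re) :
    DifferentiableAt ℂ (fun t => laplaceTransform μ (P t)) t :=
  ((differentiableOn_laplace hμ).differentiableAt (isOpen_rightHalf.mem_nhds hp)).comp t hd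

lemma analyticAt_laplace_comp (hμ : μ (Set.Iio 0) = 0) (hP : IsHalfPlaneExponent P) {t : ℂ}
    (ht : 0 < t.re) (hp : 0 < (P t).re) :
    AnalyticAt ℂ (fun t => laplaceTransform μ (P t)) t :=
  ((differentiableOn_laplace hμ).analyticAt (isOpen_rightHalf.mem_nhds hp)).fun_comp
    (hP.diff.analyticAt (isOpen_rightHalf.mem_nhds ht))

/-- On the vertical segment from the real axis up to t, monotonicity keeps Im P and Im Q
nonpositive. Hence Re P and Re Q are positive there, and the identity theorem carries the agreement
near the axis up to t. -/
lemma laplace_eq_of_im_nonpos (hμ : μ (Set.Iio 0) = 0) (hP : IsHalfPlaneExponent P)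
    (hQ : IsHalfPlaneExponent Q) (hH : AgreeNearReal μ P Q) {t : ℂ} (ht : 0 < t.re)
    (hi : 0 < t.im) (hpi : (P t).im ≤ 0) (hqi : (Q t).im ≤ 0) :
    laplaceTransform μ (P t) = laplaceTransform μ (Q t) := by
  set x := t.re with hx
  let e : ℝ → ℂ := fun η => x + η * Complex.I
  have he : Continuous e := by fun_prop
  have het : e t.im = t := by simp [e, hx, Complex.re_add_im]
  have here : ∀ η, (e η).re = x := fun η => by simp [e]
  have heim : ∀ η, (e η).im = η := fun η => by simp [e]
  have hPe : ∀ η ∈ Set.Ioc 0 t.im, 0 < (P (e η)).re := fun η hη =>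
    hP.re_pos_of_im_nonpos (by rw [here]; exact ht) (by rw [heim]; exact hη.1)
      ((hP.monotone_im ht hη.2).trans (by simpa [e, hx, Complex.re_add_im] using hpi))
  have hQe : ∀ η ∈ Set.Ioc 0 t.im, 0 < (Q (e η)).re := fun η hη =>
    hQ.re_pos_of_im_nonpos (by rw [here]; exact ht) (by rw [heim]; exact hη.1)
      ((hQ.monotone_im ht hη.2).trans (by simpa [e, hx, Complex.re_add_im] using hqi))
  have hpre : IsPreconnected (e '' Set.Ioc 0 t.im) :=
    isPreconnected_Ioc.image e he.continuousOn
  have hF : AnalyticOnNhd ℂ (fun t => laplaceTransform μ (P t)) (e '' Set.Ioc 0 t.im) := by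
    rintro _ ⟨η, hη, rfl⟩
    exact analyticAt_laplace_comp hμ hP (by rw [here]; exact ht) (hPe η hη)
  have hG : AnalyticOnNhd ℂ (fun t => laplaceTransform μ (Q t)) (e '' Set.Ioc 0 t.im) := by
    rintro _ ⟨η, hη, rfl⟩
    exact analyticAt_laplace_comp hμ hQ (by rw [here]; exact ht) (hQe η hη)
  have h0 : Tendsto e (𝓝[>] 0) (𝓝 (x : ℂ)) := by
    have : Tendsto e (𝓝 0) (𝓝 (e 0)) := he.tendsto 0
    simp only [e, Complex.ofReal_zero, zero_mul, add_zero] at this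
    exact this.mono_left nhdsWithin_le_nhds
  obtain ⟨η₀, h1, h2⟩ := ((h0.eventually (eventually_eventually_nhds.2 (hH x ht))).and
    (Ioc_mem_nhdsGT hi)).exists
  have hev : (fun t => laplaceTransform μ (P t)) =ᶠ[𝓝 (e η₀)]
      fun t => laplaceTransform μ (Q t) := by
    have hp : ∀ᶠ s in 𝓝 (e η₀), 0 < (P s).re :=
      (Complex.continuous_re.continuousAt.comp
        (hP.differentiableAt (by rw [here]; exact ht)).continuousAt).eventually_const_lt
        (hPe η₀ h2)
    have hq : ∀ᶠ s in 𝓝 (e η₀), 0 < (Q s).re :=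
      (Complex.continuous_re.continuousAt.comp
        (hQ.differentiableAt (by rw [here]; exact ht)).continuousAt).eventually_const_lt
        (hQe η₀ h2)
    filter_upwards [h1, hp, hq] with s hs hps hqs using hs hps.le hqs.le
  have := hF.eqOn_of_preconnected_of_eventuallyEq hG hpre ⟨η₀, h2, rfl⟩ hev
    ⟨t.im, ⟨hi, le_rfl⟩, rfl⟩
  simpa only [het] using this

lemma laplace_eq_of_im_nonneg (hμ : μ (Set.Iio 0) = 0) (hP : IsHalfPlaneExponent P)
    (hQ : IsHalfPlaneExponent Q) (hH : AgreeNearReal μ P Q) {t : ℂ} (ht : 0 < t.re)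
    (hi : t.im < 0) (hpi : 0 ≤ (P t).im) (hqi : 0 ≤ (Q t).im) :
    laplaceTransform μ (P t) = laplaceTransform μ (Q t) := by
  have := laplace_eq_of_im_nonpos hμ hP.conjReflect hQ.conjReflect hH.conjReflect
    (t := starRingEnd ℂ t) (by simpa using ht) (by simpa using hi)
    (by simpa [conjReflect] using hpi) (by simpa [conjReflect] using hqi)
  simp only [conjReflect, Complex.conj_conj, laplace_conj] at this
  exact (starRingEnd ℂ).injective this

lemma laplace_im_eq_zero {z : ℂ} (hz : z.im = 0) : (laplaceTransform μ z).im = 0 := by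
  have : z = (z.re : ℂ) := Complex.ext (by simp) (by simp [hz])
  rw [this, laplace_im_ofReal]

/-- A nontrivial Laplace transform is not constant near any point of the open half-plane. -/
lemma laplace_not_eventually_const (hμ : μ (Set.Iio 0) = 0) (hμ0 : μ ≠ Measure.dirac 0) {z : ℂ}
    (hz : 0 < z.re) (c : ℂ) : ¬ ∀ᶠ w in 𝓝 z, laplaceTransform μ w = c := by
  intro h
  have hpre : IsPreconnected {t : ℂ | 0 < t.re} :=
    (convex_halfSpace_re_gt 0).isPreconnected
  have han : AnalyticOnNhd ℂ (laplaceTransform μ) {t : ℂ | 0 < t.re} :=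
    (differentiableOn_laplace hμ).analyticOnNhd isOpen_rightHalf
  have := han.eqOn_of_preconnected_of_eventuallyEq (g := fun _ => c) analyticOnNhd_const hpre hz h
  have h1 : laplaceTransform μ ((1 : ℝ) : ℂ) = c := this (by simp)
  have h2 : laplaceTransform μ ((2 : ℝ) : ℂ) = c := this (by simp)
  have := laplace_strictAnti hμ hμ0 zero_le_one (one_lt_two)
  rw [h1, h2] at this
  exact lt_irrefl _ this

/-- P is locally open, so φ∘P is not locally constant; by the open mapping theorem its values cover
a disc and cannot all be real. -/
lemma not_im_laplace_comp_eq_zero (hμ : μ (Set.Iio 0) = 0) (hμ0 : μ ≠ Measure.dirac 0)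
    (hP : IsHalfPlaneExponent P) {t : ℂ} (ht : 0 < t.re) (hp : 0 < (P t).re)
    (hd : deriv P t ≠ 0) :
    ¬ ∀ᶠ s in 𝓝 t, (laplaceTransform μ (P s)).im = 0 := by
  intro h
  have han := analyticAt_laplace_comp hμ hP ht hp
  have hPa := hP.diff.analyticAt (isOpen_rightHalf.mem_nhds ht)
  have hopen : map P (𝓝 t) = 𝓝 (P t) := by
    have := (hPa.hasStrictDerivAt).map_nhds_eq hd
    exact this
  rcases han.eventually_constant_or_nhds_le_map_nhds with hc | hn
  · refine laplace_not_eventually_const hμ hμ0 hp (laplaceTransform μ (P t)) ?_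
    rw [← hopen]
    exact eventually_map.2 hc
  · have h1 : ∀ᶠ w in 𝓝 (laplaceTransform μ (P t)), w.im = 0 :=
      hn (eventually_map.2 h)
    obtain ⟨ε, hε, hb⟩ := Metric.eventually_nhds_iff.1 h1
    have h2 := hb (y := laplaceTransform μ (P t) + (ε / 2 : ℝ) * Complex.I) (by
      simp [abs_of_pos hε]; linarith)
    have h3 := hb (y := laplaceTransform μ (P t)) (by simpa using hε)
    simp at h2 h3
    rw [h3] at h2
    linarith

/-- The spines `Im P = 0` and `Im Q = 0` do not separate the half-plane differently. -/
lemma not_im_neg_and_im_pos (hμ : μ (Set.Iio 0) = 0) (hμ0 : μ ≠ Measure.dirac 0)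
    (hP : IsHalfPlaneExponent P) (hQ : IsHalfPlaneExponent Q)
    (hPr : ∀ x : ℝ, 0 < x → 0 < (P x).re) (hH : AgreeNearReal μ P Q) {t₀ : ℂ} (ht₀ : 0 < t₀.re)
    (hp₀ : (P t₀).im < 0) (hq₀ : 0 < (Q t₀).im) : False := by
  set B : Set ℂ := {t | 0 < t.re ∧ (P t).im < 0 ∧ 0 < (Q t).im} with hBdef
  have hBo : IsOpen B := by
    rw [isOpen_iff_mem_nhds]
    rintro t ⟨h1, h2, h3⟩
    have e1 : ∀ᶠ s in 𝓝 t, 0 < s.re := isOpen_rightHalf.mem_nhds h1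
    have e2 : ∀ᶠ s in 𝓝 t, (P s).im < 0 := (Complex.continuous_im.continuousAt.comp
      (hP.differentiableAt h1).continuousAt).eventually_lt_const h2
    have e3 : ∀ᶠ s in 𝓝 t, 0 < (Q s).im := (Complex.continuous_im.continuousAt.comp
      (hQ.differentiableAt h1).continuousAt).eventually_const_lt h3
    filter_upwards [e1, e2, e3] with s a b c using ⟨a, b, c⟩
  have hBsub : B ⊆ {t | 0 < t.re} := fun t ht => ht.1
  have hPB : ∀ t ∈ B, 0 ≤ t.im → 0 < (P t).re := by
    intro t ht hi
    rcases hi.eq_or_lt with hi | hi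
    · have : t = (t.re : ℂ) := Complex.ext (by simp) (by simp [← hi])
      rw [this]; exact hPr _ ht.1
    · exact hP.re_pos_of_im_nonpos ht.1 hi ht.2.1.le
  have hQB : ∀ t ∈ B, t.im < 0 → 0 < (Q t).re := fun t ht hi =>
    hQ.re_pos_of_im_nonneg ht.1 hi ht.2.2.le
  -- In B the sign of Im P gives Re P > 0 on and above the axis, and the sign of Im Q gives Re Q > 0
  -- below it. Each branch is used where it is known to be defined, and they fit together across the
  -- axis by `AgreeNearReal`.
  set E : ℂ → ℂ := fun t =>
    if 0 ≤ t.im then laplaceTransform μ (P t) else laplaceTransform μ (Q t) with hE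
  have hEpos : ∀ t ∈ B, 0 < t.im → E =ᶠ[𝓝 t] fun t => laplaceTransform μ (P t) := by
    intro t _ hi
    have : ∀ᶠ s in 𝓝 t, 0 < s.im :=
      Complex.continuous_im.continuousAt.eventually_const_lt hi
    filter_upwards [this] with s hs
    simp [hE, hs.le]
  have hEneg : ∀ t ∈ B, t.im < 0 → E =ᶠ[𝓝 t] fun t => laplaceTransform μ (Q t) := by
    intro t _ hi
    have : ∀ᶠ s in 𝓝 t, s.im < 0 :=
      Complex.continuous_im.continuousAt.eventually_lt_const hi
    filter_upwards [this] with s hs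
    simp [hE, not_le.2 hs]
  have hEzero : ∀ t ∈ B, t.im = 0 → E =ᶠ[𝓝 t] fun t => laplaceTransform μ (P t) := by
    intro t ht hi
    have htr : t = (t.re : ℂ) := Complex.ext (by simp) (by simp [hi])
    have h1 := hH t.re ht.1
    rw [← htr] at h1
    have h2 : ∀ᶠ s in 𝓝 t, 0 < (P s).re := (Complex.continuous_re.continuousAt.comp
      (hP.differentiableAt ht.1).continuousAt).eventually_const_lt (hPB t ht hi.ge)
    filter_upwards [h1, h2, hBo.mem_nhds ht] with s hs hps hsB
    simp only [hE]
    split_ifs with hsi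
    · rfl
    · exact (hs hps.le (hQB s hsB (not_le.1 hsi)).le).symm
  have hEd : DifferentiableOn ℂ E B := by
    intro t ht
    apply DifferentiableAt.differentiableWithinAt
    rcases lt_trichotomy t.im 0 with hi | hi | hi
    · exact (differentiableAt_laplace_comp hμ (hQ.differentiableAt ht.1) (hQB t ht hi)).congr_of_eventuallyEq
        (hEneg t ht hi)
    · exact (differentiableAt_laplace_comp hμ (hP.differentiableAt ht.1)
        (hPB t ht hi.ge)).congr_of_eventuallyEq (hEzero t ht hi)
    · exact (differentiableAt_laplace_comp hμ (hP.differentiableAt ht.1)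
        (hPB t ht hi.le)).congr_of_eventuallyEq (hEpos t ht hi)
  have hclre : closure B \ {0} ⊆ {t | 0 ≤ t.re} \ {0} := by
    refine Set.sdiff_subset_sdiff_left (closure_minimal (fun t ht => (show 0 < t.re from ht.1).le)
      (isClosed_le continuous_const Complex.continuous_re))
  have hcl : ∀ t ∈ closure B, t ≠ 0 → (P t).im ≤ 0 ∧ 0 ≤ (Q t).im ∧
      (0 < t.im → 0 ≤ (P t).re) ∧ (t.im < 0 → 0 ≤ (Q t).re) := by
    intro t ht h0
    have hPc : ContinuousWithinAt P B t := (hP.cont t (hclre ⟨ht, h0⟩)).mono fun s hs =>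
      ⟨le_of_lt hs.1, by rintro rfl; simpa using hs.1⟩
    have hQc : ContinuousWithinAt Q B t := (hQ.cont t (hclre ⟨ht, h0⟩)).mono fun s hs =>
      ⟨le_of_lt hs.1, by rintro rfl; simpa using hs.1⟩
    have hne : (𝓝[B] t).NeBot := mem_closure_iff_nhdsWithin_neBot.1 ht
    refine ⟨?_, ?_, ?_, ?_⟩
    · exact le_of_tendsto ((Complex.continuous_im.tendsto _).comp hPc)
        (eventually_mem_nhdsWithin.mono fun s hs => hs.2.1.le)
    · exact ge_of_tendsto ((Complex.continuous_im.tendsto _).comp hQc)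
        (eventually_mem_nhdsWithin.mono fun s hs => hs.2.2.le)
    · intro hi
      have : ∀ᶠ s in 𝓝[B] t, 0 < s.im := nhdsWithin_le_nhds
        (Complex.continuous_im.continuousAt.eventually_const_lt hi)
      refine ge_of_tendsto ((Complex.continuous_re.tendsto _).comp hPc) ?_
      filter_upwards [this, eventually_mem_nhdsWithin] with s hs hsB using (hPB s hsB hs.le).le
    · intro hi
      have : ∀ᶠ s in 𝓝[B] t, s.im < 0 := nhdsWithin_le_nhds
        (Complex.continuous_im.continuousAt.eventually_lt_const hi)
      refine ge_of_tendsto ((Complex.continuous_re.tendsto _).comp hQc) ?_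
      filter_upwards [this, eventually_mem_nhdsWithin] with s hs hsB using (hQB s hsB hs).le
  have hreal : ∀ t : ℂ, 0 ≤ t.re → t ≠ 0 → t.im = 0 →
      0 ≤ (P t).re ∧ 0 ≤ (Q t).re ∧ laplaceTransform μ (P t) = laplaceTransform μ (Q t) := by
    intro t h1 h2 h3
    have htr : t = (t.re : ℂ) := Complex.ext (by simp) (by simp [h3])
    have hx : 0 < t.re := lt_of_le_of_ne h1 fun h => h2 (Complex.ext h.symm h3)
    have hp := (hPr t.re hx).le
    have hq := hQ.re_nonneg_ofReal hx
    have := (hH t.re hx).self_of_nhds hp hq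
    rw [← htr] at hp hq this
    exact ⟨hp, hq, this⟩
  have hEc : ContinuousOn E (closure B \ {0}) := by
    have hφ := continuousOn_laplace hμ
    refine ContinuousOn.if ?_ ?_ ?_
    · rintro t ⟨⟨htc, h0⟩, hfr⟩
      have hi : t.im = 0 := by
        have : frontier {a : ℂ | 0 ≤ a.im} ⊆ {a | 0 = a.im} :=
          frontier_le_subset_eq continuous_const Complex.continuous_im
        exact (this hfr).symm
      exact (hreal t (hclre ⟨htc, h0⟩).1 h0 hi).2.2
    · refine hφ.comp (hP.cont.mono ?_) ?_
      · exact fun t ht => hclre ht.1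
      · rintro t ⟨⟨htc, h0⟩, hi⟩
        have hi' : 0 ≤ t.im := by
          have := closure_minimal (fun a (ha : a ∈ {a : ℂ | 0 ≤ a.im}) => ha)
            (isClosed_le continuous_const Complex.continuous_im)
          exact this hi
        rcases hi'.eq_or_lt with h | h
        · exact (hreal t (hclre ⟨htc, h0⟩).1 h0 h.symm).1
        · exact (hcl t htc h0).2.2.1 h
    · refine hφ.comp (hQ.cont.mono ?_) ?_
      · exact fun t ht => hclre ht.1
      · rintro t ⟨⟨htc, h0⟩, hi⟩
        have hi' : t.im ≤ 0 := by
          have := closure_minimal (s := {a : ℂ | ¬ 0 ≤ a.im}) (t := {a : ℂ | a.im ≤ 0})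
            (fun a ha => (not_le.1 ha).le)
            (isClosed_le Complex.continuous_im continuous_const)
          exact this hi
        rcases hi'.eq_or_lt with h | h
        · exact (hreal t (hclre ⟨htc, h0⟩).1 h0 h).2.1
        · exact (hcl t htc h0).2.2.2 h
  have hEb : ∀ t ∈ B, ‖E t‖ ≤ 1 := by
    intro t ht
    simp only [hE]
    split_ifs with hi
    · exact norm_laplace_le_one hμ (hPB t ht hi).le
    · exact norm_laplace_le_one hμ (hQB t ht (not_le.1 hi)).le
  -- At a frontier point Im P or Im Q vanishes. If it is the one entering E, then E is real at once;
  -- otherwise the equality φ(P) = φ(Q), available for these signs, transfers reality.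
  have hEf : ∀ t ∈ frontier B, t ≠ 0 → (E t).im = 0 := by
    intro t ht h0
    have htc := frontier_subset_closure ht
    have htB : t ∉ B := by rw [hBo.frontier_eq] at ht; exact ht.2
    have htr : 0 ≤ t.re := (hclre ⟨htc, h0⟩).1
    obtain ⟨hp, hq, hp', hq'⟩ := hcl t htc h0
    rcases lt_trichotomy t.im 0 with hi | hi | hi
    · have hEt : E t = laplaceTransform μ (Q t) := by simp [hE, not_le.2 hi]
      rw [hEt]
      rcases hq.eq_or_lt with hq | hq
      · exact laplace_im_eq_zero hq.symm
      · have hqt := hQ.quot t htr h0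
        -- On the imaginary axis `quot` reads Im t · Im Q ≥ 0, which fails for Im t < 0 < Im Q.
        have hre : 0 < t.re := by
          rcases htr.eq_or_lt with h | h
          · rw [← h] at hqt; nlinarith
          · exact h
        have hp0 : (P t).im = 0 := by
          by_contra hne
          exact htB ⟨hre, lt_of_le_of_ne hp hne, hq⟩
        rw [← laplace_eq_of_im_nonneg hμ hP hQ hH hre hi hp0.ge hq.le]
        exact laplace_im_eq_zero hp0
    · have hEt : E t = laplaceTransform μ (P t) := by simp [hE, hi]
      rw [hEt]
      have hre : 0 < t.re := lt_of_le_of_ne htr fun h => h0 (Complex.ext h.symm hi)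
      by_cases hp0 : (P t).im = 0
      · exact laplace_im_eq_zero hp0
      · have hq0 : (Q t).im = 0 := by
          by_contra hne
          exact htB ⟨hre, lt_of_le_of_ne hp hp0, lt_of_le_of_ne hq (Ne.symm hne)⟩
        rw [(hreal t htr h0 hi).2.2]
        exact laplace_im_eq_zero hq0
    · have hEt : E t = laplaceTransform μ (P t) := by simp [hE, hi.le]
      rw [hEt]
      rcases hp.eq_or_lt with hp | hp
      · exact laplace_im_eq_zero hp
      · have hpt := hP.quot t htr h0
        have hre : 0 < t.re := by
          rcases htr.eq_or_lt with h | h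
          · rw [← h] at hpt; nlinarith
          · exact h
        have hq0 : (Q t).im = 0 := by
          by_contra hne
          exact htB ⟨hre, hp, lt_of_le_of_ne hq (Ne.symm hne)⟩
        rw [laplace_eq_of_im_nonpos hμ hP hQ hH hre hi hp.le hq0.le]
        exact laplace_im_eq_zero hq0
  have hEim : ∀ t ∈ B, (E t).im = 0 := by
    intro t ht
    have h1 := im_nonpos_of_frontier hBo hBsub hEd hEc hEb (fun t ht h0 => (hEf t ht h0).le) t ht
    have h2 := im_nonpos_of_frontier hBo hBsub (E := fun t => -E t) hEd.neg hEc.neg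
      (M := 1) (fun t ht => by rw [norm_neg]; exact hEb t ht)
      (fun t ht h0 => by simp [hEf t ht h0]) t ht
    rw [Complex.neg_im] at h2
    linarith
  obtain ⟨t, ht, hti⟩ : ∃ t ∈ B, t.im ≠ 0 := by
    by_contra! hall
    obtain ⟨ε, hε, hb⟩ := Metric.isOpen_iff.1 hBo t₀ ⟨ht₀, hp₀, hq₀⟩
    have h1 := hall t₀ ⟨ht₀, hp₀, hq₀⟩
    have h2 := hall (t₀ + (ε / 2 : ℝ) * Complex.I) (hb (by simp [abs_of_pos hε]; linarith))
    simp [h1] at h2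
    exact hε.ne' h2
  have hev : ∀ᶠ s in 𝓝 t, (E s).im = 0 := by
    filter_upwards [hBo.mem_nhds ht] with s hs using hEim s hs
  rcases lt_or_gt_of_ne hti with hi | hi
  · refine not_im_laplace_comp_eq_zero hμ hμ0 hQ ht.1 (hQB t ht hi) (hQ.deriv_ne_zero t ht.1) ?_
    filter_upwards [hev, hEneg t ht hi] with s h1 h2
    rw [← h2]; exact h1
  · refine not_im_laplace_comp_eq_zero hμ hμ0 hP ht.1 (hPB t ht hi.le)
      (hP.deriv_ne_zero t ht.1) ?_
    filter_upwards [hev, hEpos t ht hi] with s h1 h2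
    rw [← h2]; exact h1

end Spine


/-! ### Uniqueness of half-plane exponents. -/

section SpineUniqueness

variable {μ : Measure ℝ} [IsProbabilityMeasure μ] {P Q : ℂ → ℂ}

lemma not_im_pos_and_im_neg (hμ : μ (Set.Iio 0) = 0) (hμ0 : μ ≠ Measure.dirac 0)
    (hP : IsHalfPlaneExponent P) (hQ : IsHalfPlaneExponent Q)
    (hPr : ∀ x : ℝ, 0 < x → 0 < (P x).re) (hH : AgreeNearReal μ P Q) {t₀ : ℂ} (ht₀ : 0 < t₀.re)
    (hp₀ : 0 < (P t₀).im) (hq₀ : (Q t₀).im < 0) : False := by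
  refine not_im_neg_and_im_pos hμ hμ0 hP.conjReflect hQ.conjReflect ?_ hH.conjReflect
    (t₀ := starRingEnd ℂ t₀) (by simpa using ht₀) (by simpa [conjReflect] using hp₀)
    (by simpa [conjReflect] using hq₀)
  intro x hx
  simpa [conjReflect] using hPr x hx

/-- Just below t one has Im P < 0 and just above Im P > 0, and Im Q cannot have the opposite strict
sign, so Im Q(t) = 0 by continuity. Both values are then real and nonnegative, where φ is injective.
Strict monotonicity is needed for P only, so that Q may be linear. -/
lemma eq_of_im_eq_zero (hμ : μ (Set.Iio 0) = 0) (hμ0 : μ ≠ Measure.dirac 0)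
    (hP : IsHalfPlaneExponent P) (hQ : IsHalfPlaneExponent Q)
    (hPs : ∀ t : ℂ, 0 < t.re → 0 < (deriv P t).re)
    (hPr : ∀ x : ℝ, 0 < x → 0 < (P x).re) (hH : AgreeNearReal μ P Q) {t : ℂ} (ht : 0 < t.re)
    (hp : (P t).im = 0) : P t = Q t := by
  have hm := hP.strictMono_im hPs ht
  have het : (t.re : ℂ) + t.im * Complex.I = t := Complex.re_add_im t
  have hQc : ContinuousAt (fun η : ℝ => (Q (t.re + η * Complex.I)).im) t.im :=
    (hQ.hasDerivAt_im_vertical ht t.im).continuousAt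
  have hq : (Q t).im = 0 := by
    apply le_antisymm
    · have h1 : Tendsto (fun η : ℝ => (Q (t.re + η * Complex.I)).im) (𝓝[<] t.im)
          (𝓝 (Q t).im) := by
        have := hQc.tendsto
        rw [het] at this
        exact this.mono_left nhdsWithin_le_nhds
      refine le_of_tendsto h1 (eventually_mem_nhdsWithin.mono fun η hη => ?_)
      have h2 : (P (t.re + η * Complex.I)).im < 0 := by
        have := hm hη
        simp only [het, hp] at this
        exact this
      by_contra! h3
      exact not_im_neg_and_im_pos hμ hμ0 hP hQ hPr hH (by simpa using ht) h2 h3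
    · have h1 : Tendsto (fun η : ℝ => (Q (t.re + η * Complex.I)).im) (𝓝[>] t.im)
          (𝓝 (Q t).im) := by
        have := hQc.tendsto
        rw [het] at this
        exact this.mono_left nhdsWithin_le_nhds
      refine ge_of_tendsto h1 (eventually_mem_nhdsWithin.mono fun η hη => ?_)
      have h2 : 0 < (P (t.re + η * Complex.I)).im := by
        have := hm hη
        simp only [het, hp] at this
        exact this
      by_contra! h3
      exact not_im_pos_and_im_neg hμ hμ0 hP hQ hPr hH (by simpa using ht) h2 h3
  rcases lt_trichotomy t.im 0 with hi | hi | hi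
  · exact laplace_injOn_real hμ hμ0 (hP.re_pos_of_im_nonneg ht hi hp.ge).le
      (hQ.re_pos_of_im_nonneg ht hi hq.ge).le hp hq
      (laplace_eq_of_im_nonneg hμ hP hQ hH ht hi hp.ge hq.ge)
  · have htr : t = (t.re : ℂ) := Complex.ext (by simp) (by simp [hi])
    have h1 := (hPr t.re ht).le
    have h2 := hQ.re_nonneg_ofReal ht
    have h3 := (hH t.re ht).self_of_nhds h1 h2
    rw [← htr] at h1 h2 h3
    exact laplace_injOn_real hμ hμ0 h1 h2 hp hq h3
  · exact laplace_injOn_real hμ hμ0 (hP.re_pos_of_im_nonpos ht hi hp.le).le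
      (hQ.re_pos_of_im_nonpos ht hi hq.le).le hp hq
      (laplace_eq_of_im_nonpos hμ hP hQ hH ht hi hp.le hq.le)

lemma IsHalfPlaneExponent.eqOn_of_frequently (hP : IsHalfPlaneExponent P)
    (hQ : IsHalfPlaneExponent Q) {t₁ : ℂ} (ht₁ : 0 < t₁.re)
    (h : ∃ᶠ t in 𝓝[≠] t₁, P t = Q t) {t : ℂ} (ht : 0 < t.re) : P t = Q t :=
  (hP.diff.analyticOnNhd isOpen_rightHalf).eqOn_of_preconnected_of_frequently_eq
    (hQ.diff.analyticOnNhd isOpen_rightHalf) (convex_halfSpace_re_gt 0).isPreconnected ht₁ h ht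

/-- A zero of Im P persists on every nearby vertical line, by strict monotonicity and the
intermediate value theorem. The zeros accumulate at t₁, and the identity theorem applies to P and Q.
-/
lemma eq_of_exists_im_eq_zero (hμ : μ (Set.Iio 0) = 0) (hμ0 : μ ≠ Measure.dirac 0)
    (hP : IsHalfPlaneExponent P) (hQ : IsHalfPlaneExponent Q)
    (hPs : ∀ t : ℂ, 0 < t.re → 0 < (deriv P t).re)
    (hPr : ∀ x : ℝ, 0 < x → 0 < (P x).re) (hH : AgreeNearReal μ P Q) {t₁ : ℂ} (ht₁ : 0 < t₁.re)
    (hp : (P t₁).im = 0) {t : ℂ} (ht : 0 < t.re) : P t = Q t := by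
  refine hP.eqOn_of_frequently hQ ht₁ ?_ ht
  rw [frequently_nhdsWithin_iff, Metric.nhds_basis_ball.frequently_iff]
  intro ε hε
  set ξ := t₁.re with hξ
  have het : (ξ : ℂ) + t₁.im * Complex.I = t₁ := Complex.re_add_im t₁
  have hm := hP.strictMono_im hPs ht₁
  have hPcont : ∀ η : ℝ, ContinuousAt (fun x : ℝ => (P (x + η * Complex.I)).im) ξ := by
    intro η
    have h1 : ContinuousAt P ((ξ : ℂ) + η * Complex.I) :=
      (hP.differentiableAt (by simpa using ht₁)).continuousAt
    have h2 : ContinuousAt (fun x : ℝ => (x : ℂ) + η * Complex.I) ξ := by fun_prop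
    exact Complex.continuous_im.continuousAt.comp (ContinuousAt.comp (f := fun x : ℝ => (x : ℂ) + η * Complex.I) h1 h2)
  have hlo : ∀ᶠ x : ℝ in 𝓝 ξ, (P (x + (t₁.im - ε / 2 : ℝ) * Complex.I)).im < 0 := by
    refine (hPcont _).eventually_lt_const ?_
    have := hm (show t₁.im - ε / 2 < t₁.im by linarith)
    simp only [het, hp] at this
    exact this
  have hhi : ∀ᶠ x : ℝ in 𝓝 ξ, 0 < (P (x + (t₁.im + ε / 2 : ℝ) * Complex.I)).im := by
    refine (hPcont _).eventually_const_lt ?_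
    have := hm (show t₁.im < t₁.im + ε / 2 by linarith)
    simp only [het, hp] at this
    exact this
  have hnear : ∀ᶠ x : ℝ in 𝓝[>] ξ, x < ξ + ε / 2 ∧ ξ < x := by
    filter_upwards [Ioo_mem_nhdsGT (show ξ < ξ + ε / 2 by linarith)] with x hx
    exact ⟨hx.2, hx.1⟩
  obtain ⟨x, hx1, hx2, hx3⟩ :=
    ((hlo.filter_mono nhdsWithin_le_nhds).and
      ((hhi.filter_mono nhdsWithin_le_nhds).and hnear)).exists
  have hx0 : 0 < x := lt_trans ht₁ hx3.2
  have hcont : ContinuousOn (fun η : ℝ => (P (x + η * Complex.I)).im)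
      (Set.Icc (t₁.im - ε / 2) (t₁.im + ε / 2)) := fun η _ =>
    (hP.hasDerivAt_im_vertical hx0 η).continuousAt.continuousWithinAt
  obtain ⟨η, hη, hη0⟩ := intermediate_value_Icc (by linarith) hcont
    (show (0 : ℝ) ∈ _ from ⟨hx1.le, hx2.le⟩)
  have hre : ((x : ℂ) + η * Complex.I).re = x := by simp
  refine ⟨x + η * Complex.I, ?_, ?_, ?_⟩
  · rw [Metric.mem_ball, dist_eq_norm]
    have h1 : |((x : ℂ) + η * Complex.I - t₁).re| < ε / 2 := by
      simp only [Complex.sub_re, hre]; rw [← hξ, abs_lt]; constructor <;> linarith [hx3.1, hx3.2]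
    have h2 : |((x : ℂ) + η * Complex.I - t₁).im| ≤ ε / 2 := by
      simp; rw [abs_le]; constructor <;> linarith [hη.1, hη.2]
    linarith [Complex.norm_le_abs_re_add_abs_im ((x : ℂ) + η * Complex.I - t₁)]
  · exact eq_of_im_eq_zero hμ hμ0 hP hQ hPs hPr hH (by rw [hre]; exact hx0) hη0
  · intro h
    have := congrArg Complex.re h
    rw [hre] at this
    exact hx3.2.ne' this

/-- Without zeros of Im P inside the half-plane, the positive imaginary axis replaces them: there
both imaginary parts are forced to vanish in the limit, so P = Q on it, and boundary uniqueness
concludes. -/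
lemma eq_of_im_neg (hμ : μ (Set.Iio 0) = 0) (hμ0 : μ ≠ Measure.dirac 0)
    (hP : IsHalfPlaneExponent P) (hQ : IsHalfPlaneExponent Q)
    (hPr : ∀ x : ℝ, 0 < x → 0 < (P x).re) (hH : AgreeNearReal μ P Q)
    (hneg : ∀ t : ℂ, 0 < t.re → (P t).im < 0) {t : ℂ} (ht : 0 < t.re) : P t = Q t := by
  have hQneg : ∀ t : ℂ, 0 < t.re → (Q t).im ≤ 0 := by
    intro t ht
    by_contra! h
    exact not_im_neg_and_im_pos hμ hμ0 hP hQ hPr hH ht (hneg t ht) h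
  have himag : ∀ η : ℝ, 0 < η → P (η * Complex.I) = Q (η * Complex.I) := by
    intro η hη
    set w : ℂ := η * Complex.I with hw
    have hw0 : w ≠ 0 := by simp [hw, hη.ne']
    have hwre : w.re = 0 := by simp [hw]
    have hwim : w.im = η := by simp [hw]
    let e : ℝ → ℂ := fun x => x + η * Complex.I
    have he : Tendsto e (𝓝[>] 0) (𝓝[{t | 0 ≤ t.re} \ {0}] w) := by
      rw [tendsto_nhdsWithin_iff]
      constructor
      · have : Continuous e := by fun_prop
        have := this.tendsto 0
        simp only [e, Complex.ofReal_zero, zero_add] at this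
        exact this.mono_left nhdsWithin_le_nhds
      · filter_upwards [eventually_mem_nhdsWithin] with x hx
        have hx' : 0 < x := hx
        refine ⟨by simp [e, hx'.le], ?_⟩
        intro h
        have := congrArg Complex.re h
        simp [e] at this
        exact hx'.ne' this
    have hmem : w ∈ ({t | 0 ≤ t.re} \ {0} : Set ℂ) := ⟨hwre.ge, hw0⟩
    have hPl : Tendsto (fun x => P (e x)) (𝓝[>] 0) (𝓝 (P w)) := (hP.cont w hmem).tendsto.comp he
    have hQl : Tendsto (fun x => Q (e x)) (𝓝[>] 0) (𝓝 (Q w)) := (hQ.cont w hmem).tendsto.comp he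
    have hex : ∀ x : ℝ, (e x).re = x := fun x => by simp [e]
    have hey : ∀ x : ℝ, (e x).im = η := fun x => by simp [e]
    have hpos : ∀ᶠ x : ℝ in 𝓝[>] 0, 0 < x := eventually_mem_nhdsWithin
    have hPp : ∀ᶠ x in 𝓝[>] 0, 0 < (P (e x)).re := hpos.mono fun x hx =>
      hP.re_pos_of_im_nonpos (by rw [hex]; exact hx) (by rw [hey]; exact hη)
        (hneg _ (by rw [hex]; exact hx)).le
    have hQp : ∀ᶠ x in 𝓝[>] 0, 0 < (Q (e x)).re := hpos.mono fun x hx =>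
      hQ.re_pos_of_im_nonpos (by rw [hex]; exact hx) (by rw [hey]; exact hη)
        (hQneg _ (by rw [hex]; exact hx))
    have hPre : 0 ≤ (P w).re := ge_of_tendsto ((Complex.continuous_re.tendsto _).comp hPl)
      (hPp.mono fun x hx => le_of_lt hx)
    have hQre : 0 ≤ (Q w).re := ge_of_tendsto ((Complex.continuous_re.tendsto _).comp hQl)
      (hQp.mono fun x hx => le_of_lt hx)
    have hPim : (P w).im = 0 := by
      apply le_antisymm
      · exact le_of_tendsto ((Complex.continuous_im.tendsto _).comp hPl)
          (hpos.mono fun x hx => (hneg _ (by rw [hex]; exact hx)).le)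
      -- On the positive imaginary axis `quot` says Im P ≥ 0, opposite to the sign inherited from
      -- the interior.
      · have := hP.quot w hwre.ge hw0
        rw [hwre, hwim, zero_mul, zero_add] at this
        exact nonneg_of_mul_nonneg_right this hη
    have hQim : (Q w).im = 0 := by
      apply le_antisymm
      · exact le_of_tendsto ((Complex.continuous_im.tendsto _).comp hQl)
          (hpos.mono fun x hx => (hQneg _ (by rw [hex]; exact hx)))
      · have := hQ.quot w hwre.ge hw0
        rw [hwre, hwim, zero_mul, zero_add] at this
        exact nonneg_of_mul_nonneg_right this hη
    have h1 : Tendsto (fun x => laplaceTransform μ (P (e x))) (𝓝[>] 0)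
        (𝓝 (laplaceTransform μ (P w))) :=
      (continuousOn_laplace hμ (P w) hPre).tendsto.comp
        (tendsto_nhdsWithin_iff.2 ⟨hPl, hPp.mono fun x hx => hx.le⟩)
    have h2 : Tendsto (fun x => laplaceTransform μ (Q (e x))) (𝓝[>] 0)
        (𝓝 (laplaceTransform μ (Q w))) :=
      (continuousOn_laplace hμ (Q w) hQre).tendsto.comp
        (tendsto_nhdsWithin_iff.2 ⟨hQl, hQp.mono fun x hx => hx.le⟩)
    have h3 : laplaceTransform μ (P w) = laplaceTransform μ (Q w) := by
      refine tendsto_nhds_unique_of_eventuallyEq h1 h2 (hpos.mono fun x hx => ?_)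
      exact laplace_eq_of_im_nonpos hμ hP hQ hH (by rw [hex]; exact hx) (by rw [hey]; exact hη)
        (hneg _ (by rw [hex]; exact hx)).le (hQneg _ (by rw [hex]; exact hx))
    exact laplace_injOn_real hμ hμ0 hPre hQre hPim hQim h3
  -- The rotation s ↦ -is takes the upper half-plane to the right one and -1 to i. The unit disc
  -- about -1 avoids the origin, where P and Q need not be continuous.
  have hrot : ∀ s : ℂ, (-(Complex.I * s)).re = s.im := fun s => by simp
  have hball : ∀ s : ℂ, ‖s - ((-1 : ℝ) : ℂ)‖ < 1 → -(Complex.I * s) ≠ 0 := by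
    intro s hs h
    have : s = 0 := by simpa using h
    rw [this] at hs
    norm_num at hs
  have hz : ∀ p : ℂ, ‖p - ((-1 : ℝ) : ℂ)‖ < 1 / 4 → 0 ≤ p.im →
      P (-(Complex.I * p)) - Q (-(Complex.I * p)) = 0 := by
    intro p hp hpi
    refine eq_zero_of_boundary (h := fun s => P (-(Complex.I * s)) - Q (-(Complex.I * s)))
      (x := -1) (ε := 1) ?_ ?_ ?_ hp hpi
    · refine DifferentiableOn.sub (hP.diff.comp (by fun_prop) ?_) (hQ.diff.comp (by fun_prop) ?_)
      · intro s hs; exact (hs.2.trans_eq (hrot s).symm : 0 < (-(Complex.I * s)).re)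
      · intro s hs; exact (hs.2.trans_eq (hrot s).symm : 0 < (-(Complex.I * s)).re)
    · refine ContinuousOn.sub (hP.cont.comp (by fun_prop) ?_) (hQ.cont.comp (by fun_prop) ?_)
      · intro s hs; exact ⟨(hs.2.trans_eq (hrot s).symm : 0 ≤ (-(Complex.I * s)).re), hball s hs.1⟩
      · intro s hs; exact ⟨(hs.2.trans_eq (hrot s).symm : 0 ≤ (-(Complex.I * s)).re), hball s hs.1⟩
    · intro s hs
      have h1 := himag (-s) (by rw [abs_lt] at hs; linarith [hs.2])
      have h2 : -(Complex.I * (s : ℂ)) = ((-s : ℝ) : ℂ) * Complex.I := by push_cast; ring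
      rw [h2, h1, sub_self]
  refine hP.eqOn_of_frequently hQ (t₁ := (1 / 8 : ℝ) + Complex.I) (by simp) ?_ ht
  refine Eventually.frequently (nhdsWithin_le_nhds ?_)
  have h1 : ∀ᶠ t : ℂ in 𝓝 ((1 / 8 : ℝ) + Complex.I), 0 < t.re :=
    isOpen_rightHalf.mem_nhds (by simp)
  have h2 : ∀ᶠ t : ℂ in 𝓝 ((1 / 8 : ℝ) + Complex.I), ‖t - Complex.I‖ < 1 / 4 := by
    have : Continuous fun t : ℂ => ‖t - Complex.I‖ := by fun_prop
    refine this.continuousAt.eventually_lt_const ?_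
    norm_num
  filter_upwards [h1, h2] with t ht1 ht2
  have h3 := hz (Complex.I * t) (by
    have : Complex.I * t - ((-1 : ℝ) : ℂ) = Complex.I * (t - Complex.I) := by
      push_cast; ring_nf; simp [add_comm]
    rw [this, norm_mul, Complex.norm_I, one_mul]; exact ht2) (by simpa using ht1.le)
  have h4 : -(Complex.I * (Complex.I * t)) = t := by
    rw [← mul_assoc, Complex.I_mul_I]; ring
  rw [h4] at h3
  exact sub_eq_zero.1 h3

/-- A half-plane exponent is determined by its composition with a nontrivial Laplace transform. -/
theorem IsHalfPlaneExponent.eq_of_agree (hμ : μ (Set.Iio 0) = 0) (hμ0 : μ ≠ Measure.dirac 0)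
    (hP : IsHalfPlaneExponent P) (hQ : IsHalfPlaneExponent Q)
    (hPs : ∀ t : ℂ, 0 < t.re → 0 < (deriv P t).re)
    (hPr : ∀ x : ℝ, 0 < x → 0 < (P x).re) (hH : AgreeNearReal μ P Q) {t : ℂ} (ht : 0 < t.re) :
    P t = Q t := by
  by_cases h0 : ∃ t₁ : ℂ, 0 < t₁.re ∧ (P t₁).im = 0
  · obtain ⟨t₁, h1, h2⟩ := h0
    exact eq_of_exists_im_eq_zero hμ hμ0 hP hQ hPs hPr hH h1 h2 ht
  push Not at h0
  have hc : ContinuousOn (fun t => (P t).im) {t | 0 < t.re} :=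
    Complex.continuous_im.comp_continuousOn hP.diff.continuousOn
  have hpre : IsPreconnected {t : ℂ | 0 < t.re} := (convex_halfSpace_re_gt 0).isPreconnected
  rcases lt_or_gt_of_ne (h0 t ht) with hlt | hgt
  · refine eq_of_im_neg hμ hμ0 hP hQ hPr hH (fun s hs => ?_) ht
    by_contra! hs'
    obtain ⟨w, hw, hw0⟩ := hpre.intermediate_value ht hs hc ⟨hlt.le, hs'⟩
    exact h0 w hw hw0
  · have := eq_of_im_neg hμ hμ0 hP.conjReflect hQ.conjReflect
      (fun x hx => by simpa [_root_.conjReflect] using hPr x hx) hH.conjReflect (fun s hs => ?_)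
      (t := starRingEnd ℂ t) (by simpa using ht)
    · simp only [_root_.conjReflect, Complex.conj_conj] at this
      exact (starRingEnd ℂ).injective this
    · have hs1 : 0 < (starRingEnd ℂ s).re := by simpa using hs
      suffices 0 < (P (starRingEnd ℂ s)).im by simpa [_root_.conjReflect] using this
      by_contra! hs'
      obtain ⟨w, hw, hw0⟩ := hpre.intermediate_value hs1 ht hc ⟨hs', hgt.le⟩
      exact h0 w hw hw0

/-- Both compositions are analytic at points of the positive axis, so equality on the axis spreads
to neighbourhoods. -/
lemma agreeNearReal_of_pos (hμ : μ (Set.Iio 0) = 0) (hP : IsHalfPlaneExponent P)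
    (hQ : IsHalfPlaneExponent Q) (hPr : ∀ x : ℝ, 0 < x → 0 < (P x).re)
    (hQr : ∀ x : ℝ, 0 < x → 0 < (Q x).re)
    (h : ∀ x : ℝ, 0 < x → laplaceTransform μ (P x) = laplaceTransform μ (Q x)) :
    AgreeNearReal μ P Q := by
  intro x hx
  have h1 := analyticAt_laplace_comp hμ hP (t := (x : ℂ)) (by simpa using hx) (hPr x hx)
  have h2 := analyticAt_laplace_comp hμ hQ (t := (x : ℂ)) (by simpa using hx) (hQr x hx)
  have h3 : ∃ᶠ t in 𝓝[≠] (x : ℂ), laplaceTransform μ (P t) = laplaceTransform μ (Q t) := by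
    have ht : Tendsto (fun y : ℝ => (y : ℂ)) (𝓝[>] x) (𝓝[≠] (x : ℂ)) := by
      rw [tendsto_nhdsWithin_iff]
      refine ⟨(Complex.continuous_ofReal.tendsto x).mono_left nhdsWithin_le_nhds, ?_⟩
      filter_upwards [eventually_mem_nhdsWithin] with y hy
      have : x < y := hy
      simpa using this.ne'
    refine ht.frequently (Eventually.frequently ?_)
    filter_upwards [eventually_mem_nhdsWithin] with y hy
    exact h y (hx.trans hy)
  have h4 := (h1.frequently_eq_iff_eventually_eq h2).1 h3
  filter_upwards [h4] with t ht _ _ using ht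

lemma hasDerivAt_linear_I (D : ℝ) (t : ℂ) :
    HasDerivAt (fun t : ℂ => Complex.I * D * t) (Complex.I * D) t := by
  simpa using (hasDerivAt_id t).const_mul (Complex.I * (D : ℂ))

lemma isHalfPlaneExponent_linear {D : ℝ} (hD : D ≠ 0) :
    IsHalfPlaneExponent (fun t => Complex.I * D * t) where
  diff := by fun_prop
  cont := by fun_prop
  quot := by intro t _ _; simp; nlinarith
  deriv_re := by
    intro t _
    rw [hasDerivAt_linear_I D t |>.deriv]
    simp
  deriv_ne_zero := by
    intro t _
    rw [hasDerivAt_linear_I D t |>.deriv]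
    simpa using hD
  ne_zero := by
    intro t ht
    have : t ≠ 0 := by rintro rfl; simp at ht
    simp [hD, this]

/-- The linear function maps the real axis into the boundary of the domain of φ, so the identity
theorem is not available. For D < 0 it maps the upper side into the interior, and boundary
uniqueness on a half-disc replaces it. -/
lemma agreeNearReal_linear (hμ : μ (Set.Iio 0) = 0) (hP : IsHalfPlaneExponent P)
    (hPr : ∀ x : ℝ, 0 < x → 0 < (P x).re) {D : ℝ} (hD : D < 0)
    (h : ∀ x : ℝ, 0 < x → laplaceTransform μ (P x) = laplaceTransform μ (Complex.I * D * x)) :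
    AgreeNearReal μ P (fun t => Complex.I * D * t) := by
  intro x hx
  have hxre : (0 : ℝ) < ((x : ℝ) : ℂ).re := by simpa using hx
  have e1 : ∀ᶠ s : ℂ in 𝓝 (x : ℂ), 0 < s.re := isOpen_rightHalf.mem_nhds hxre
  have e2 : ∀ᶠ s : ℂ in 𝓝 (x : ℂ), 0 < (P s).re := (Complex.continuous_re.continuousAt.comp
    (hP.differentiableAt hxre).continuousAt).eventually_const_lt (hPr x hx)
  obtain ⟨ε, hε, hb⟩ := Metric.eventually_nhds_iff.1 (e1.and e2)
  simp only [dist_eq_norm] at hb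
  have hQre : ∀ t : ℂ, (Complex.I * D * t).re = (-D) * t.im := fun t => by simp
  have hD' : 0 < -D := by linarith
  have h4 : ∀ᶠ t : ℂ in 𝓝 (x : ℂ), ‖t - x‖ < ε / 4 := by
    have : Continuous fun t : ℂ => ‖t - x‖ := by fun_prop
    refine this.continuousAt.eventually_lt_const ?_
    simp only [sub_self, norm_zero]; positivity
  filter_upwards [h4] with t ht _ hq
  have hti : 0 ≤ t.im := by
    rw [hQre] at hq
    exact nonneg_of_mul_nonneg_right hq hD'
  refine sub_eq_zero.1 (eq_zero_of_boundary (x := x) (ε := ε)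
    (h := fun t => laplaceTransform μ (P t) - laplaceTransform μ (Complex.I * D * t))
    ?_ ?_ ?_ ht hti)
  · intro s hs
    refine (DifferentiableAt.sub ?_ ?_).differentiableWithinAt
    · exact differentiableAt_laplace_comp hμ (hP.differentiableAt (hb hs.1).1) (hb hs.1).2
    · refine differentiableAt_laplace_comp (P := fun t => Complex.I * D * t) hμ (by fun_prop) ?_
      rw [hQre]; exact mul_pos hD' hs.2
  · refine ContinuousOn.sub ?_ ?_
    · intro s hs
      exact (differentiableAt_laplace_comp hμ (hP.differentiableAt (hb hs.1).1)
        (hb hs.1).2).continuousAt.continuousWithinAt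
    · refine (continuousOn_laplace hμ).comp (by fun_prop) ?_
      intro s hs
      show 0 ≤ (Complex.I * D * s).re
      rw [hQre]; exact mul_nonneg hD'.le hs.2
  · intro s hs
    have hs0 : 0 < s := by
      have := (hb (y := (s : ℂ)) (by rw [← Complex.ofReal_sub, Complex.norm_real]; exact hs)).1
      simpa using this
    rw [h s hs0, sub_self]

/-- A nondegenerate half-plane exponent and a linear one are distinguished by the Laplace
transform. -/
theorem IsHalfPlaneExponent.not_agree_linear (hμ : μ (Set.Iio 0) = 0)
    (hμ0 : μ ≠ Measure.dirac 0) (hP : IsHalfPlaneExponent P)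
    (hPs : ∀ t : ℂ, 0 < t.re → 0 < (deriv P t).re)
    (hPr : ∀ x : ℝ, 0 < x → 0 < (P x).re) (D : ℝ) :
    ¬ ∀ x : ℝ, 0 < x → laplaceTransform μ (P x) = laplaceTransform μ (Complex.I * D * x) := by
  intro h
  rcases lt_trichotomy D 0 with hD | hD | hD
  · have := hP.eq_of_agree hμ hμ0 (isHalfPlaneExponent_linear hD.ne) hPs hPr
      (agreeNearReal_linear hμ hP hPr hD h) (t := ((1 : ℝ) : ℂ)) (by simp)
    have h1 := hPr 1 one_pos
    rw [this] at h1
    simp at h1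
  -- For D = 0 the right-hand side is φ(0) = 1, whereas |φ| < 1 in the open half-plane.
  · have h1 := h 1 one_pos
    rw [hD] at h1
    have h2 := norm_laplace_lt_one hμ hμ0 (hPr 1 one_pos)
    rw [h1] at h2
    simp [laplace_zero] at h2
  · have hPr' : ∀ x : ℝ, 0 < x → 0 < (_root_.conjReflect P x).re := fun x hx => by
      simpa [_root_.conjReflect] using hPr x hx
    have hag : AgreeNearReal μ (_root_.conjReflect P) (fun t => Complex.I * (-D : ℝ) * t) := by
      refine agreeNearReal_linear hμ hP.conjReflect hPr' (by linarith) fun x hx => ?_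
      have := congrArg (starRingEnd ℂ) (h x hx)
      rw [← laplace_conj, ← laplace_conj] at this
      simp only [_root_.conjReflect, Complex.conj_ofReal]
      rw [this]
      simp
    have := hP.conjReflect.eq_of_agree hμ hμ0 (isHalfPlaneExponent_linear (by linarith : -D ≠ 0))
      (fun t ht => by rw [hP.deriv_conjReflect ht]; exact hPs _ (by simpa using ht)) hPr' hag
      (t := ((1 : ℝ) : ℂ)) (by simp)
    have h1 := hPr' 1 one_pos
    rw [this] at h1
    simp at h1

end SpineUniqueness


/-! ### Inequalities for characteristic functions and their exponents. -/

section CharFunBasics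

lemma IsCharFun.affine {g : ℝ → ℂ} (hg : IsCharFun g) (c d : ℝ) :
    IsCharFun (fun t => g (c * t) * Complex.exp (Complex.I * (t * d : ℝ))) := by
  obtain ⟨ν, hν, rfl⟩ := hg
  refine ⟨(ν.map (c * ·)).map (· + d), ?_, ?_⟩
  · have : IsProbabilityMeasure (ν.map (c * ·)) :=
      Measure.isProbabilityMeasure_map (by fun_prop)
    exact Measure.isProbabilityMeasure_map (by fun_prop)
  · ext t
    rw [charFun_map_add_const, charFun_map_mul]
    congr 2
    simp; ring

lemma IsCharFun.normalized {g : ℝ → ℂ} (hg : IsCharFun g) (a b : ℝ) :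
    IsCharFun (normalizedCharFun g a b) := by
  convert hg.affine a⁻¹ (-b) using 2 with t
  unfold normalizedCharFun
  rw [div_eq_inv_mul]
  congr 2
  push_cast; ring

lemma IsCharFun.mul {f g : ℝ → ℂ} (hf : IsCharFun f) (hg : IsCharFun g) :
    IsCharFun (fun t => f t * g t) := by
  obtain ⟨ν, hν, rfl⟩ := hf
  obtain ⟨ρ, hρ, rfl⟩ := hg
  exact ⟨ν ∗ ρ, inferInstance, by ext t; rw [charFun_conv]⟩

lemma isCharFun_one : IsCharFun (fun _ => 1) :=
  ⟨Measure.dirac 0, inferInstance, by ext t; simp [charFun_dirac]⟩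

lemma IsCharFun.pow {g : ℝ → ℂ} (hg : IsCharFun g) (n : ℕ) : IsCharFun (fun t => g t ^ n) := by
  induction n with
  | zero => simpa using isCharFun_one
  | succ n ih => simpa only [pow_succ] using ih.mul hg

lemma IsCharFun.continuous {g : ℝ → ℂ} (hg : IsCharFun g) : Continuous g := by
  obtain ⟨ν, hν, rfl⟩ := hg
  exact continuous_charFun

lemma IsCharFun.map_zero {g : ℝ → ℂ} (hg : IsCharFun g) : g 0 = 1 := by
  obtain ⟨ν, hν, rfl⟩ := hg
  simp

lemma IsCharFun.norm_le_one {g : ℝ → ℂ} (hg : IsCharFun g) (t : ℝ) : ‖g t‖ ≤ 1 := by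
  obtain ⟨ν, hν, rfl⟩ := hg
  exact norm_charFun_le_one t

lemma IsCharFun.map_neg {g : ℝ → ℂ} (hg : IsCharFun g) (t : ℝ) :
    g (-t) = starRingEnd ℂ (g t) := by
  obtain ⟨ν, hν, rfl⟩ := hg
  exact charFun_neg t

lemma IsCharFun.re_le_one {g : ℝ → ℂ} (hg : IsCharFun g) (t : ℝ) : (g t).re ≤ 1 :=
  (Complex.re_le_norm _).trans (hg.norm_le_one t)

lemma integrable_char {ν : Measure ℝ} [IsProbabilityMeasure ν] (t : ℝ) :
    Integrable (fun x : ℝ => Complex.exp (t * x * Complex.I)) ν := by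
  refine (integrable_const (1 : ℝ)).mono' (by fun_prop) (Eventually.of_forall fun x => ?_)
  rw [← Complex.ofReal_mul, Complex.norm_exp_ofReal_mul_I]

lemma norm_char_sub_one_sq (u : ℝ) :
    ‖Complex.exp (u * Complex.I) - 1‖ ^ 2 = 2 * (1 - (Complex.exp (u * Complex.I)).re) := by
  rw [Complex.sq_norm, Complex.normSq_apply, Complex.exp_ofReal_mul_I_re, Complex.sub_re,
    Complex.sub_im, Complex.exp_ofReal_mul_I_re, Complex.exp_ofReal_mul_I_im]
  simp only [Complex.one_re, Complex.one_im]
  nlinarith [Real.sin_sq_add_cos_sq u]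

lemma integral_norm_char_sub_one_sq {ν : Measure ℝ} [IsProbabilityMeasure ν] (t : ℝ) :
    ∫ x : ℝ, ‖Complex.exp (t * x * Complex.I) - 1‖ ^ 2 ∂ν = 2 * (1 - (charFun ν t).re) := by
  have h : ∀ x : ℝ, ‖Complex.exp (t * x * Complex.I) - 1‖ ^ 2 =
      2 * (1 - (Complex.exp (t * x * Complex.I)).re) := fun x => by
    rw [← Complex.ofReal_mul]; exact norm_char_sub_one_sq _
  simp_rw [h]
  have hre : Integrable (fun x : ℝ => (Complex.exp (t * x * Complex.I)).re) ν :=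
    (integrable_char t).re
  rw [integral_const_mul, integral_sub (integrable_const _) hre]
  have : ∫ x : ℝ, (Complex.exp (t * x * Complex.I)).re ∂ν = (charFun ν t).re := by
    rw [charFun_apply_real]; exact integral_re (integrable_char t)
  rw [this]; simp

/-- The left side is -E[(e^{isX} - 1)(e^{itX} - 1)], and E|e^{isX} - 1|² = 2(1 - Re g(s));
Cauchy–Schwarz gives the bound. It is homogeneous in 1 - g, so it survives multiplication by n and
passage to the limit. -/
lemma IsCharFun.add_bound {g : ℝ → ℂ} (hg : IsCharFun g) (s t : ℝ) :
    ‖(1 - g (s + t)) - (1 - g s) - (1 - g t)‖ ≤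
      2 * (√(1 - (g s).re) * √(1 - (g t).re)) := by
  obtain ⟨ν, hν, rfl⟩ := hg
  let e : ℝ → ℝ → ℂ := fun t x => Complex.exp (t * x * Complex.I)
  have hm : ∀ t, MemLp (fun x => ‖e t x - 1‖) (ENNReal.ofReal 2) ν := by
    intro t
    refine MemLp.of_bound (C := 2) (by fun_prop) ?_
    refine Eventually.of_forall fun x => ?_
    rw [norm_norm]
    refine (norm_sub_le _ _).trans ?_
    simp only [e]
    rw [← Complex.ofReal_mul, Complex.norm_exp_ofReal_mul_I]
    norm_num
  have h1 : (1 - charFun ν (s + t)) - (1 - charFun ν s) - (1 - charFun ν t) =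
      -∫ x, (e s x - 1) * (e t x - 1) ∂ν := by
    have : ∀ x : ℝ, (e s x - 1) * (e t x - 1) =
        Complex.exp ((s + t : ℝ) * x * Complex.I) - e s x - e t x + 1 := by
      intro x
      have : Complex.exp ((s + t : ℝ) * x * Complex.I) = e s x * e t x := by
        simp only [e]; rw [← Complex.exp_add]; congr 1; push_cast; ring
      rw [this]; ring
    simp_rw [this]
    rw [integral_add, integral_sub, integral_sub, charFun_apply_real, charFun_apply_real,
      charFun_apply_real]
    · simp [e]; ring
    · exact integrable_char _
    · exact integrable_char _
    · exact (integrable_char _).sub (integrable_char _)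
    · exact integrable_char _
    · exact ((integrable_char _).sub (integrable_char _)).sub (integrable_char _)
    · exact integrable_const _
  rw [h1, norm_neg]
  calc ‖∫ x, (e s x - 1) * (e t x - 1) ∂ν‖ ≤ ∫ x, ‖e s x - 1‖ * ‖e t x - 1‖ ∂ν := by
        refine (norm_integral_le_integral_norm _).trans (le_of_eq ?_)
        simp_rw [norm_mul]
    _ ≤ (∫ x, ‖e s x - 1‖ ^ (2 : ℝ) ∂ν) ^ (1 / (2 : ℝ)) *
        (∫ x, ‖e t x - 1‖ ^ (2 : ℝ) ∂ν) ^ (1 / (2 : ℝ)) := by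
        apply integral_mul_le_Lp_mul_Lq_of_nonneg
        · exact Real.HolderConjugate.two_two
        · exact Eventually.of_forall fun x => norm_nonneg _
        · exact Eventually.of_forall fun x => norm_nonneg _
        · exact hm s
        · exact hm t
    _ = √(2 * (1 - (charFun ν s).re)) * √(2 * (1 - (charFun ν t).re)) := by
        simp_rw [Real.rpow_two]
        rw [integral_norm_char_sub_one_sq, integral_norm_char_sub_one_sq, ← Real.sqrt_eq_rpow,
          ← Real.sqrt_eq_rpow]
    _ = 2 * (√(1 - (charFun ν s).re) * √(1 - (charFun ν t).re)) := by
        rw [Real.sqrt_mul (by norm_num), Real.sqrt_mul (by norm_num)]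
        have := Real.mul_self_sqrt (show (0 : ℝ) ≤ 2 by norm_num)
        linear_combination (√(1 - (charFun ν s).re) * √(1 - (charFun ν t).re)) * this

/-- The inequalities satisfied by `c (1 - g)` for characteristic functions `g` and `c ≥ 0`, and by
their pointwise limits. -/
structure IsCharExponent (z : ℝ → ℂ) : Prop where
  map_zero : z 0 = 0
  re_nonneg : ∀ t, 0 ≤ (z t).re
  map_neg : ∀ t, z (-t) = starRingEnd ℂ (z t)
  add_bound : ∀ s t, ‖z (s + t) - z s - z t‖ ≤ 2 * (√(z s).re * √(z t).re)

lemma IsCharFun.isCharExponent {g : ℝ → ℂ} (hg : IsCharFun g) {c : ℝ} (hc : 0 ≤ c) :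
    IsCharExponent (fun t => (c : ℂ) * (1 - g t)) where
  map_zero := by simp [hg.map_zero]
  re_nonneg t := by
    have := hg.re_le_one t
    simp only [Complex.re_ofReal_mul, Complex.sub_re, Complex.one_re]
    exact mul_nonneg hc (by linarith)
  map_neg t := by simp [hg.map_neg]
  add_bound s t := by
    have h := hg.add_bound s t
    simp only [Complex.re_ofReal_mul, Complex.sub_re, Complex.one_re]
    rw [Real.sqrt_mul hc, Real.sqrt_mul hc]
    calc ‖(c : ℂ) * (1 - g (s + t)) - c * (1 - g s) - c * (1 - g t)‖
        = c * ‖(1 - g (s + t)) - (1 - g s) - (1 - g t)‖ := by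
          rw [← mul_sub, ← mul_sub, norm_mul, Complex.norm_real, Real.norm_eq_abs, abs_of_nonneg hc]
      _ ≤ c * (2 * (√(1 - (g s).re) * √(1 - (g t).re))) := by gcongr
      _ = 2 * (√c * √(1 - (g s).re) * (√c * √(1 - (g t).re))) := by
          have := Real.mul_self_sqrt hc
          linear_combination (-2 * (√(1 - (g s).re) * √(1 - (g t).re))) * this

lemma IsCharExponent.of_tendsto {ι : Type*} {l : Filter ι} [l.NeBot] {z : ι → ℝ → ℂ} {χ : ℝ → ℂ}
    (hz : ∀ᶠ i in l, IsCharExponent (z i)) (h : ∀ t, Tendsto (fun i => z i t) l (𝓝 (χ t))) :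
    IsCharExponent χ where
  map_zero := tendsto_nhds_unique_of_eventuallyEq (h 0) (tendsto_const_nhds (x := (0 : ℂ)))
    (hz.mono fun i hi => hi.map_zero)
  re_nonneg t := ge_of_tendsto ((Complex.continuous_re.tendsto _).comp (h t))
    (hz.mono fun i hi => hi.re_nonneg t)
  map_neg t := tendsto_nhds_unique_of_eventuallyEq (h (-t))
    ((Complex.continuous_conj.tendsto _).comp (h t)) (hz.mono fun i hi => hi.map_neg t)
  add_bound s t := by
    have hre : ∀ t, Tendsto (fun i => √(z i t).re) l (𝓝 √(χ t).re) := fun t =>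
      (Real.continuous_sqrt.tendsto _).comp ((Complex.continuous_re.tendsto _).comp (h t))
    exact le_of_tendsto_of_tendsto (((h (s + t)).sub (h s)).sub (h t)).norm
      (((hre s).mul (hre t)).const_mul 2) (hz.mono fun i hi => hi.add_bound s t)

namespace IsCharExponent

variable {z : ℝ → ℂ}

lemma norm_add_le (hz : IsCharExponent z) (s t : ℝ) :
    ‖z (s + t) - z s‖ ≤ ‖z t‖ + 2 * (√‖z s‖ * √‖z t‖) := by
  have h := hz.add_bound s t
  have h1 : √(z s).re * √(z t).re ≤ √‖z s‖ * √‖z t‖ := by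
    gcongr <;> exact Complex.re_le_norm _
  calc ‖z (s + t) - z s‖ = ‖(z (s + t) - z s - z t) + z t‖ := by ring_nf
    _ ≤ ‖z (s + t) - z s - z t‖ + ‖z t‖ := _root_.norm_add_le _ _
    _ ≤ _ := by linarith

lemma norm_two_mul_le (hz : IsCharExponent z) (t : ℝ) : ‖z (2 * t)‖ ≤ 4 * ‖z t‖ := by
  have h := hz.norm_add_le t t
  rw [Real.mul_self_sqrt (norm_nonneg _), ← two_mul] at h
  have := norm_sub_norm_le (z (2 * t)) (z t)
  linarith

lemma re_two_mul_le (hz : IsCharExponent z) (t : ℝ) : (z (2 * t)).re ≤ 4 * (z t).re := by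
  have h := hz.add_bound t t
  rw [Real.mul_self_sqrt (hz.re_nonneg t), ← two_mul] at h
  have := (Complex.re_le_norm _).trans h
  simp only [Complex.sub_re] at this
  linarith

/-- Doubling t multiplies the bound by at most 4, which is quadratic growth; the extra factor 4 pays
for rounding up to a power of two. -/
lemma norm_le_growth (hz : IsCharExponent z) {τ M : ℝ} (hτ : 0 < τ)
    (h : ∀ t, |t| ≤ τ → ‖z t‖ ≤ M) (t : ℝ) : ‖z t‖ ≤ M * (1 + 4 * (t / τ) ^ 2) := by
  have hM : 0 ≤ M := (norm_nonneg _).trans (h 0 (by simpa using hτ.le))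
  have key : ∀ j : ℕ, ∀ t, |t| ≤ 2 ^ j * τ → ‖z t‖ ≤ 4 ^ j * M := by
    intro j
    induction j with
    | zero => simpa using h
    | succ j ih =>
      intro t ht
      have h1 := ih (t / 2) (by
        rw [abs_div, abs_two, div_le_iff₀ two_pos]
        calc |t| ≤ 2 ^ (j + 1) * τ := ht
          _ = _ := by ring)
      have h2 := hz.norm_two_mul_le (t / 2)
      rw [mul_div_cancel₀ t two_ne_zero] at h2
      calc ‖z t‖ ≤ 4 * ‖z (t / 2)‖ := h2
        _ ≤ 4 * (4 ^ j * M) := by gcongr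
        _ = 4 ^ (j + 1) * M := by ring
  by_cases ht : |t| ≤ τ
  · refine (h t ht).trans ?_
    nlinarith [mul_nonneg hM (sq_nonneg (t / τ))]
  push Not at ht
  obtain ⟨j, hj1, hj2⟩ := exists_nat_pow_near (show 1 ≤ |t| / τ by rw [le_div_iff₀ hτ]; linarith)
    (one_lt_two)
  have h1 := key (j + 1) t (by rw [div_lt_iff₀ hτ] at hj2; exact hj2.le)
  refine h1.trans ?_
  have h2 : (4 : ℝ) ^ j ≤ (t / τ) ^ 2 := by
    have : (4 : ℝ) ^ j = (2 ^ j) ^ 2 := by rw [← pow_mul, mul_comm, pow_mul]; norm_num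
    rw [this, ← sq_abs (t / τ), abs_div, abs_of_pos hτ]
    gcongr
  rw [pow_succ]
  nlinarith [mul_le_mul_of_nonneg_right h2 hM]

lemma continuous_of_continuousAt (hz : IsCharExponent z)
    (h : Tendsto z (𝓝 0) (𝓝 0)) : Continuous z := by
  rw [continuous_iff_continuousAt]
  intro t
  have h1 : Tendsto (fun s => z (t + (s - t)) - z t) (𝓝 t) (𝓝 0) := by
    rw [tendsto_zero_iff_norm_tendsto_zero]
    have h2 : Tendsto (fun s => z (s - t)) (𝓝 t) (𝓝 0) := by
      have : Tendsto (fun s => s - t) (𝓝 t) (𝓝 0) := by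
        have : Continuous fun s => s - t := by fun_prop
        simpa using this.tendsto t
      exact h.comp this
    have h3 : Tendsto (fun s => ‖z (s - t)‖ + 2 * (√‖z t‖ * √‖z (s - t)‖)) (𝓝 t) (𝓝 0) := by
      have h4 := h2.norm
      rw [norm_zero] at h4
      have h5 := (Real.continuous_sqrt.tendsto 0).comp h4
      rw [Real.sqrt_zero] at h5
      simpa using h4.add ((h5.const_mul √‖z t‖).const_mul 2)
    exact squeeze_zero (fun _ => norm_nonneg _) (fun s => hz.norm_add_le t (s - t)) h3
  have h2 := h1.add_const (z t)
  simpa [ContinuousAt] using h2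

/-- With vanishing real parts the right side of `add_bound` is zero, so z is additive, and
continuity makes it real-linear. -/
lemma linear_of_re_eq_zero (hz : IsCharExponent z) (hc : Continuous z)
    (h : ∀ t, (z t).re = 0) : ∃ D : ℝ, ∀ t, z t = Complex.I * D * t := by
  have hadd : ∀ s t, z (s + t) = z s + z t := by
    intro s t
    have := hz.add_bound s t
    rw [h s, h t] at this
    simp only [Real.sqrt_zero, mul_zero, norm_le_zero_iff] at this
    linear_combination this
  let f : ℝ →+ ℂ := ⟨⟨z, hz.map_zero⟩, hadd⟩
  let L := f.toRealLinearMap hc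
  refine ⟨(z 1).im, fun t => ?_⟩
  have h1 : L t = t • L 1 := by
    rw [← map_smul]; simp
  have h2 : z t = t • z 1 := h1
  rw [h2, Complex.real_smul]
  apply Complex.ext <;> simp [h 1, mul_comm]

end IsCharExponent

end CharFunBasics


/-! ### Tight sequences of exponents: equicontinuity, selection, and criteria. -/

section Tight

/-- A sequence of exponents that is uniformly small near the origin. -/
structure TightExponents (z : ℕ → ℝ → ℂ) : Prop where
  exponent : ∀ n, IsCharExponent (z n)
  small : ∀ r : ℝ, 0 < r → ∃ τ : ℝ, 0 < τ ∧ ∀ᶠ n in atTop, ∀ t, |t| ≤ τ → ‖z n t‖ ≤ r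

namespace TightExponents

variable {z : ℕ → ℝ → ℂ}

lemma comp (hz : TightExponents z) {σ : ℕ → ℕ} (hσ : Tendsto σ atTop atTop) :
    TightExponents (fun n => z (σ n)) where
  exponent n := hz.exponent _
  small r hr := by
    obtain ⟨τ, hτ, h⟩ := hz.small r hr
    exact ⟨τ, hτ, hσ.eventually h⟩

lemma growth (hz : TightExponents z) :
    ∃ C : ℝ, 0 < C ∧ ∀ᶠ n in atTop, ∀ t, ‖z n t‖ ≤ C * (1 + t ^ 2) := by
  obtain ⟨τ, hτ, h⟩ := hz.small 1 one_pos
  refine ⟨1 + 4 / τ ^ 2, by positivity, h.mono fun n hn t => ?_⟩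
  have := (hz.exponent n).norm_le_growth hτ hn t
  refine this.trans ?_
  have h1 : (t / τ) ^ 2 = t ^ 2 / τ ^ 2 := by rw [div_pow]
  rw [h1]
  have : 0 ≤ 4 / τ ^ 2 := by positivity
  have h2 : 4 * (t ^ 2 / τ ^ 2) = 4 / τ ^ 2 * t ^ 2 := by ring
  rw [h2]
  nlinarith [sq_nonneg t]

lemma tendsto_zero (hz : TightExponents z) {u : ℕ → ℝ} (hu : Tendsto u atTop (𝓝 0)) :
    Tendsto (fun n => z n (u n)) atTop (𝓝 0) := by
  rw [Metric.tendsto_nhds]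
  intro ε hε
  obtain ⟨τ, hτ, h⟩ := hz.small (ε / 2) (by positivity)
  have h1 : ∀ᶠ n in atTop, |u n| < τ := by
    have := (Metric.tendsto_nhds.1 hu) τ hτ
    simpa [Real.dist_eq] using this
  filter_upwards [h, h1] with n hn hn1
  rw [dist_zero_right]
  linarith [hn (u n) hn1.le]

/-- Asymptotic equicontinuity: by `add_bound` the increment at t is controlled by the size of z_n
near 0 and the bounded size of z_n(t). -/
lemma tendsto_sub_of_tendsto (hz : TightExponents z) {u : ℕ → ℝ} {t : ℝ}
    (hu : Tendsto u atTop (𝓝 t)) : Tendsto (fun n => z n (u n) - z n t) atTop (𝓝 0) := by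
  obtain ⟨C, hC, hb⟩ := hz.growth
  have h0 : Tendsto (fun n => z n (u n - t)) atTop (𝓝 0) :=
    hz.tendsto_zero (by simpa using hu.sub_const t)
  have h1 := h0.norm
  rw [norm_zero] at h1
  have h2 := (Real.continuous_sqrt.tendsto 0).comp h1
  rw [Real.sqrt_zero] at h2
  have h3 : Tendsto (fun n => ‖z n (u n - t)‖ + 2 * (√(C * (1 + t ^ 2)) * √‖z n (u n - t)‖))
      atTop (𝓝 0) := by
    simpa using h1.add ((h2.const_mul √(C * (1 + t ^ 2))).const_mul 2)
  rw [tendsto_zero_iff_norm_tendsto_zero]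
  refine tendsto_of_tendsto_of_tendsto_of_le_of_le' tendsto_const_nhds h3
    (Eventually.of_forall fun _ => norm_nonneg _) (hb.mono fun n hn => ?_)
  have := (hz.exponent n).norm_add_le t (u n - t)
  rw [add_sub_cancel] at this
  refine this.trans ?_
  gcongr
  exact hn t

lemma tendsto_moving (hz : TightExponents z) {χ : ℝ → ℂ}
    (hχ : ∀ t, Tendsto (fun n => z n t) atTop (𝓝 (χ t))) {u : ℕ → ℝ} {t : ℝ}
    (hu : Tendsto u atTop (𝓝 t)) : Tendsto (fun n => z n (u n)) atTop (𝓝 (χ t)) := by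
  simpa using (hz.tendsto_sub_of_tendsto hu).add (hχ t)

lemma limit_small (hz : TightExponents z) {r : ℝ} (hr : 0 < r) :
    ∃ τ : ℝ, 0 < τ ∧ ∀ (σ : ℕ → ℕ) (χ : ℝ → ℂ), Tendsto σ atTop atTop →
      (∀ t, Tendsto (fun n => z (σ n) t) atTop (𝓝 (χ t))) → ∀ t, |t| ≤ τ → ‖χ t‖ ≤ r := by
  obtain ⟨τ, hτ, h⟩ := hz.small r hr
  refine ⟨τ, hτ, fun σ χ hσ hχ t ht => ?_⟩
  exact le_of_tendsto (hχ t).norm ((hσ.eventually h).mono fun n hn => hn t ht)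

lemma isCharExponent_limit (hz : TightExponents z) {χ : ℝ → ℂ}
    (hχ : ∀ t, Tendsto (fun n => z n t) atTop (𝓝 (χ t))) : IsCharExponent χ :=
  IsCharExponent.of_tendsto (Eventually.of_forall hz.exponent) hχ

lemma continuous_limit (hz : TightExponents z) {χ : ℝ → ℂ}
    (hχ : ∀ t, Tendsto (fun n => z n t) atTop (𝓝 (χ t))) : Continuous χ := by
  refine (hz.isCharExponent_limit hχ).continuous_of_continuousAt ?_
  rw [Metric.tendsto_nhds_nhds]
  intro ε hε
  obtain ⟨τ, hτ, h⟩ := hz.limit_small (half_pos hε)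
  refine ⟨τ, hτ, fun {t} ht => ?_⟩
  have := h id χ tendsto_id hχ t (by simpa [Real.dist_eq] using ht.le)
  rw [dist_zero_right]; linarith

/-- Helly-type selection for tight sequences of exponents. -/
lemma exists_subseq (hz : TightExponents z) :
    ∃ (σ : ℕ → ℕ) (χ : ℝ → ℂ), StrictMono σ ∧
      ∀ t, Tendsto (fun n => z (σ n) t) atTop (𝓝 (χ t)) := by
  obtain ⟨C, hC, hb⟩ := hz.growth
  -- Diagonal extraction over the rationals, by Tychonoff; other t are reached through asymptotic
  -- equicontinuity.
  have hK : IsCompact (Set.univ.pi fun q : ℚ => Metric.closedBall (0 : ℂ) (C * (1 + (q : ℝ) ^ 2))) :=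
    isCompact_univ_pi fun q => isCompact_closedBall _ _
  have hfr : ∃ᶠ n in atTop, (fun q : ℚ => z n q) ∈
      (Set.univ.pi fun q : ℚ => Metric.closedBall (0 : ℂ) (C * (1 + (q : ℝ) ^ 2))) := by
    refine Eventually.frequently (hb.mono fun n hn q _ => ?_)
    simpa using hn q
  obtain ⟨a, _, σ, hσ, ha⟩ := hK.tendsto_subseq' hfr
  rw [tendsto_pi_nhds] at ha
  have hzσ := hz.comp hσ.tendsto_atTop
  have hcau : ∀ t, ∃ w, Tendsto (fun n => z (σ n) t) atTop (𝓝 w) := by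
    intro t
    refine cauchySeq_tendsto_of_complete (Metric.cauchySeq_iff'.2 fun ε hε => ?_)
    have hclose : ∃ q : ℚ, ∀ᶠ n in atTop, ‖z (σ n) q - z (σ n) t‖ < ε / 3 := by
      by_contra! hne
      have hq : ∀ k : ℕ, ∃ q : ℚ, |(q : ℝ) - t| < 1 / (k + 1) := fun k => by
        obtain ⟨q, h1, h2⟩ := exists_rat_btwn (show t < t + 1 / ((k : ℝ) + 1) by
          linarith [show (0 : ℝ) < 1 / ((k : ℝ) + 1) by positivity])
        exact ⟨q, by rw [abs_lt]; constructor <;> linarith⟩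
      choose q hq using hq
      have hex : ∀ k : ℕ, ∃ n, k ≤ n ∧ ε / 3 ≤ ‖z (σ n) (q k) - z (σ n) t‖ := fun k => by
        obtain ⟨n, h1, h2⟩ := (frequently_atTop.1 (hne (q k))) k
        exact ⟨n, h1, h2⟩
      choose ν hν1 hν2 using hex
      have hνt : Tendsto ν atTop atTop := tendsto_atTop_mono hν1 tendsto_id
      have hqt : Tendsto (fun k => (q k : ℝ)) atTop (𝓝 t) := by
        rw [tendsto_iff_dist_tendsto_zero]
        refine squeeze_zero (fun _ => dist_nonneg) (fun k => ?_)
          tendsto_one_div_add_atTop_nhds_zero_nat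
        rw [Real.dist_eq]; exact (hq k).le
      have h0 := ((hzσ.comp hνt).tendsto_sub_of_tendsto hqt).norm
      rw [norm_zero] at h0
      have := ge_of_tendsto h0 (Eventually.of_forall hν2)
      linarith
    obtain ⟨q, hq⟩ := hclose
    have h1 : ∀ᶠ n in atTop, ‖z (σ n) q - a q‖ < ε / 12 := by
      have := (Metric.tendsto_nhds.1 (ha q)) (ε / 12) (by positivity)
      simpa [dist_eq_norm, Function.comp] using this
    obtain ⟨N, hN⟩ := eventually_atTop.1 (hq.and h1)
    refine ⟨N, fun n hn => ?_⟩
    have e1 := hN n hn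
    have e2 := hN N le_rfl
    rw [dist_eq_norm]
    calc ‖z (σ n) t - z (σ N) t‖ = ‖-(z (σ n) q - z (σ n) t) + (z (σ n) q - a q)
          - (z (σ N) q - a q) + (z (σ N) q - z (σ N) t)‖ := by ring_nf
      _ ≤ ‖z (σ n) q - z (σ n) t‖ + ‖z (σ n) q - a q‖ + ‖z (σ N) q - a q‖
          + ‖z (σ N) q - z (σ N) t‖ := by
          refine (norm_add_le _ _).trans (add_le_add ((norm_sub_le _ _).trans
            (add_le_add ((norm_add_le _ _).trans ?_) le_rfl)) le_rfl)
          rw [norm_neg]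
      _ < ε := by linarith [e1.1, e1.2, e2.1, e2.2]
  choose χ hχ using hcau
  exact ⟨σ, χ, hσ, hχ⟩

/-- To prove convergence it suffices to identify all subsequential limits. -/
lemma tendsto_of_unique_limit (hz : TightExponents z) {ψ : ℝ → ℂ}
    (h : ∀ (σ : ℕ → ℕ) (χ : ℝ → ℂ), StrictMono σ →
      (∀ t, Tendsto (fun n => z (σ n) t) atTop (𝓝 (χ t))) → χ = ψ) (t : ℝ) :
    Tendsto (fun n => z n t) atTop (𝓝 (ψ t)) := by
  refine tendsto_of_subseq_tendsto fun ns hns => ?_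
  obtain ⟨σ, hσ, hmono⟩ := strictMono_subseq_of_tendsto_atTop hns
  obtain ⟨σ', χ, hσ', hχ⟩ := (hz.comp (hmono.tendsto_atTop)).exists_subseq
  refine ⟨fun n => σ (σ' n), ?_⟩
  have := h (fun n => ns (σ (σ' n))) χ (hmono.comp hσ') hχ
  rw [← this]
  exact hχ t

/-- Tightness from a barrier that the exponents cannot cross near the origin. -/
lemma of_barrier {f : ℕ → ℝ → ℂ} (hz : ∀ n, IsCharExponent (z n)) (hc : ∀ n, Continuous (z n))
    (hf : ∀ ε : ℝ, 0 < ε → ∃ τ : ℝ, 0 < τ ∧ ∀ᶠ n in atTop, ∀ t, |t| ≤ τ → ‖1 - f n t‖ ≤ ε)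
    {r₀ : ℝ} (hr₀ : 0 < r₀)
    (hb : ∀ r, 0 < r → r < r₀ → ∃ κ : ℝ, 0 < κ ∧ ∀ᶠ n in atTop, ∀ t, ‖z n t‖ = r →
      κ ≤ ‖1 - f n t‖) : TightExponents z where
  exponent := hz
  small r hr := by
    set r' := min r (r₀ / 2) with hr'
    have hr'0 : 0 < r' := lt_min hr (by positivity)
    obtain ⟨κ, hκ, h1⟩ := hb r' hr'0 ((min_le_right _ _).trans_lt (by linarith))
    obtain ⟨τ, hτ, h2⟩ := hf (κ / 2) (by positivity)
    refine ⟨τ, hτ, ?_⟩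
    filter_upwards [h1, h2] with n h1 h2 t ht
    by_contra! hgt
    have hgt' : r' ≤ ‖z n t‖ := (min_le_left _ _).trans hgt.le
    have hcont : ContinuousOn (fun s => ‖z n s‖) (Set.uIcc 0 t) := (hc n).norm.continuousOn
    have hmem : r' ∈ Set.uIcc ‖z n 0‖ ‖z n t‖ := by
      rw [(hz n).map_zero, norm_zero, Set.uIcc_of_le (norm_nonneg _)]
      exact ⟨hr'0.le, hgt'⟩
    -- Since z_n vanishes at 0, exceeding r' at t means hitting the circle of radius r' at some s
    -- between 0 and t.
    obtain ⟨s, hs, hsr⟩ := intermediate_value_uIcc hcont hmem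
    have hs' : |s| ≤ τ := by
      have h0 : s ∈ Set.uIcc 0 t := hs
      rw [Set.mem_uIcc] at h0
      rw [abs_le] at ht ⊢
      rcases h0 with h0 | h0 <;> constructor <;> linarith [h0.1, h0.2]
    have := h1 s hsr
    linarith [h2 s hs']

end TightExponents

/-- The inequality between values of `1 - Re f` satisfied by characteristic functions and their
mixtures. -/
structure IsSubQuadratic (f : ℝ → ℂ) : Prop where
  norm_le : ∀ t, ‖f t‖ ≤ 1
  re_neg : ∀ t, (f (-t)).re = (f t).re
  sub_le : ∀ s t, 1 - (f (s + t)).re ≤ 2 * (1 - (f s).re) + 2 * (1 - (f t).re)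
  cont : Continuous f

lemma IsCharFun.isSubQuadratic {g : ℝ → ℂ} (hg : IsCharFun g) : IsSubQuadratic g where
  norm_le := hg.norm_le_one
  re_neg t := by rw [hg.map_neg, Complex.conj_re]
  cont := hg.continuous
  sub_le s t := by
    have h := (Complex.re_le_norm _).trans (hg.add_bound s t)
    simp only [Complex.sub_re, Complex.one_re] at h
    have h1 : 0 ≤ 1 - (g s).re := by linarith [hg.re_le_one s]
    have h2 : 0 ≤ 1 - (g t).re := by linarith [hg.re_le_one t]
    nlinarith [sq_nonneg (√(1 - (g s).re) - √(1 - (g t).re)), Real.sq_sqrt h1, Real.sq_sqrt h2]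

/-- Expanding the exponential exhibits a Poisson mixture of the ChFs g^k. The inequality is linear
in 1 - Re f, so it passes to mixtures. -/
lemma IsCharFun.isSubQuadratic_exp {g : ℝ → ℂ} (hg : IsCharFun g) {c : ℝ} (hc : 0 ≤ c) :
    IsSubQuadratic (fun t => Complex.exp (-(c * (1 - g t)))) := by
  have hnn : ∀ k : ℕ, 0 ≤ Real.exp (-c) * (c ^ k / k.factorial) := fun k => by positivity
  have hs1 : HasSum (fun k : ℕ => Real.exp (-c) * (c ^ k / k.factorial)) 1 := by
    have := (NormedSpace.expSeries_div_hasSum_exp c).mul_left (Real.exp (-c))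
    rwa [← Real.exp_eq_exp_ℝ, ← Real.exp_add, neg_add_cancel, Real.exp_zero] at this
  have hsg : ∀ t, HasSum (fun k : ℕ => (Real.exp (-c) * (c ^ k / k.factorial)) * (1 - (g t ^ k).re))
      (1 - (Complex.exp (-(c * (1 - g t)))).re) := by
    intro t
    have h1 := (NormedSpace.expSeries_div_hasSum_exp ((c : ℂ) * g t)).mul_left
      (Complex.exp (-(c : ℂ)))
    rw [← Complex.exp_eq_exp_ℂ, ← Complex.exp_add] at h1
    have h2 : -(c : ℂ) + c * g t = -(c * (1 - g t)) := by ring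
    rw [h2] at h1
    have h3 := hs1.sub (Complex.hasSum_re h1)
    suffices hk : ∀ k : ℕ, Real.exp (-c) * (c ^ k / k.factorial) * (1 - (g t ^ k).re) =
        Real.exp (-c) * (c ^ k / k.factorial) -
          (Complex.exp (-(c : ℂ)) * ((c * g t) ^ k / k.factorial)).re by
      simpa only [hk] using h3
    intro k
    have : Complex.exp (-(c : ℂ)) * ((c * g t) ^ k / k.factorial) =
        ((Real.exp (-c) * (c ^ k / k.factorial) : ℝ) : ℂ) * g t ^ k := by
      push_cast; rw [mul_pow]; ring
    rw [this, Complex.re_ofReal_mul]; ring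
  constructor
  · intro t
    rw [Complex.norm_exp, Real.exp_le_one_iff]
    have := hg.re_le_one t
    simp only [Complex.neg_re, Complex.re_ofReal_mul, Complex.sub_re, Complex.one_re]
    nlinarith
  · intro t
    have h1 : -((c : ℂ) * (1 - g (-t))) = starRingEnd ℂ (-(c * (1 - g t))) := by
      rw [hg.map_neg]; simp
    rw [h1, Complex.exp_conj, Complex.conj_re]
  · intro s t
    refine hasSum_le (fun k => ?_) (hsg (s + t)) (((hsg s).mul_left 2).add ((hsg t).mul_left 2))
    have := (hg.pow k).isSubQuadratic.sub_le s t
    nlinarith [mul_le_mul_of_nonneg_left this (hnn k)]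
  · have := hg.continuous
    fun_prop

/-- φ(c(1 - g)) is the mixture over x under μ of the Poisson-type functions e^{-cx(1 - g)}. -/
lemma IsCharFun.isSubQuadratic_laplace {μ : Measure ℝ} [IsProbabilityMeasure μ]
    (hμ : μ (Set.Iio 0) = 0) {g : ℝ → ℂ} (hg : IsCharFun g) {c : ℝ} (hc : 0 ≤ c) :
    IsSubQuadratic (fun t => laplaceTransform μ (c * (1 - g t))) := by
  have hz := hg.isCharExponent hc
  have hre : ∀ t, ∫ x, (1 - (Complex.exp (-((c : ℂ) * (1 - g t) * (x : ℂ)))).re) ∂μ =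
      1 - (laplaceTransform μ (c * (1 - g t))).re := by
    intro t
    have hint := integrable_laplace (μ := μ) hμ (hz.re_nonneg t)
    have h1 : Integrable (fun x : ℝ => (Complex.exp (-((c : ℂ) * (1 - g t) * (x : ℂ)))).re) μ :=
      hint.re
    rw [integral_sub (integrable_const _) h1]
    have : ∫ x : ℝ, (Complex.exp (-((c : ℂ) * (1 - g t) * (x : ℂ)))).re ∂μ =
        (laplaceTransform μ (c * (1 - g t))).re := integral_re hint
    rw [this]; simp
  have hint : ∀ t, Integrable
      (fun x : ℝ => 1 - (Complex.exp (-((c : ℂ) * (1 - g t) * (x : ℂ)))).re) μ := fun t =>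
    (integrable_const _).sub (integrable_laplace (μ := μ) hμ (hz.re_nonneg t)).re
  constructor
  · exact fun t => norm_laplace_le_one hμ (hz.re_nonneg t)
  · intro t
    rw [hz.map_neg t, laplace_conj, Complex.conj_re]
  · intro s t
    rw [← hre, ← hre, ← hre, ← integral_const_mul, ← integral_const_mul, ← integral_add]
    · refine integral_mono_ae (hint _) (((hint s).const_mul 2).add ((hint t).const_mul 2)) ?_
      filter_upwards [ae_nonneg_of_Iio hμ] with x hx
      have := (hg.isSubQuadratic_exp (mul_nonneg hc hx)).sub_le s t
      have e : ∀ t, (((c * x : ℝ) : ℂ) * (1 - g t)) = c * (1 - g t) * x := fun t => by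
        push_cast; ring
      simp only [e] at this
      exact this
    · exact (hint s).const_mul 2
    · exact (hint t).const_mul 2
  · refine (continuousOn_laplace hμ).comp_continuous ?_ hz.re_nonneg
    have := hg.continuous
    fun_prop

lemma IsSubQuadratic.norm_one_sub_sq_le {f : ℝ → ℂ} (hf : IsSubQuadratic f) (t : ℝ) :
    ‖1 - f t‖ ^ 2 ≤ 2 * (1 - (f t).re) := by
  have h1 : ‖f t‖ ^ 2 ≤ 1 := pow_le_one₀ (norm_nonneg _) (hf.norm_le t)
  rw [Complex.sq_norm, Complex.normSq_apply] at h1 ⊢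
  simp only [Complex.sub_re, Complex.sub_im, Complex.one_re, Complex.one_im]
  nlinarith

/-- Pointwise convergence to a continuous function is uniform near the origin. -/
lemma IsSubQuadratic.uniform_near_zero {f : ℕ → ℝ → ℂ} (hf : ∀ n, IsSubQuadratic (f n))
    {F : ℝ → ℂ} (hF : Continuous F) (hF0 : F 0 = 1)
    (h : ∀ t, Tendsto (fun n => f n t) atTop (𝓝 (F t))) {ε : ℝ} (hε : 0 < ε) :
    ∃ τ : ℝ, 0 < τ ∧ ∀ᶠ n in atTop, ∀ t, |t| ≤ τ → ‖1 - f n t‖ ≤ ε := by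
  -- Chosen for the last step: 1 - Re f ≤ 13 δ together with ‖1 - f‖² ≤ 2(1 - Re f) gives ε².
  set δ := ε ^ 2 / 26 with hδ
  have hδ0 : 0 < δ := by positivity
  obtain ⟨ρ, hρ, hFρ⟩ : ∃ ρ : ℝ, 0 < ρ ∧ ∀ t, |t| < ρ → 1 - (F t).re < δ := by
    have hc : Continuous fun t => 1 - (F t).re := by fun_prop
    have h1 : ∀ᶠ t in 𝓝 (0 : ℝ), 1 - (F t).re < δ :=
      hc.continuousAt.eventually_lt_const (by simpa [hF0] using hδ0)
    obtain ⟨ρ, hρ, hb⟩ := Metric.eventually_nhds_iff.1 h1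
    exact ⟨ρ, hρ, fun t ht => hb (by simpa [Real.dist_eq] using ht)⟩
  set τ := ρ / 3 with hτ
  have hτ0 : 0 < τ := by positivity
  refine ⟨τ, hτ0, ?_⟩
  have hcA : ∀ n, Continuous fun s => 1 - (f n s).re := fun n => by
    have := (hf n).cont
    fun_prop
  have hnn : ∀ n s, 0 ≤ 1 - (f n s).re := fun n s => by
    linarith [(Complex.re_le_norm _).trans ((hf n).norm_le s)]
  have hlim : Tendsto (fun n => ∫ s in (-τ)..(2 * τ), (1 - (f n s).re)) atTop
      (𝓝 (∫ s in (-τ)..(2 * τ), (1 - (F s).re))) := by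
    refine intervalIntegral.tendsto_integral_filter_of_dominated_convergence (fun _ => (2 : ℝ))
      (Eventually.of_forall fun n => (hcA n).aestronglyMeasurable) ?_ (by simp) ?_
    · refine Eventually.of_forall fun n => Eventually.of_forall fun s _ => ?_
      rw [Real.norm_eq_abs, abs_of_nonneg (hnn n s)]
      have := (abs_le.1 ((Complex.abs_re_le_norm _).trans ((hf n).norm_le s))).1
      linarith
    · exact Eventually.of_forall fun s _ =>
        tendsto_const_nhds.sub ((Complex.continuous_re.tendsto _).comp (h s))
  have hFint : ∫ s in (-τ)..(2 * τ), (1 - (F s).re) ≤ 3 * τ * δ := by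
    have : ∫ s in (-τ)..(2 * τ), (1 - (F s).re) ≤ ∫ _ in (-τ)..(2 * τ), δ := by
      refine intervalIntegral.integral_mono_on_of_le_Ioo (by linarith) ?_ (by simp) ?_
      · have hc : Continuous fun t => 1 - (F t).re := by fun_prop
        exact hc.intervalIntegrable _ _
      · intro s hs
        refine (hFρ s ?_).le
        rw [abs_lt]; constructor <;> linarith [hs.1, hs.2]
    rw [intervalIntegral.integral_const, smul_eq_mul] at this
    linarith
  have hev : ∀ᶠ n in atTop, ∫ s in (-τ)..(2 * τ), (1 - (f n s).re) < 13 / 4 * τ * δ :=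
    hlim.eventually_lt_const (by nlinarith [mul_pos hτ0 hδ0])
  filter_upwards [hev] with n hn t ht
  -- Averaging 1 - Re f(t) ≤ 2(1 - Re f(s + t)) + 2(1 - Re f(s)) over s in [0, τ] bounds every value
  -- near 0 by one integral, for which dominated convergence suffices. Hence the bound is uniform in
  -- t.
  have hA : τ * (1 - (f n t).re) ≤ 4 * ∫ s in (-τ)..(2 * τ), (1 - (f n s).re) := by
    have hi : ∀ a b, IntervalIntegrable (fun s => 1 - (f n s).re) volume a b := fun a b =>
      (hcA n).intervalIntegrable a b
    have hsub : ∀ a b, -τ ≤ a → a ≤ b → b ≤ 2 * τ →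
        ∫ s in a..b, (1 - (f n s).re) ≤ ∫ s in (-τ)..(2 * τ), (1 - (f n s).re) := by
      intro a b h1 h2 h3
      exact intervalIntegral.integral_mono_interval h1 h2 h3
        (Eventually.of_forall fun s => hnn n s) (hi _ _)
    have h1 : ∫ _ in (0 : ℝ)..τ, (1 - (f n t).re) ≤
        ∫ s in (0 : ℝ)..τ, (2 * (1 - (f n (s + t)).re) + 2 * (1 - (f n s).re)) := by
      refine intervalIntegral.integral_mono_on hτ0.le (by simp) ?_ fun s _ => ?_
      · have := hcA n
        have h2 : Continuous fun s => 1 - (f n (s + t)).re := this.comp (by fun_prop)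
        exact ((h2.const_mul 2).add (this.const_mul 2)).intervalIntegrable _ _
      · have := (hf n).sub_le (s + t) (-s)
        rw [(hf n).re_neg, show s + t + -s = t by ring] at this
        exact this
    rw [intervalIntegral.integral_const, smul_eq_mul, sub_zero,
      intervalIntegral.integral_add, intervalIntegral.integral_const_mul,
      intervalIntegral.integral_const_mul,
      intervalIntegral.integral_comp_add_right (fun s => 1 - (f n s).re) t] at h1
    · have ht' := abs_le.1 ht
      have h2 := hsub (0 + t) (τ + t) (by linarith) (by linarith) (by linarith)
      have h3 := hsub 0 τ (by linarith) hτ0.le (by linarith)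
      linarith
    · have h2 : Continuous fun s => 1 - (f n (s + t)).re := (hcA n).comp (by fun_prop)
      exact (h2.const_mul 2).intervalIntegrable _ _
    · exact ((hcA n).const_mul 2).intervalIntegrable _ _
  have hA2 : 1 - (f n t).re ≤ 13 * δ := by
    have : τ * (1 - (f n t).re) ≤ τ * (13 * δ) := by nlinarith
    exact le_of_mul_le_mul_left this hτ0
  have := (hf n).norm_one_sub_sq_le t
  have h2 : ‖1 - f n t‖ ^ 2 ≤ ε ^ 2 := by rw [hδ] at hA2; linarith
  exact (abs_le_of_sq_le_sq' h2 hε.le).2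

end Tight


/-! ### Row exponents: classical convergence, tightness, degenerate limits. -/

section Attraction

/-- The exponents `n (1 - g(t / a_n) e^{-i t b_n})`. -/
noncomputable def rowExponent (g : ℝ → ℂ) (a b : ℕ → ℝ) (n : ℕ) (t : ℝ) : ℂ :=
  (n : ℂ) * (1 - normalizedCharFun g (a n) (b n) t)

/-- Telescoping w^n - v^n with v = e^{w - 1} in the unit disc costs n|w - v|, and |w - v| ≤ |1 - w|²
by Taylor expansion. -/
lemma norm_pow_sub_exp_le {w : ℂ} (hw : ‖w‖ ≤ 1) (hw1 : ‖1 - w‖ ≤ 1) (n : ℕ) :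
    ‖w ^ n - Complex.exp (-(n * (1 - w)))‖ ≤ n * ‖1 - w‖ ^ 2 := by
  have h1 : Complex.exp (-(n * (1 - w))) = Complex.exp (w - 1) ^ n := by
    rw [← Complex.exp_nat_mul]; congr 1; ring
  have h2 : ‖Complex.exp (w - 1)‖ ≤ 1 := by
    rw [Complex.norm_exp, Real.exp_le_one_iff, Complex.sub_re, Complex.one_re]
    linarith [(Complex.re_le_norm w)]
  have h3 : ‖w - Complex.exp (w - 1)‖ ≤ ‖1 - w‖ ^ 2 := by
    have := Complex.norm_exp_sub_one_sub_id_le (x := w - 1) (by rwa [norm_sub_rev])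
    rw [norm_sub_rev, norm_sub_rev 1 w]
    have e : Complex.exp (w - 1) - w = Complex.exp (w - 1) - 1 - (w - 1) := by ring
    rwa [e]
  rw [h1]
  clear h1
  refine le_trans ?_ (mul_le_mul_of_nonneg_left h3 (Nat.cast_nonneg n))
  generalize Complex.exp (w - 1) = v at h2
  induction n with
  | zero => simp
  | succ n ih =>
    calc ‖w ^ (n + 1) - v ^ (n + 1)‖ = ‖w ^ n * (w - v) + (w ^ n - v ^ n) * v‖ := by ring_nf
      _ ≤ ‖w ^ n * (w - v)‖ + ‖(w ^ n - v ^ n) * v‖ := norm_add_le _ _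
      _ ≤ 1 * ‖w - v‖ + (n * ‖w - v‖) * 1 := by
        rw [norm_mul, norm_mul, norm_pow]
        gcongr
        exact pow_le_one₀ (norm_nonneg _) hw
      _ = _ := by push_cast; ring

/-- The difference divided by 2πi is integer-valued and continuous, hence constant. -/
lemma eq_of_exp_eq {u v : ℝ → ℂ} (hu : Continuous u) (hv : Continuous v) (h0 : u 0 = v 0)
    (h : ∀ t, Complex.exp (u t) = Complex.exp (v t)) : u = v := by
  have h1 : ∀ t, ∃ n : ℤ, u t = v t + n * (2 * Real.pi * Complex.I) := fun t =>
    Complex.exp_eq_exp_iff_exists_int.1 (h t)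
  choose m hm using h1
  have hpi : (2 * Real.pi * Complex.I : ℂ) ≠ 0 := Complex.two_pi_I_ne_zero
  have hmc : Continuous m := by
    have hc : Continuous fun t => ((m t : ℝ)) := by
      have : (fun t => (m t : ℝ)) = fun t => ((u t - v t) / (2 * Real.pi * Complex.I)).re := by
        funext t
        rw [hm t, add_sub_cancel_left, mul_div_assoc, div_self hpi]
        simp
      rw [this]
      fun_prop
    exact Int.isClosedEmbedding_coe_real.isEmbedding.continuous_iff.2 hc
  have hconst : ∀ t, m t = m 0 := fun t => PreconnectedSpace.constant inferInstance hmc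
  have hm0 : m 0 = 0 := by
    have := hm 0
    rw [h0, left_eq_add, mul_eq_zero] at this
    exact_mod_cast this.resolve_right hpi
  funext t
  rw [hm t, hconst, hm0]; simp

variable {g : ℝ → ℂ} {a b : ℕ → ℝ}

lemma IsCharFun.isCharExponent_row (hg : IsCharFun g) (n : ℕ) :
    IsCharExponent (rowExponent g a b n) := by
  have h := (hg.normalized (a n) (b n)).isCharExponent (Nat.cast_nonneg (α := ℝ) n)
  simp only [Complex.ofReal_natCast] at h
  exact h

lemma IsCharFun.continuous_row (hg : IsCharFun g) (n : ℕ) :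
    Continuous (rowExponent g a b n) := by
  have := (hg.normalized (a n) (b n)).continuous
  unfold rowExponent
  fun_prop

lemma norm_one_sub_normalizedCharFun {n : ℕ} (hn : 1 ≤ n) (t : ℝ) :
    ‖1 - normalizedCharFun g (a n) (b n) t‖ = ‖rowExponent g a b n t‖ / n := by
  have : (0 : ℝ) < n := by exact_mod_cast hn
  rw [rowExponent, norm_mul, Complex.norm_natCast]
  field_simp

lemma IsCharFun.norm_pow_sub_exp_row_le (hg : IsCharFun g) {n : ℕ} (hn : 1 ≤ n) {t : ℝ}
    (h : ‖rowExponent g a b n t‖ ≤ n) :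
    ‖normalizedCharFun g (a n) (b n) t ^ n - Complex.exp (-rowExponent g a b n t)‖ ≤
      ‖rowExponent g a b n t‖ ^ 2 / n := by
  have hn0 : (0 : ℝ) < n := by exact_mod_cast hn
  have h1 := norm_pow_sub_exp_le ((hg.normalized (a n) (b n)).norm_le_one t)
    (by rw [norm_one_sub_normalizedCharFun hn]; exact (div_le_one hn0).2 h) n
  refine h1.trans_eq ?_
  rw [norm_one_sub_normalizedCharFun hn]
  field_simp

lemma tendsto_laplace_of_row {μ : Measure ℝ} [IsProbabilityMeasure μ] (hμ : μ (Set.Iio 0) = 0)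
    {z : ℕ → ℂ} {w : ℂ} (hz : ∀ n, 0 ≤ (z n).re) (h : Tendsto z atTop (𝓝 w)) :
    Tendsto (fun n => laplaceTransform μ (z n)) atTop (𝓝 (laplaceTransform μ w)) := by
  have hw : 0 ≤ w.re := ge_of_tendsto ((Complex.continuous_re.tendsto _).comp h)
    (Eventually.of_forall hz)
  exact (continuousOn_laplace hμ w hw).tendsto.comp
    (tendsto_nhdsWithin_iff.2 ⟨h, Eventually.of_forall hz⟩)

lemma IsCharFun.tendsto_pow_of_row (hg : IsCharFun g) {t : ℝ} {w : ℂ}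
    (h : Tendsto (fun n => rowExponent g a b n t) atTop (𝓝 w)) :
    Tendsto (fun n => normalizedCharFun g (a n) (b n) t ^ n) atTop (𝓝 (Complex.exp (-w))) := by
  have h1 : Tendsto (fun n => Complex.exp (-rowExponent g a b n t)) atTop
      (𝓝 (Complex.exp (-w))) := (Complex.continuous_exp.tendsto _).comp h.neg
  have h2 : Tendsto (fun n : ℕ => ‖rowExponent g a b n t‖ ^ 2 / n) atTop (𝓝 0) :=
    (h.norm.pow 2).div_atTop tendsto_natCast_atTop_atTop
  have h3 : Tendsto (fun n => normalizedCharFun g (a n) (b n) t ^ n -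
      Complex.exp (-rowExponent g a b n t)) atTop (𝓝 0) := by
    refine squeeze_zero_norm' ?_ h2
    have e1 : ∀ᶠ n in atTop, ‖rowExponent g a b n t‖ < ‖w‖ + 1 :=
      h.norm.eventually_lt_const (by linarith)
    have e2 : ∀ᶠ n : ℕ in atTop, ‖w‖ + 1 ≤ n :=
      tendsto_natCast_atTop_atTop.eventually_ge_atTop _
    filter_upwards [e1, e2, eventually_ge_atTop 1] with n h1 h2 h3
    exact hg.norm_pow_sub_exp_row_le h3 (h1.le.trans h2)
  simpa using h3.add h1

/-- The functions φ(z_n) are uniformly close to 1 near the origin, because they are mixtures of ChFs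
with continuous limit; the barrier for φ then keeps z_n small. -/
lemma IsCharFun.tightExponents_of_laplace {μ : Measure ℝ} [IsProbabilityMeasure μ]
    (hμ : μ (Set.Iio 0) = 0) (hμ0 : μ ≠ Measure.dirac 0) (hg : IsCharFun g) {ψ : ℝ → ℂ}
    (hψ : Continuous ψ) (hψ0 : ψ 0 = 0) (hre : ∀ t, 0 ≤ (ψ t).re)
    (h : ∀ t, Tendsto (fun n => laplaceTransform μ (rowExponent g a b n t)) atTop
      (𝓝 (laplaceTransform μ (ψ t)))) : TightExponents (rowExponent g a b) := by
  obtain ⟨r₀, hr₀, hb⟩ := exists_laplace_barrier hμ hμ0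
  refine TightExponents.of_barrier (f := fun n t => laplaceTransform μ (rowExponent g a b n t))
    hg.isCharExponent_row hg.continuous_row (fun ε hε => ?_) hr₀ (fun r hr hrr => ?_)
  · refine IsSubQuadratic.uniform_near_zero (fun n => ?_)
      ((continuousOn_laplace hμ).comp_continuous hψ hre) (by simp [hψ0, laplace_zero]) h hε
    have h := (hg.normalized (a n) (b n)).isSubQuadratic_laplace hμ (Nat.cast_nonneg (α := ℝ) n)
    simp only [Complex.ofReal_natCast] at h
    exact h
  · obtain ⟨κ, hκ, h⟩ := hb r hr hrr
    exact ⟨κ, hκ, Eventually.of_forall fun n t ht =>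
      h _ ((hg.isCharExponent_row n).re_nonneg t) ht⟩

/-- On ‖z_n‖ = r the power g_n^n differs from 1 - z_n by at most 2r², so it stays at distance r -
2r² ≥ r/2 from 1 when r < 1/4. -/
lemma IsCharFun.tightExponents_of_pow (hg : IsCharFun g) {ψ : ℝ → ℂ}
    (hψ : Continuous ψ) (hψ0 : ψ 0 = 0)
    (h : ∀ t, Tendsto (fun n => normalizedCharFun g (a n) (b n) t ^ n) atTop
      (𝓝 (Complex.exp (-ψ t)))) : TightExponents (rowExponent g a b) := by
  refine TightExponents.of_barrier (f := fun n t => normalizedCharFun g (a n) (b n) t ^ n)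
    hg.isCharExponent_row hg.continuous_row (fun ε hε => ?_) (r₀ := 1 / 4) (by norm_num)
    (fun r hr hrr => ⟨r / 2, by positivity, ?_⟩)
  · exact IsSubQuadratic.uniform_near_zero
      (fun n => ((hg.normalized (a n) (b n)).pow n).isSubQuadratic) (by fun_prop)
      (by simp [hψ0]) h hε
  · filter_upwards [eventually_ge_atTop 1] with n hn t ht
    have hn1 : (1 : ℝ) ≤ n := by exact_mod_cast hn
    have h1 := hg.norm_pow_sub_exp_row_le (a := a) (b := b) hn (t := t) (by rw [ht]; linarith)
    rw [ht] at h1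
    have h1' : r ^ 2 / n ≤ r ^ 2 := div_le_self (sq_nonneg r) hn1
    have h2 := Complex.norm_exp_sub_one_sub_id_le (x := -rowExponent g a b n t)
      (by rw [norm_neg, ht]; linarith)
    rw [norm_neg, ht] at h2
    have h3 : r ≤ ‖1 - normalizedCharFun g (a n) (b n) t ^ n‖ + r ^ 2 + r ^ 2 := by
      set w := normalizedCharFun g (a n) (b n) t ^ n
      set e := Complex.exp (-rowExponent g a b n t)
      calc r = ‖rowExponent g a b n t‖ := ht.symm
        _ = ‖(1 - w) + (w - e) + (e - 1 - -rowExponent g a b n t)‖ := by ring_nf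
        _ ≤ ‖(1 - w)‖ + ‖w - e‖ + ‖e - 1 - -rowExponent g a b n t‖ := norm_add₃_le
        _ ≤ _ := by gcongr; exact h1.trans h1'
    nlinarith

/-- Classical convergence to `e^{-ψ}` amounts to convergence of the exponents. -/
lemma IsCharFun.tendsto_row_of_pow (hg : IsCharFun g) {ψ : ℝ → ℂ}
    (hψ : Continuous ψ) (hψ0 : ψ 0 = 0)
    (h : ∀ t, Tendsto (fun n => normalizedCharFun g (a n) (b n) t ^ n) atTop
      (𝓝 (Complex.exp (-ψ t)))) (t : ℝ) :
    Tendsto (fun n => rowExponent g a b n t) atTop (𝓝 (ψ t)) := by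
  have hz := hg.tightExponents_of_pow hψ hψ0 h
  refine hz.tendsto_of_unique_limit (fun σ χ hσ hχ => ?_) t
  have hzσ := hz.comp hσ.tendsto_atTop
  refine eq_of_exp_eq (hzσ.continuous_limit hχ) hψ
    (by rw [(hzσ.isCharExponent_limit hχ).map_zero, hψ0]) fun t => ?_
  rw [← neg_neg (χ t), ← neg_neg (ψ t), Complex.exp_neg (-χ t), Complex.exp_neg (-ψ t)]
  congr 1
  -- compare the limits of the powers with those of the exponentials
  have h1 : Tendsto (fun n => Complex.exp (-rowExponent g a b (σ n) t)) atTop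
      (𝓝 (Complex.exp (-χ t))) := (Complex.continuous_exp.tendsto _).comp (hχ t).neg
  have h2 : Tendsto (fun n : ℕ => ‖rowExponent g a b (σ n) t‖ ^ 2 / (σ n : ℝ)) atTop (𝓝 0) :=
    ((hχ t).norm.pow 2).div_atTop (tendsto_natCast_atTop_atTop.comp hσ.tendsto_atTop)
  have h3 : Tendsto (fun n => normalizedCharFun g (a (σ n)) (b (σ n)) t ^ (σ n) -
      Complex.exp (-rowExponent g a b (σ n) t)) atTop (𝓝 0) := by
    refine squeeze_zero_norm' ?_ h2
    have e1 : ∀ᶠ n in atTop, ‖rowExponent g a b (σ n) t‖ < ‖χ t‖ + 1 :=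
      (hχ t).norm.eventually_lt_const (by linarith)
    have e2 : ∀ᶠ n : ℕ in atTop, ‖χ t‖ + 1 ≤ (σ n : ℝ) :=
      (tendsto_natCast_atTop_atTop.comp hσ.tendsto_atTop).eventually_ge_atTop _
    filter_upwards [e1, e2, hσ.tendsto_atTop.eventually_ge_atTop 1] with n h1 h2 h3
    exact hg.norm_pow_sub_exp_row_le h3 (h1.le.trans h2)
  have h4 := h3.add h1
  simp only [sub_add_cancel, zero_add] at h4
  exact tendsto_nhds_unique h4 ((h t).comp hσ.tendsto_atTop)

/-- Every characteristic function is attracted to every degenerate law. -/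
lemma IsCharFun.exists_tendsto_row_linear (hg : IsCharFun g) (D : ℝ) :
    ∃ a b : ℕ → ℝ, (∀ n, 0 < a n) ∧
      ∀ t : ℝ, Tendsto (fun n => rowExponent g a b n t) atTop (𝓝 (Complex.I * D * t)) := by
  have hδ : ∀ n : ℕ, ∃ δ : ℝ, 0 < δ ∧ ∀ u, |u| < δ → ‖1 - g u‖ < 1 / ((n : ℝ) + 1) ^ 2 := by
    intro n
    have h0 := hg.continuous.tendsto 0
    rw [hg.map_zero] at h0
    obtain ⟨δ, hδ, h⟩ := Metric.tendsto_nhds_nhds.1 h0 (1 / ((n : ℝ) + 1) ^ 2) (by positivity)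
    refine ⟨δ, hδ, fun u hu => ?_⟩
    rw [norm_sub_rev, ← dist_eq_norm]
    exact h (by simpa [Real.dist_eq] using hu)
  choose δ hδ hδg using hδ
  -- The norming is so strong that t / a_n falls in the δ_n-window as soon as n ≥ |t|, making n(1 -
  -- g(t / a_n)) of order 1/n. The centring D / n alone then produces the limit.
  refine ⟨fun n => (n + 1) / δ n, fun n => D / n, fun n => div_pos (by positivity) (hδ n),
    fun t => ?_⟩
  have h1 : Tendsto (fun n : ℕ => (n : ℂ) * (1 - g (t / ((n + 1) / δ n))) *
      Complex.exp (-(Complex.I * (t * (D / n) : ℝ)))) atTop (𝓝 0) := by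
    have h0 : Tendsto (fun n : ℕ => 1 / ((n : ℝ) + 1)) atTop (𝓝 0) :=
      tendsto_one_div_add_atTop_nhds_zero_nat
    refine squeeze_zero_norm' ?_ h0
    filter_upwards [tendsto_natCast_atTop_atTop.eventually_ge_atTop |t|] with n hn
    have hne : ‖Complex.exp (-(Complex.I * (t * (D / n) : ℝ)))‖ = 1 := by
      rw [Complex.norm_exp]; simp
    have hsmall : |t / ((n + 1) / δ n)| < δ n := by
      have h2 : (0 : ℝ) < (n + 1) / δ n := div_pos (by positivity) (hδ n)
      rw [abs_div, abs_of_pos h2, div_lt_iff₀ h2, mul_div_cancel₀ _ (hδ n).ne']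
      linarith
    have h3 := hδg n _ hsmall
    rw [norm_mul, norm_mul, hne, mul_one, Complex.norm_natCast]
    have h4 : (0 : ℝ) < (n : ℝ) + 1 := by positivity
    calc (n : ℝ) * ‖1 - g (t / ((n + 1) / δ n))‖ ≤ (n + 1) * (1 / ((n : ℝ) + 1) ^ 2) := by
          gcongr; linarith
      _ = 1 / ((n : ℝ) + 1) := by field_simp
  have h2 : Tendsto (fun n : ℕ => (n : ℂ) * (1 - Complex.exp (-(Complex.I * (t * (D / n) : ℝ)))))
      atTop (𝓝 (Complex.I * D * t)) := by
    set c : ℂ := -(Complex.I * D * t) with hc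
    have hder : HasDerivAt (fun x : ℂ => Complex.exp (c * x)) c 0 := by
      have := ((hasDerivAt_id (0 : ℂ)).const_mul c).cexp
      simpa using this
    have hlim : Tendsto (fun n : ℕ => (n : ℝ)⁻¹) atTop (𝓝[≠] 0) :=
      tendsto_nhdsWithin_iff.2 ⟨tendsto_inv_atTop_nhds_zero_nat, by
        filter_upwards [eventually_ge_atTop 1] with n hn
        have : (n : ℝ) ≠ 0 := by positivity
        simpa using this⟩
    have hlimc : Tendsto (fun n : ℕ => (n : ℂ)⁻¹) atTop (𝓝[≠] 0) :=
      tendsto_nhdsWithin_iff.2 ⟨by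
        have := (Complex.continuous_ofReal.tendsto 0).comp
          (tendsto_inv_atTop_nhds_zero_nat (𝕜 := ℝ))
        simpa [Function.comp_def] using this, by
        filter_upwards [eventually_ge_atTop 1] with n hn
        have : (n : ℂ) ≠ 0 := by exact_mod_cast (by omega : n ≠ 0)
        simpa using this⟩
    have := (hasDerivAt_iff_tendsto_slope_zero.1 hder).comp hlimc
    have hneg := this.neg
    rw [hc, neg_neg] at hneg
    refine hneg.congr fun n => ?_
    simp only [Function.comp, zero_add, mul_zero, Complex.exp_zero, inv_inv, smul_eq_mul]
    rw [← mul_neg, neg_sub]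
    congr 3
    push_cast
    ring_nf
  have h3 := h1.add h2
  rw [zero_add] at h3
  refine h3.congr fun n => ?_
  simp only [rowExponent, normalizedCharFun]
  ring

end Attraction


/-! ### Solving the self-similarity equation on the half-line. -/

section SelfSimilar

/-- `χ(u) = k χ(c u) - i e u` for every `k`, with a scale `c` and a drift `e` depending on `k`. -/
def IsSelfSimilar (χ : ℝ → ℂ) (I : Set ℝ) : Prop :=
  ∀ k : ℕ, 2 ≤ k → ∃ c e : ℝ, 0 < c ∧ ∀ u ∈ I, χ u = k * χ (c * u) - Complex.I * e * u

/-- A subgroup of the plane on which one coordinate controls the sign of the other is a line. -/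
lemma proportional_of_sign {H : AddSubgroup (ℝ × ℝ)} (hH : ∀ p ∈ H, 0 ≤ p.1 → 0 ≤ p.2)
    {p q : ℝ × ℝ} (hp : p ∈ H) (hq : q ∈ H) (hp2 : 0 < p.2) :
    p.1 * q.2 = q.1 * p.2 := by
  have hp1 : 0 < p.1 := by
    by_contra! h
    have := hH (-p) (H.neg_mem hp) (by simpa using h)
    simp only [Prod.snd_neg] at this
    linarith
  -- The sign condition applied to integer combinations of p and q: the ratios of first and of
  -- second coordinates fall on the same side of every rational.
  have key : ∀ r : ℤ × ℕ, 0 < r.2 → 0 ≤ (r.2 : ℝ) * q.1 - r.1 * p.1 →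
      0 ≤ (r.2 : ℝ) * q.2 - r.1 * p.2 := by
    intro r _ h
    have := hH (r.2 • q - r.1 • p) (H.sub_mem (H.nsmul_mem hq _) (H.zsmul_mem hp _))
      (by simpa using h)
    simpa using this
  have key' : ∀ r : ℤ × ℕ, 0 < r.2 → (r.2 : ℝ) * q.1 - r.1 * p.1 ≤ 0 →
      (r.2 : ℝ) * q.2 - r.1 * p.2 ≤ 0 := by
    intro r _ h
    have := hH (r.1 • p - r.2 • q) (H.sub_mem (H.zsmul_mem hp _) (H.nsmul_mem hq _))
      (by simp; linarith)
    simp at this; linarith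
  have hrat : ∀ x : ℚ, ((x.num, x.den) : ℤ × ℕ).1 = (x : ℝ) * ((x.num, x.den) : ℤ × ℕ).2 := by
    intro x
    exact_mod_cast (Rat.mul_den_eq_num x).symm
  suffices h : q.2 / p.2 = q.1 / p.1 by
    rw [div_eq_div_iff hp2.ne' hp1.ne'] at h
    linarith
  rcases lt_trichotomy (q.2 / p.2) (q.1 / p.1) with h | h | h
  · obtain ⟨x, hx1, hx2⟩ := exists_rat_btwn h
    rw [div_lt_iff₀ hp2] at hx1
    rw [lt_div_iff₀ hp1] at hx2
    have hd : (0 : ℝ) < x.den := by exact_mod_cast x.den_pos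
    have := key (x.num, x.den) x.den_pos (by rw [hrat]; simp only; nlinarith)
    rw [hrat] at this
    simp only at this
    nlinarith
  · exact h
  · obtain ⟨x, hx1, hx2⟩ := exists_rat_btwn h
    rw [lt_div_iff₀ hp2] at hx2
    rw [div_lt_iff₀ hp1] at hx1
    have hd : (0 : ℝ) < x.den := by exact_mod_cast x.den_pos
    have := key' (x.num, x.den) x.den_pos (by rw [hrat]; simp only; nlinarith)
    rw [hrat] at this
    simp only at this
    nlinarith

/-- Pairs `(log s, -log λ)` with `χ(u) = s χ(λ u) - i e u` on the half-line. -/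
def selfSimilarGroup (χ : ℝ → ℂ) : AddSubgroup (ℝ × ℝ) where
  carrier := {p | ∃ e : ℝ, ∀ u : ℝ, 0 < u →
    χ u = (Real.exp p.1 : ℝ) * χ (Real.exp (-p.2) * u) - Complex.I * e * u}
  zero_mem' := ⟨0, fun u _ => by simp⟩
  add_mem' := by
    rintro p q ⟨e, he⟩ ⟨e', he'⟩
    refine ⟨e + Real.exp p.1 * Real.exp (-p.2) * e', fun u hu => ?_⟩
    rw [he u hu, he' _ (mul_pos (Real.exp_pos _) hu)]
    simp only [Prod.fst_add, Prod.snd_add, neg_add, Real.exp_add, ← mul_assoc]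
    rw [mul_comm (Real.exp (-q.2)) (Real.exp (-p.2))]
    push_cast
    ring
  neg_mem' := by
    rintro p ⟨e, he⟩
    refine ⟨-(Real.exp (-p.1) * Real.exp p.2 * e), fun u hu => ?_⟩
    have := he (Real.exp p.2 * u) (mul_pos (Real.exp_pos _) hu)
    rw [← mul_assoc, ← Real.exp_add, neg_add_cancel, Real.exp_zero, one_mul] at this
    simp only [Prod.fst_neg, Prod.snd_neg, neg_neg]
    rw [this, Real.exp_neg]
    have h0 : (Real.exp p.1 : ℂ) ≠ 0 := by exact_mod_cast (Real.exp_pos _).ne'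
    push_cast at h0 ⊢
    field_simp
    ring

variable {χ : ℝ → ℂ}

/-- Iteration would keep Re χ(c^n u) ≥ Re χ(u) > 0 although c^n u tends to 0. -/
lemma not_scale_of_tendsto_zero (h0 : Tendsto χ (𝓝[>] 0) (𝓝 0)) {u : ℝ} (hu : 0 < u)
    (hpos : 0 < (χ u).re) {s c : ℝ} (hs : 1 ≤ s) (hc0 : 0 < c) (hc : c < 1)
    (h : ∀ v, 0 < v → (χ (c * v)).re = s * (χ v).re) : False := by
  have h1 : ∀ n : ℕ, (χ u).re ≤ (χ (c ^ n * u)).re := by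
    intro n
    induction n with
    | zero => simp
    | succ n ih =>
      rw [pow_succ', mul_assoc, h _ (by positivity)]
      nlinarith
  have h2 : Tendsto (fun n : ℕ => c ^ n * u) atTop (𝓝[>] 0) := by
    refine tendsto_nhdsWithin_iff.2 ⟨?_, Eventually.of_forall fun n => ?_⟩
    · simpa using (tendsto_pow_atTop_nhds_zero_of_lt_one hc0.le hc).mul_const u
    · exact mul_pos (by positivity) hu
  have h3 := (Complex.continuous_re.tendsto _).comp (h0.comp h2)
  have := ge_of_tendsto h3 (Eventually.of_forall h1)
  simp at this
  linarith

/-- A factor s ≥ 1 cannot go with an expansion of the argument. This is the hypothesis of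
`proportional_of_sign`, and it stands in for any regularity of the scale as a function of s. -/
lemma selfSimilarGroup_sign (h0 : Tendsto χ (𝓝[>] 0) (𝓝 0)) {u : ℝ} (hu : 0 < u)
    (hpos : 0 < (χ u).re) : ∀ p ∈ selfSimilarGroup χ, 0 ≤ p.1 → 0 ≤ p.2 := by
  rintro p ⟨e, he⟩ hp
  by_contra! h
  refine not_scale_of_tendsto_zero h0 hu hpos (s := Real.exp p.1) (c := Real.exp p.2)
    (Real.one_le_exp hp) (Real.exp_pos _) (by rw [← Real.exp_zero]; exact Real.exp_lt_exp.2 h) fun v hv => ?_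
  have h1 := he (Real.exp p.2 * v) (mul_pos (Real.exp_pos _) hv)
  rw [← mul_assoc, ← Real.exp_add, neg_add_cancel, Real.exp_zero, one_mul] at h1
  rw [h1, Complex.sub_re, Complex.re_ofReal_mul]
  simp

lemma eq_on_pos_of_rat {f g : ℝ → ℝ} (hf : ContinuousOn f (Set.Ioi 0))
    (hg : ContinuousOn g (Set.Ioi 0)) (h : ∀ q : ℚ, 0 < q → f q = g q) {s : ℝ} (hs : 0 < s) :
    f s = g s := by
  have : ∃ q : ℕ → ℚ, (∀ n, 0 < q n) ∧ Tendsto (fun n => (q n : ℝ)) atTop (𝓝 s) := by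
    have : ∀ n : ℕ, ∃ q : ℚ, s < q ∧ (q : ℝ) < s + 1 / ((n : ℝ) + 1) := fun n =>
      exists_rat_btwn (by linarith [show (0 : ℝ) < 1 / ((n : ℝ) + 1) by positivity])
    choose q h1 h2 using this
    refine ⟨q, fun n => by exact_mod_cast hs.trans (h1 n), ?_⟩
    refine tendsto_of_tendsto_of_tendsto_of_le_of_le tendsto_const_nhds ?_ (fun n => (h1 n).le)
      (fun n => (h2 n).le)
    simpa using tendsto_one_div_add_atTop_nhds_zero_nat.const_add s
  obtain ⟨q, hq, hqs⟩ := this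
  have h1 := ((hf.continuousAt (Ioi_mem_nhds hs)).tendsto).comp hqs
  have h2 := ((hg.continuousAt (Ioi_mem_nhds hs)).tendsto).comp hqs
  refine tendsto_nhds_unique h1 (h2.congr fun n => ?_)
  exact (h _ (hq n)).symm

/-- The exponents of stable laws on the positive half-line. -/
lemma IsSelfSimilar.form (hss : IsSelfSimilar χ (Set.Ioi 0)) (hc : ContinuousOn χ (Set.Ioi 0))
    (h0 : Tendsto χ (𝓝[>] 0) (𝓝 0)) (hpos : ∀ u, 0 < u → 0 < (χ u).re)
    (h2 : (χ 2).re ≤ 4 * (χ 1).re) :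
    ∃ α : ℝ, 0 < α ∧ α ≤ 2 ∧ ∃ ζ : ℂ, 0 < ζ.re ∧
      ((α ≠ 1 ∧ ∃ d : ℝ, ∀ t : ℝ, 0 < t → χ t = ζ * (t ^ α : ℝ) + Complex.I * d * t) ∨
      (α = 1 ∧ ∃ β : ℝ, ∀ t : ℝ, 0 < t → χ t = ζ * t + Complex.I * β * (t * Real.log t : ℝ))) := by
  have hsign := selfSimilarGroup_sign h0 one_pos (hpos 1 one_pos)
  -- the integers are scaling factors
  have hk : ∀ k : ℕ, 2 ≤ k → ∃ y, (Real.log k, y) ∈ selfSimilarGroup χ := by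
    intro k hk
    obtain ⟨c, e, hc0, h⟩ := hss k hk
    refine ⟨-Real.log c, e, fun u hu => ?_⟩
    simp only [neg_neg]
    rw [Real.exp_log hc0, Real.exp_log (by positivity)]
    exact_mod_cast h u hu
  obtain ⟨y₂, hy₂⟩ := hk 2 le_rfl
  have hy2pos : 0 < y₂ := by
    refine lt_of_le_of_ne (hsign _ hy₂ (Real.log_nonneg (by norm_num))) fun h => ?_
    obtain ⟨e, he⟩ := hy₂
    have := congrArg Complex.re (he 1 one_pos)
    rw [← h] at this
    simp only [neg_zero, Real.exp_zero, one_mul, Nat.cast_ofNat, Real.exp_log two_pos] at this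
    simp at this
    linarith [hpos 1 one_pos]
  have hl2 : 0 < Real.log 2 := Real.log_pos (by norm_num)
  -- The slope of the line containing the whole group: integers k have scale k^{-a}, quotients
  -- extend this to the rationals, and continuity of χ to all s > 0.
  set a := y₂ / Real.log 2 with ha
  have ha0 : 0 < a := by positivity
  have hkmem : ∀ k : ℕ, 1 ≤ k → (Real.log k, a * Real.log k) ∈ selfSimilarGroup χ := by
    intro k hk1
    rcases hk1.eq_or_lt with rfl | hk1
    · have h := (selfSimilarGroup χ).zero_mem
      rw [Nat.cast_one, Real.log_one, mul_zero]
      exact h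
    · obtain ⟨y, hy⟩ := hk k hk1
      have := proportional_of_sign hsign hy₂ hy hy2pos
      simp only [Nat.cast_ofNat] at this
      have hya : y = a * Real.log k := by
        rw [ha]; field_simp; linarith
      rwa [← hya]
  have hqmem : ∀ q : ℚ, 0 < q → (Real.log q, a * Real.log q) ∈ selfSimilarGroup χ := by
    intro q hq
    have hn : 0 < q.num := Rat.num_pos.2 hq
    have h1 := (selfSimilarGroup χ).sub_mem (hkmem q.num.toNat (by omega)) (hkmem q.den q.den_pos)
    have hq' : (q : ℝ) = (q.num.toNat : ℝ) / q.den := by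
      have : (q.num.toNat : ℝ) = (q.num : ℝ) := by
        exact_mod_cast congrArg (Int.cast (R := ℝ)) (Int.toNat_of_nonneg hn.le)
      rw [this]
      exact Rat.cast_def q
    have hn' : (q.num.toNat : ℝ) ≠ 0 := by
      have : q.num.toNat ≠ 0 := by omega
      exact_mod_cast this
    have hlog : Real.log q = Real.log q.num.toNat - Real.log q.den := by
      rw [hq', Real.log_div hn' (by exact_mod_cast q.den_nz)]
    rw [hlog, mul_sub]
    exact h1
  have hqeq : ∀ q : ℚ, 0 < q → ∃ e : ℝ, ∀ u : ℝ, 0 < u →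
      χ u = (q : ℝ) * χ ((q : ℝ) ^ (-a) * u) - Complex.I * e * u := by
    intro q hq
    obtain ⟨e, he⟩ := hqmem q hq
    have hq' : (0 : ℝ) < q := by exact_mod_cast hq
    refine ⟨e, fun u hu => ?_⟩
    have := he u hu
    simp only [Real.exp_log hq'] at this
    rwa [show -(a * Real.log q) = Real.log q * (-a) by ring, ← Real.rpow_def_of_pos hq'] at this
  set ρ : ℝ → ℝ := fun t => (χ t).re with hρ
  set τ : ℝ → ℝ := fun t => (χ t).im with hτ
  have hρc : ContinuousOn ρ (Set.Ioi 0) := Complex.continuous_re.comp_continuousOn hc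
  have hτc : ContinuousOn τ (Set.Ioi 0) := Complex.continuous_im.comp_continuousOn hc
  have hmaps : ∀ u : ℝ, 0 < u → ContinuousOn (fun s : ℝ => s ^ (-a) * u) (Set.Ioi 0) := fun u _ s hs =>
    ((Real.continuousAt_rpow_const s _ (Or.inl (ne_of_gt hs))).mul_const u).continuousWithinAt
  have hmapsTo : ∀ u : ℝ, 0 < u → Set.MapsTo (fun s : ℝ => s ^ (-a) * u) (Set.Ioi 0) (Set.Ioi 0) :=
    fun u hu s hs => mul_pos (Real.rpow_pos_of_pos hs _) hu
  have hρs : ∀ u s : ℝ, 0 < u → 0 < s → ρ u = s * ρ (s ^ (-a) * u) := by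
    intro u s hu hs
    refine eq_on_pos_of_rat (f := fun _ => ρ u) (g := fun s => s * ρ (s ^ (-a) * u))
      continuousOn_const (continuousOn_id.mul (hρc.comp (hmaps u hu) (hmapsTo u hu)))
      (fun q hq => ?_) hs
    obtain ⟨e, he⟩ := hqeq q hq
    have := congrArg Complex.re (he u hu)
    simpa using this
  -- The drift e is eliminated by evaluating at u = 1. The resulting relation involves continuous
  -- functions of s only, so it passes from rational to real s.
  have hτs : ∀ u s : ℝ, 0 < u → 0 < s →
      τ u = s * τ (s ^ (-a) * u) - (s * τ (s ^ (-a) * 1) - τ 1) * u := by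
    intro u s hu hs
    refine eq_on_pos_of_rat (f := fun _ => τ u)
      (g := fun s => s * τ (s ^ (-a) * u) - (s * τ (s ^ (-a) * 1) - τ 1) * u)
      continuousOn_const ((continuousOn_id.mul (hτc.comp (hmaps u hu) (hmapsTo u hu))).sub
        (((continuousOn_id.mul (hτc.comp (hmaps 1 one_pos) (hmapsTo 1 one_pos))).sub
          continuousOn_const).mul continuousOn_const))
      (fun q hq => ?_) hs
    obtain ⟨e, he⟩ := hqeq q hq
    have e1 := congrArg Complex.im (he u hu)
    have e2 := congrArg Complex.im (he 1 one_pos)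
    simp at e1 e2
    simp only [hτ, mul_one]
    rw [e2, e1]
    ring
  set α := 1 / a with hα
  have hα0 : 0 < α := by positivity
  have hscale : ∀ v : ℝ, 0 < v → (v ^ (-α)) ^ (-a) = v := by
    intro v hv
    rw [← Real.rpow_mul hv.le]
    have : -α * -a = 1 := by rw [hα]; field_simp
    rw [this, Real.rpow_one]
  have hρt : ∀ t, 0 < t → ρ t = ρ 1 * t ^ α := by
    intro t ht
    have h := hρs 1 (t ^ (-α)) one_pos (Real.rpow_pos_of_pos ht _)
    rw [hscale t ht, mul_one, Real.rpow_neg ht.le] at h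
    have : t ^ α ≠ 0 := (Real.rpow_pos_of_pos ht _).ne'
    rw [h]; field_simp
  have hτt : ∀ u v, 0 < u → 0 < v →
      τ (v * u) = v ^ α * τ u + u * τ v - v ^ α * u * τ 1 := by
    intro u v hu hv
    have h := hτs u (v ^ (-α)) hu (Real.rpow_pos_of_pos hv _)
    rw [hscale v hv, mul_one, Real.rpow_neg hv.le] at h
    have : v ^ α ≠ 0 := (Real.rpow_pos_of_pos hv _).ne'
    field_simp at h
    linarith
  have hα2 : α ≤ 2 := by
    have h1 := hρt 2 two_pos
    have hρ1 : 0 < ρ 1 := hpos 1 one_pos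
    have h3 : (2 : ℝ) ^ α ≤ 2 ^ (2 : ℝ) := by
      have : ρ 2 ≤ 4 * ρ 1 := h2
      rw [h1] at this
      norm_num
      nlinarith
    exact (Real.rpow_le_rpow_left_iff (by norm_num)).1 h3
  refine ⟨α, hα0, hα2, ?_⟩
  by_cases hα1 : α = 1
  -- For α = 1 the relation says that τ(e^x)/e^x - τ(1) is additive in x; continuity makes it
  -- linear, which is the t log t term.
  · have hadd : ∀ x y : ℝ, τ (Real.exp (x + y)) / Real.exp (x + y) - τ 1 =
        (τ (Real.exp x) / Real.exp x - τ 1) + (τ (Real.exp y) / Real.exp y - τ 1) := by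
      intro x y
      rw [Real.exp_add, hτt _ _ (Real.exp_pos _) (Real.exp_pos _), hα1, Real.rpow_one]
      have := (Real.exp_pos x).ne'
      have := (Real.exp_pos y).ne'
      field_simp
      ring
    let m : ℝ →+ ℝ := AddMonoidHom.mk' (fun x => τ (Real.exp x) / Real.exp x - τ 1) hadd
    have hmc : Continuous m := by
      have h1 : Continuous fun x => τ (Real.exp x) :=
        hτc.comp_continuous Real.continuous_exp fun x => Real.exp_pos x
      exact (h1.div Real.continuous_exp fun x => (Real.exp_pos x).ne').sub continuous_const
    have hm : ∀ x, m x = x * m 1 := fun x => by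
      simpa using (m.toRealLinearMap hmc).map_smul x 1
    refine ⟨χ 1, hpos 1 one_pos, Or.inr ⟨hα1, m 1, fun t ht => ?_⟩⟩
    have h1 : τ t / t - τ 1 = Real.log t * m 1 := by
      have : m (Real.log t) = τ t / t - τ 1 := by
        simp only [m, AddMonoidHom.mk'_apply, Real.exp_log ht]
      rw [← this, hm]
    have h2 : τ t = τ 1 * t + m 1 * (t * Real.log t) := by
      field_simp at h1
      linarith
    have h3 := hρt t ht
    rw [hα1, Real.rpow_one] at h3
    apply Complex.ext
    · simpa using h3
    · simpa using h2
  · have h2α : (2 : ℝ) ^ α - 2 ≠ 0 := by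
      intro h
      apply hα1
      have h' : (2 : ℝ) ^ α = 2 ^ (1 : ℝ) := by rw [Real.rpow_one]; linarith
      exact le_antisymm ((Real.rpow_le_rpow_left_iff one_lt_two).1 h'.le)
        ((Real.rpow_le_rpow_left_iff one_lt_two).1 h'.ge)
    obtain ⟨A, hA⟩ : ∃ A, A = (τ 2 - 2 * τ 1) / (2 ^ α - 2) := ⟨_, rfl⟩
    obtain ⟨B, hB⟩ : ∃ B, B = (-τ 2 + 2 ^ α * τ 1) / (2 ^ α - 2) := ⟨_, rfl⟩
    refine ⟨⟨ρ 1, A⟩, hpos 1 one_pos, Or.inl ⟨hα1, B, fun t ht => ?_⟩⟩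
    -- For α ≠ 1, expanding τ(2t) in two ways by exchanging the roles of t and 2 gives a linear
    -- equation for τ(t) with coefficient 2^α - 2 ≠ 0.
    have e1 := hτt t 2 ht two_pos
    have e2 := hτt 2 t two_pos ht
    rw [mul_comm t 2] at e2
    have e3 : τ t = A * t ^ α + B * t := by
      rw [hA, hB]
      field_simp
      linarith
    apply Complex.ext
    · simpa using hρt t ht
    · simpa using e3

end SelfSimilar

/-! ### Exponents of stable laws. -/

section Stable

variable {ψ : ℝ → ℂ}

/-- Uniqueness of continuous logarithms lifts stability from ω to ψ without a multiple of 2πi. -/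
lemma IsStableCharFun.exponent_sum (hψ : IsStableCharFun fun t => Complex.exp (-ψ t))
    (hc : Continuous ψ) (h0 : ψ 0 = 0) {a b : ℝ} (ha : 0 < a) (hb : 0 < b) :
    ∃ c d : ℝ, 0 < c ∧ ∀ t : ℝ, ψ (a * t) + ψ (b * t) = ψ (c * t) - Complex.I * d * t := by
  obtain ⟨c, d, hc0, h⟩ := hψ.2 a b ha hb
  refine ⟨c, d, hc0, fun t => ?_⟩
  have := eq_of_exp_eq (u := fun t => -(ψ (a * t) + ψ (b * t)))
    (v := fun t => -(ψ (c * t) - Complex.I * d * t)) (by fun_prop) (by fun_prop) (by simp [h0])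
    fun t => by
      have := h t
      rw [← Complex.exp_add, ← Complex.exp_add] at this
      convert this using 2
      · ring
      · push_cast; ring
  exact neg_injective (congrFun this t)

lemma IsStableCharFun.exponent_nat_mul (hψ : IsStableCharFun fun t => Complex.exp (-ψ t))
    (hc : Continuous ψ) (h0 : ψ 0 = 0) {k : ℕ} (hk : 1 ≤ k) :
    ∃ c d : ℝ, 0 < c ∧ ∀ t : ℝ, k * ψ t = ψ (c * t) - Complex.I * d * t := by
  induction k, hk using Nat.le_induction with
  | base => exact ⟨1, 0, one_pos, fun t => by simp⟩
  | succ k hk ih =>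
    obtain ⟨c, d, hc0, h⟩ := ih
    obtain ⟨c', d', hc0', h'⟩ := hψ.exponent_sum hc h0 hc0 one_pos
    refine ⟨c', d + d', hc0', fun t => ?_⟩
    have h1 := h t
    have h2 := h' t
    rw [one_mul] at h2
    push_cast
    rw [add_mul, one_mul, h1]
    linear_combination h2

/-- Infinite divisibility: e^{-ψ/k} is ω after a change of scale and drift, hence a ChF. -/
lemma IsStableCharFun.exponent_scale (hψ : IsStableCharFun fun t => Complex.exp (-ψ t))
    (hc : Continuous ψ) (h0 : ψ 0 = 0) {k : ℕ} (hk : 1 ≤ k) :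
    ∃ c e : ℝ, 0 < c ∧ ∀ t : ℝ, ψ t = k * ψ (c * t) - Complex.I * e * t := by
  obtain ⟨c, d, hc0, h⟩ := hψ.exponent_nat_mul hc h0 hk
  refine ⟨c⁻¹, -(d * c⁻¹), inv_pos.2 hc0, fun t => ?_⟩
  have := h (c⁻¹ * t)
  rw [mul_inv_cancel_left₀ hc0.ne'] at this
  rw [this]
  push_cast
  ring

lemma tendsto_mul_one_sub_exp (w : ℂ) :
    Tendsto (fun n : ℕ => (n : ℂ) * (1 - Complex.exp (-(w / n)))) atTop (𝓝 w) := by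
  have hder : HasDerivAt (fun x : ℂ => Complex.exp (-w * x)) (-w) 0 := by
    have := ((hasDerivAt_id (0 : ℂ)).const_mul (-w)).cexp
    simpa using this
  have hlimc : Tendsto (fun n : ℕ => (n : ℂ)⁻¹) atTop (𝓝[≠] 0) :=
    tendsto_nhdsWithin_iff.2 ⟨by
      have := (Complex.continuous_ofReal.tendsto 0).comp
        (tendsto_inv_atTop_nhds_zero_nat (𝕜 := ℝ))
      simpa [Function.comp_def] using this, by
      filter_upwards [eventually_ge_atTop 1] with n hn
      have : (n : ℂ) ≠ 0 := by exact_mod_cast (by omega : n ≠ 0)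
      simpa using this⟩
  have := ((hasDerivAt_iff_tendsto_slope_zero.1 hder).comp hlimc).neg
  rw [neg_neg] at this
  refine this.congr fun n => ?_
  simp only [Function.comp, zero_add, mul_zero, Complex.exp_zero, inv_inv, smul_eq_mul]
  rw [← mul_neg, neg_sub]
  congr 3
  ring

/-- ψ is the limit of n(1 - e^{-ψ/n}), and e^{-ψ/n} is a ChF by `exponent_scale`; the inequalities
survive the limit. -/
lemma IsStableCharFun.isCharExponent (hψ : IsStableCharFun fun t => Complex.exp (-ψ t))
    (hc : Continuous ψ) (h0 : ψ 0 = 0) : IsCharExponent ψ := by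
  refine IsCharExponent.of_tendsto (l := atTop)
    (z := fun (n : ℕ) t => ((n : ℝ) : ℂ) * (1 - Complex.exp (-(ψ t / n)))) ?_
    fun t => tendsto_mul_one_sub_exp (ψ t)
  filter_upwards [eventually_ge_atTop 1] with n hn
  obtain ⟨c, e, hc0, h⟩ := hψ.exponent_scale hc h0 hn
  have hn0 : (n : ℂ) ≠ 0 := by exact_mod_cast (by omega : n ≠ 0)
  have hcf : IsCharFun fun t => Complex.exp (-(ψ t / n)) := by
    convert hψ.1.affine c (e / n) using 2 with t
    rw [← Complex.exp_add]
    congr 1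
    rw [h t]
    push_cast
    field_simp
    ring
  exact hcf.isCharExponent (Nat.cast_nonneg n)

end Stable

/-! ### Positivity of the real part away from the origin. -/

section Positivity

variable {χ : ℝ → ℂ}

lemma IsCharExponent.re_eq_zero_of_add (hχ : IsCharExponent χ) {s t : ℝ} (hs : (χ s).re = 0)
    (ht : (χ t).re = 0) : (χ (s + t)).re = 0 := by
  have h := hχ.add_bound s t
  rw [hs, ht, Real.sqrt_zero, mul_zero, mul_zero, norm_le_zero_iff] at h
  have := congrArg Complex.re h
  simp only [Complex.sub_re, Complex.zero_re] at this
  linarith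

/-- The zero set of `Re χ` is a closed subgroup, so it is everything or avoids `(0, b)`. -/
lemma IsCharExponent.exists_pos_interval (hχ : IsCharExponent χ) (hc : Continuous χ)
    (hne : ∃ t, (χ t).re ≠ 0) : ∃ b : ℝ, 0 < b ∧ ∀ t, 0 < t → t < b → 0 < (χ t).re := by
  by_contra! hcon
  obtain ⟨t₀, ht₀⟩ := hne
  apply ht₀
  let S : AddSubgroup ℝ :=
    { carrier := {t | (χ t).re = 0}
      zero_mem' := by simp [hχ.map_zero]
      add_mem' := fun h1 h2 => hχ.re_eq_zero_of_add h1 h2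
      neg_mem' := fun {t} h => by
        simp only [Set.mem_ofPred_eq] at h ⊢
        rw [hχ.map_neg, Complex.conj_re, h] }
  have hdense : Dense (S : Set ℝ) := by
    refine S.dense_of_not_isolated_zero fun ε hε => ?_
    obtain ⟨t, h1, h2, h3⟩ := hcon ε hε
    exact ⟨t, le_antisymm h3 (hχ.re_nonneg t), h1, h2⟩
  have hcl : IsClosed (S : Set ℝ) :=
    isClosed_eq (Complex.continuous_re.comp hc) continuous_const
  have := hcl.closure_eq ▸ hdense.closure_eq
  have hmem : t₀ ∈ (S : Set ℝ) := this ▸ Set.mem_univ _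
  exact hmem

/-- Where the real part is positive on an initial interval. -/
def positivityRange (χ : ℝ → ℂ) : Set ℝ := {t | 0 < t ∧ ∀ s, 0 < s → s ≤ t → 0 < (χ s).re}

/-- At a first zero T of Re χ, the scaling relation, extended to T by continuity, gives Re χ(T) = s
Re χ(cT) > 0 because cT < T. The relation is needed only on the range itself, which is all that is
known for subsequential limits. -/
lemma positivityRange_eq (hc : Continuous χ) {b : ℝ} (hb : 0 < b)
    (hpos : ∀ t, 0 < t → t < b → 0 < (χ t).re) {c e s : ℝ} (hc0 : 0 < c) (hc1 : c < 1) (hs : 0 < s)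
    (h : ∀ u ∈ positivityRange χ, χ u = s * χ (c * u) - Complex.I * e * u) :
    positivityRange χ = Set.Ioi 0 := by
  refine Set.Subset.antisymm (fun t ht => ht.1) fun t₁ ht₁ => ?_
  by_contra hnot
  have hex : ∃ t, 0 < t ∧ (χ t).re ≤ 0 := by
    by_contra! hall
    exact hnot ⟨ht₁, fun s hs _ => hall s hs⟩
  let Z : Set ℝ := Set.Ici b ∩ {t | (χ t).re ≤ 0}
  have hZc : IsClosed Z := isClosed_Ici.inter
    (isClosed_le (Complex.continuous_re.comp hc) continuous_const)
  have hZn : Z.Nonempty := by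
    obtain ⟨t, ht, h⟩ := hex
    refine ⟨t, Set.mem_Ici.2 (not_lt.1 fun hlt => ?_), h⟩
    linarith [hpos t ht hlt]
  have hZb : BddBelow Z := ⟨b, fun t ht => ht.1⟩
  have hmem := hZc.csInf_mem hZn hZb
  set T := sInf Z
  have hbT : b ≤ T := hmem.1
  have hT0 : 0 < T := hb.trans_le hbT
  have hbelow : ∀ t, 0 < t → t < T → 0 < (χ t).re := by
    intro t ht htT
    by_contra! hle
    rcases lt_or_ge t b with h1 | h1
    · linarith [hpos t ht h1]
    · exact (notMem_of_lt_csInf htT hZb) ⟨h1, hle⟩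
  have hIoo : ∀ t ∈ Set.Ioo 0 T, (χ t).re = s * (χ (c * t)).re := by
    intro t ht
    have := congrArg Complex.re (h t ⟨ht.1, fun s hs hst => hbelow s hs (hst.trans_lt ht.2)⟩)
    simpa using this
  have hT : (χ T).re = s * (χ (c * T)).re := by
    have h1 : Set.EqOn (fun t => (χ t).re) (fun t => s * (χ (c * t)).re) (closure (Set.Ioo 0 T)) :=
      Set.EqOn.closure hIoo (by fun_prop) (by fun_prop)
    exact h1 (by rw [closure_Ioo hT0.ne]; exact ⟨hT0.le, le_rfl⟩)
  have h3 : (χ T).re ≤ 0 := hmem.2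
  have := hbelow (c * T) (by positivity) (by nlinarith)
  nlinarith [mul_pos hs this]

/-- A nondegenerate stable exponent has positive real part away from the origin. -/
lemma IsStableCharFun.re_pos (hψ : IsStableCharFun fun t => Complex.exp (-χ t))
    (hc : Continuous χ) (h0 : χ 0 = 0) (hne : ∃ t, (χ t).re ≠ 0) {t : ℝ} (ht : 0 < t) :
    0 < (χ t).re := by
  have hχ := hψ.isCharExponent hc h0
  obtain ⟨b, hb, hpos⟩ := hχ.exists_pos_interval hc hne
  obtain ⟨c, e, hc0, h⟩ := hψ.exponent_scale hc h0 (k := 2) (by norm_num)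
  have hre : ∀ v, (χ v).re = 2 * (χ (c * v)).re := fun v => by
    have := congrArg Complex.re (h v)
    simpa using this
  have h0' : Tendsto χ (𝓝[>] 0) (𝓝 0) := by
    have := hc.tendsto 0
    rw [h0] at this
    exact this.mono_left nhdsWithin_le_nhds
  -- c = 1 would give Re χ = 2 Re χ, and c > 1 would keep Re χ away from 0 along c^{-n} v, which
  -- tends to 0.
  have hc1 : c < 1 := by
    by_contra! hle
    have hp := hpos (b / 2) (by positivity) (by linarith)
    rcases hle.eq_or_lt with h1 | h1
    · have := hre (b / 2)
      rw [← h1, one_mul] at this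
      linarith
    · refine not_scale_of_tendsto_zero h0' (half_pos hb) hp (s := 2) (c := c⁻¹) (by norm_num)
        (by positivity) (inv_lt_one_of_one_lt₀ h1) fun v _ => ?_
      rw [hre (c⁻¹ * v), mul_inv_cancel_left₀ hc0.ne']
  have := positivityRange_eq hc hb hpos hc0 hc1 two_pos (e := e) fun u _ => by
    exact_mod_cast h u
  have hmem : t ∈ positivityRange χ := this ▸ ht
  exact hmem.2 t ht le_rfl

end Positivity


/-! ### Laplace integrals of powers and logarithms. -/

section HalfLaplace

/-- The Laplace integral of a function on the positive half-line. -/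
noncomputable def halfLaplace (f : ℝ → ℂ) (r : ℂ) : ℂ :=
  ∫ t in Set.Ioi (0 : ℝ), f t * Complex.exp (-(r * t))

/-- Continuous on the positive half-line with at most cubic growth. -/
structure IsCubic (f : ℝ → ℂ) : Prop where
  cont : ContinuousOn f (Set.Ioi 0)
  bound : ∃ C : ℝ, ∀ t : ℝ, 0 < t → ‖f t‖ ≤ C * (1 + t ^ 3)

lemma integrableOn_pow_mul_exp (n : ℕ) {b : ℝ} (hb : 0 < b) :
    IntegrableOn (fun t : ℝ => t ^ n * Real.exp (-(b * t))) (Set.Ioi 0) := by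
  have := integrableOn_rpow_mul_exp_neg_mul_rpow (p := 1) (s := n) (b := b)
    (by have : (0 : ℝ) ≤ n := Nat.cast_nonneg n
        linarith) one_pos hb
  simpa only [Real.rpow_one, Real.rpow_natCast, neg_mul] using this

lemma integrableOn_quartic_mul_exp (C : ℝ) {b : ℝ} (hb : 0 < b) :
    IntegrableOn (fun t : ℝ => C * (1 + t ^ 4) * Real.exp (-(b * t))) (Set.Ioi 0) := by
  have h := ((integrableOn_pow_mul_exp 0 hb).add (integrableOn_pow_mul_exp 4 hb)).const_mul C
  refine h.congr (Eventually.of_forall fun t => ?_)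
  simp only [Pi.add_apply, pow_zero]
  ring

lemma norm_exp_neg_mul (r : ℂ) (t : ℝ) :
    ‖Complex.exp (-(r * t))‖ = Real.exp (-(r.re * t)) := by
  rw [Complex.norm_exp]; simp

lemma quartic_aux {t : ℝ} (ht : 0 < t) : 1 + t ^ 3 ≤ 2 * (1 + t ^ 4) ∧
    t * (1 + t ^ 3) ≤ 2 * (1 + t ^ 4) := by
  constructor
  · nlinarith [sq_nonneg (t ^ 2 - t), sq_nonneg (t ^ 2 - 1), sq_nonneg t]
  · nlinarith [sq_nonneg (t ^ 2 - 1), sq_nonneg (t - 1), sq_nonneg (t + 1)]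

namespace IsCubic

variable {f g : ℝ → ℂ}

lemma exists_bound (hf : IsCubic f) : ∃ C : ℝ, 0 ≤ C ∧ ∀ t : ℝ, 0 < t →
    ‖f t‖ ≤ C * (1 + t ^ 4) ∧ ‖(t : ℂ) * f t‖ ≤ C * (1 + t ^ 4) := by
  obtain ⟨C, hC⟩ := hf.bound
  have hC0 : 0 ≤ C := by
    have := (norm_nonneg _).trans (hC 1 one_pos)
    linarith
  refine ⟨2 * C, by positivity, fun t ht => ?_⟩
  have h := hC t ht
  have h1 := quartic_aux ht
  constructor
  · nlinarith [mul_le_mul_of_nonneg_left h1.1 hC0]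
  · rw [norm_mul, Complex.norm_real, Real.norm_of_nonneg ht.le]
    nlinarith [mul_le_mul_of_nonneg_left h1.2 hC0, mul_le_mul_of_nonneg_left h ht.le]

lemma aestronglyMeasurable_mul (hf : IsCubic f) (r : ℂ) :
    AEStronglyMeasurable (fun t : ℝ => f t * Complex.exp (-(r * t)))
      (volume.restrict (Set.Ioi 0)) :=
  (hf.cont.mul (by fun_prop)).aestronglyMeasurable measurableSet_Ioi

lemma aestronglyMeasurable_mul' (hf : IsCubic f) (r : ℂ) :
    AEStronglyMeasurable (fun t : ℝ => (t : ℂ) * f t * Complex.exp (-(r * t)))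
      (volume.restrict (Set.Ioi 0)) := by
  refine ContinuousOn.aestronglyMeasurable ?_ measurableSet_Ioi
  exact ((by fun_prop : ContinuousOn (fun t : ℝ => (t : ℂ)) _).mul hf.cont).mul (by fun_prop)

lemma integrableOn (hf : IsCubic f) {r : ℂ} (hr : 0 < r.re) :
    IntegrableOn (fun t : ℝ => f t * Complex.exp (-(r * t))) (Set.Ioi 0) := by
  obtain ⟨C, _, hC⟩ := hf.exists_bound
  refine (integrableOn_quartic_mul_exp C hr).mono' (hf.aestronglyMeasurable_mul r) ?_
  refine (ae_restrict_iff' measurableSet_Ioi).2 (Eventually.of_forall fun t ht => ?_)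
  rw [norm_mul, norm_exp_neg_mul]
  exact mul_le_mul_of_nonneg_right (hC t ht).1 (Real.exp_pos _).le

lemma integrableOn' (hf : IsCubic f) {r : ℂ} (hr : 0 < r.re) :
    IntegrableOn (fun t : ℝ => (t : ℂ) * f t * Complex.exp (-(r * t))) (Set.Ioi 0) := by
  obtain ⟨C, _, hC⟩ := hf.exists_bound
  refine (integrableOn_quartic_mul_exp C hr).mono' (hf.aestronglyMeasurable_mul' r) ?_
  refine (ae_restrict_iff' measurableSet_Ioi).2 (Eventually.of_forall fun t ht => ?_)
  rw [norm_mul, norm_exp_neg_mul]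
  exact mul_le_mul_of_nonneg_right (hC t ht).2 (Real.exp_pos _).le

lemma differentiableOn_halfLaplace (hf : IsCubic f) :
    DifferentiableOn ℂ (halfLaplace f) {r : ℂ | 0 < r.re} := by
  intro r hr
  obtain ⟨C, hC0, hC⟩ := hf.exists_bound
  have hr' : 0 < r.re := hr
  have hs : {w : ℂ | r.re / 2 < w.re} ∈ 𝓝 r :=
    (isOpen_lt continuous_const Complex.continuous_re).mem_nhds (by
      simp only [Set.mem_ofPred_eq]; linarith)
  have := hasDerivAt_integral_of_dominated_loc_of_deriv_le (μ := volume.restrict (Set.Ioi (0 : ℝ)))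
    (F := fun w (t : ℝ) => f t * Complex.exp (-(w * t)))
    (F' := fun w (t : ℝ) => -((t : ℂ) * f t * Complex.exp (-(w * t))))
    (bound := fun t => C * (1 + t ^ 4) * Real.exp (-(r.re / 2 * t))) hs
    (Eventually.of_forall fun w => hf.aestronglyMeasurable_mul w) (hf.integrableOn hr')
    (hf.aestronglyMeasurable_mul' r).neg ?_ (integrableOn_quartic_mul_exp C (by positivity)) ?_
  · exact this.2.differentiableAt.differentiableWithinAt
  · refine (ae_restrict_iff' measurableSet_Ioi).2 (Eventually.of_forall fun t ht w hw => ?_)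
    rw [norm_neg, norm_mul, norm_exp_neg_mul]
    have ht' : 0 < t := ht
    have hw' : r.re / 2 < w.re := hw
    have h1 : Real.exp (-(w.re * t)) ≤ Real.exp (-(r.re / 2 * t)) := by
      rw [Real.exp_le_exp]; nlinarith
    exact mul_le_mul (hC t ht).2 h1 (Real.exp_pos _).le (by positivity)
  · refine Eventually.of_forall fun t w _ => ?_
    have h1 : HasDerivAt (fun w : ℂ => -(w * (t : ℂ))) (-(1 * (t : ℂ))) w :=
      ((hasDerivAt_id w).mul_const _).neg
    refine (h1.cexp.const_mul (f t)).congr_deriv ?_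
    ring

lemma of_pow_mul (hf : ContinuousOn f (Set.Ioi 0)) (h : ∀ t : ℝ, 0 < t → ‖f t‖ ≤ 1 + t ^ 3) :
    IsCubic f := ⟨hf, 1, fun t ht => by simpa using h t ht⟩

/-- A formula for the Laplace integral on the positive axis extends to the half-plane. -/
lemma halfLaplace_eq (hf : IsCubic f) {F : ℂ → ℂ} (hF : DifferentiableOn ℂ F {r : ℂ | 0 < r.re})
    (h : ∀ x : ℝ, 0 < x → halfLaplace f x = F x) {r : ℂ} (hr : 0 < r.re) :
    halfLaplace f r = F r := by
  have hpre : IsPreconnected {r : ℂ | 0 < r.re} :=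
    (convex_halfSpace_re_gt 0).isPreconnected
  refine (hf.differentiableOn_halfLaplace.analyticOnNhd
    isOpen_rightHalf).eqOn_of_preconnected_of_frequently_eq
    (hF.analyticOnNhd isOpen_rightHalf) hpre (z₀ := 1) (by simp) ?_ hr
  have hlim : Tendsto (fun n : ℕ => ((1 + 1 / ((n : ℝ) + 1) : ℝ) : ℂ)) atTop (𝓝[≠] 1) := by
    refine tendsto_nhdsWithin_iff.2 ⟨?_, Eventually.of_forall fun n => ?_⟩
    · have := (Complex.continuous_ofReal.tendsto _).comp
        (tendsto_one_div_add_atTop_nhds_zero_nat.const_add (1 : ℝ))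
      simpa [Function.comp_def] using this
    · have : (1 : ℝ) + 1 / ((n : ℝ) + 1) ≠ 1 := by
        have : (0 : ℝ) < 1 / ((n : ℝ) + 1) := by positivity
        linarith
      simp only [Set.mem_compl_iff, Set.mem_singleton_iff]
      exact_mod_cast this
  exact hlim.frequently (Frequently.of_forall fun n => h _ (by positivity))

end IsCubic

lemma isCubic_rpow {a : ℝ} (ha : 0 ≤ a) (ha3 : a ≤ 3) :
    IsCubic (fun t => ((t ^ a : ℝ) : ℂ)) := by
  refine IsCubic.of_pow_mul (fun t ht => ?_) fun t ht => ?_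
  · exact (Complex.continuous_ofReal.continuousAt.comp
      (Real.continuousAt_rpow_const t a (Or.inl (ne_of_gt ht)))).continuousWithinAt
  · rw [Complex.norm_real, Real.norm_of_nonneg (by positivity)]
    rcases le_total t 1 with h | h
    · have := Real.rpow_le_one ht.le h ha
      have : 0 ≤ t ^ 3 := by positivity
      linarith
    · have := Real.rpow_le_rpow_of_exponent_le h ha3
      rw [show (3 : ℝ) = (3 : ℕ) by norm_num, Real.rpow_natCast] at this
      linarith

/-- The Gamma integral on the positive axis, continued analytically to the half-plane. The explicit
right side has boundary values at ±i, where the integral no longer converges. -/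
lemma halfLaplace_rpow {a : ℝ} (ha : 0 ≤ a) (ha3 : a ≤ 3) {r : ℂ} (hr : 0 < r.re) :
    halfLaplace (fun t => ((t ^ a : ℝ) : ℂ)) r =
      (Real.Gamma (a + 1) : ℂ) * r ^ (-(a + 1) : ℂ) := by
  refine (isCubic_rpow ha ha3).halfLaplace_eq (F := fun r => (Real.Gamma (a + 1) : ℂ) *
    r ^ (-(a + 1) : ℂ)) (fun w hw => ?_) (fun x hx => ?_) hr
  · exact ((differentiableAt_id.cpow_const (Or.inl hw)).const_mul _).differentiableWithinAt
  · have h := Real.integral_rpow_mul_exp_neg_mul_Ioi (a := a + 1) (by linarith) hx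
    unfold halfLaplace
    have h1 : ∀ t : ℝ, ((t ^ a : ℝ) : ℂ) * Complex.exp (-((x : ℂ) * t)) =
        ((t ^ (a + 1 - 1) * Real.exp (-(x * t)) : ℝ) : ℂ) := fun t => by
      rw [add_sub_cancel_right]; push_cast; rfl
    simp_rw [h1]
    rw [integral_complex_ofReal, h]
    rw [one_div, Real.inv_rpow hx.le, ← Real.rpow_neg hx.le, mul_comm]
    push_cast [Complex.ofReal_cpow hx.le]
    rfl

lemma isCubic_pow_mul_log {m : ℕ} (hm : 1 ≤ m) (hm2 : m ≤ 2) :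
    IsCubic (fun t => ((t ^ m * Real.log t : ℝ) : ℂ)) := by
  refine IsCubic.of_pow_mul ?_ fun t ht => ?_
  · refine Complex.continuous_ofReal.comp_continuousOn ?_
    exact (by fun_prop : ContinuousOn (fun t : ℝ => t ^ m) _).mul
      (Real.continuousOn_log.mono fun t ht => ne_of_gt ht)
  · rw [Complex.norm_real, norm_mul, Real.norm_of_nonneg (by positivity), Real.norm_eq_abs]
    rcases le_total t 1 with h | h
    · have h1 := Real.abs_log_mul_self_lt t ht h
      have h2 : t ^ m ≤ t := by
        calc t ^ m ≤ t ^ 1 := pow_le_pow_of_le_one ht.le h hm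
          _ = t := pow_one t
      have h3 : t ^ m * |Real.log t| ≤ t * |Real.log t| := by gcongr
      rw [abs_mul, abs_of_pos ht] at h1
      have : 0 ≤ t ^ 3 := by positivity
      linarith
    · rw [abs_of_nonneg (Real.log_nonneg h)]
      have h1 := Real.log_le_self ht.le
      have h2 : t ^ m ≤ t ^ 2 := pow_le_pow_right₀ h hm2
      calc t ^ m * Real.log t ≤ t ^ 2 * t := by
            gcongr
            exact Real.log_nonneg h
        _ ≤ 1 + t ^ 3 := by nlinarith

/-- Substituting u = xt splits off log x. Of the constant γ only its being real matters: multiplied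
by iβ it drops out of the real part at ±i. -/
lemma halfLaplace_pow_mul_log {m : ℕ} (hm : 1 ≤ m) (hm2 : m ≤ 2) :
    ∃ γ : ℝ, ∀ r : ℂ, 0 < r.re → halfLaplace (fun t => ((t ^ m * Real.log t : ℝ) : ℂ)) r =
      (γ - (Real.Gamma (m + 1) : ℂ) * Complex.log r) * (r ^ (m + 1))⁻¹ := by
  refine ⟨∫ t in Set.Ioi (0 : ℝ), t ^ m * Real.log t * Real.exp (-t), fun r hr => ?_⟩
  set γ := ∫ t in Set.Ioi (0 : ℝ), t ^ m * Real.log t * Real.exp (-t) with hγ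
  refine (isCubic_pow_mul_log hm hm2).halfLaplace_eq
    (F := fun r => (γ - (Real.Gamma (m + 1) : ℂ) * Complex.log r) * (r ^ (m + 1))⁻¹)
    (fun w hw => ?_) (fun x hx => ?_) hr
  · have hw0 : w ≠ 0 := fun h => by simp [h] at hw
    refine DifferentiableAt.differentiableWithinAt ?_
    have h1 : DifferentiableAt ℂ Complex.log w := Complex.differentiableAt_log (Or.inl hw)
    exact ((differentiableAt_const _).sub (h1.const_mul _)).mul
      ((differentiableAt_id.pow _).inv (pow_ne_zero _ hw0))
  · unfold halfLaplace
    have h1 : ∀ t : ℝ, ((t ^ m * Real.log t : ℝ) : ℂ) * Complex.exp (-((x : ℂ) * t)) =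
        ((t ^ m * Real.log t * Real.exp (-(x * t)) : ℝ) : ℂ) := fun t => by push_cast; rfl
    simp_rw [h1]
    rw [integral_complex_ofReal]
    have h2 := integral_comp_mul_left_Ioi
      (fun u : ℝ => x⁻¹ ^ m * (u ^ m * Real.log u * Real.exp (-u) -
        Real.log x * (u ^ m * Real.exp (-u)))) 0 hx
    have h3 : ∫ t in Set.Ioi (0 : ℝ), t ^ m * Real.log t * Real.exp (-(x * t)) =
        ∫ t in Set.Ioi (0 : ℝ), x⁻¹ ^ m * ((x * t) ^ m * Real.log (x * t) * Real.exp (-(x * t)) -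
        Real.log x * ((x * t) ^ m * Real.exp (-(x * t)))) := by
      refine setIntegral_congr_fun measurableSet_Ioi fun t ht => ?_
      have ht0 : t ≠ 0 := ne_of_gt ht
      rw [Real.log_mul hx.ne' ht0, mul_pow, inv_pow]
      have : x ^ m ≠ 0 := pow_ne_zero _ hx.ne'
      field_simp
      ring
    have hi1 : IntegrableOn (fun u : ℝ => u ^ m * Real.log u * Real.exp (-u)) (Set.Ioi 0) := by
      have := ((isCubic_pow_mul_log hm hm2).integrableOn (r := 1) (by simp)).re
      refine this.congr (Eventually.of_forall fun t => ?_)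
      simp only [one_mul, RCLike.re_eq_complex_re]
      rw [← Complex.ofReal_neg, ← Complex.ofReal_exp, ← Complex.ofReal_mul, Complex.ofReal_re]
    have hi2 : IntegrableOn (fun u : ℝ => u ^ m * Real.exp (-u)) (Set.Ioi 0) := by
      simpa using integrableOn_pow_mul_exp m one_pos
    have hG : ∫ u in Set.Ioi (0 : ℝ), u ^ m * Real.exp (-u) = Real.Gamma (m + 1) := by
      have := Real.integral_rpow_mul_exp_neg_mul_Ioi (a := m + 1) (r := 1) (by positivity) one_pos
      simpa using this
    rw [h3, h2, mul_zero, integral_const_mul, integral_sub hi1 (hi2.const_mul _),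
      integral_const_mul, hG, ← hγ, smul_eq_mul, inv_pow, ← mul_assoc, ← mul_inv, ← pow_succ',
      Complex.ofReal_mul, Complex.ofReal_sub, Complex.ofReal_mul, Complex.ofReal_log hx.le]
    push_cast
    ring

end HalfLaplace

/-! ### A kernel whose Fourier transform has nonnegative real part. -/

section Kernel

/-- The real part of the Fourier transform of the kernel is a square. -/
lemma re_kernel_nonneg {r w : ℂ} (hw : w.re = r.re) (hr : 0 < r.re) :
    0 ≤ ((‖r‖ ^ 2 : ℝ) * (1 / w) - r.re * (r ^ 2 * (1 / w ^ 2)) : ℂ).re := by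
  have hw0 : w ≠ 0 := fun h => by simp [h] at hw; linarith
  have h1 : (1 / w).re = r.re / ‖w‖ ^ 2 := by
    rw [one_div, Complex.inv_re, hw, Complex.sq_norm]
  have h2 : r ^ 2 * (1 / w ^ 2) = (r / w) ^ 2 := by rw [div_pow]; ring
  have h3 : ((r / w) ^ 2).re ≤ ‖r‖ ^ 2 / ‖w‖ ^ 2 := by
    refine (Complex.re_le_norm _).trans_eq ?_
    rw [norm_pow, norm_div, div_pow]
  rw [h2, Complex.sub_re, Complex.re_ofReal_mul, Complex.re_ofReal_mul, h1]
  have : ‖r‖ ^ 2 * (r.re / ‖w‖ ^ 2) = r.re * (‖r‖ ^ 2 / ‖w‖ ^ 2) := by ring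
  rw [this]
  have := mul_le_mul_of_nonneg_left h3 hr.le
  linarith

/-- With w = r - ix this is the value at x = 0. So Re of the integral of (1 - g)k is minus the mean
of the nonnegative `re_kernel_nonneg`, with no constant left over. -/
lemma re_kernel_zero {r : ℂ} (hr : 0 < r.re) :
    ((‖r‖ ^ 2 : ℝ) * (1 / r) - r.re * (r ^ 2 * (1 / r ^ 2)) : ℂ).re = 0 := by
  have hr0 : r ≠ 0 := fun h => by simp [h] at hr
  have h2 : r ^ 2 * (1 / r ^ 2) = 1 := by field_simp
  have hn : ‖r‖ ^ 2 ≠ 0 := by positivity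
  rw [h2, Complex.sub_re, Complex.re_ofReal_mul, Complex.re_ofReal_mul, one_div, Complex.inv_re,
    ← Complex.sq_norm]
  simp; field_simp; ring

lemma halfLaplace_one {r : ℂ} (hr : 0 < r.re) : halfLaplace (fun _ => 1) r = 1 / r := by
  have := halfLaplace_rpow (a := 0) le_rfl (by norm_num) hr
  simpa [Complex.cpow_neg] using this

lemma halfLaplace_id {r : ℂ} (hr : 0 < r.re) : halfLaplace (fun t => (t : ℂ)) r = 1 / r ^ 2 := by
  have := halfLaplace_rpow (a := 1) zero_le_one (by norm_num) hr
  simp only [Real.rpow_one] at this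
  rw [this, Complex.cpow_neg]
  norm_num [Real.Gamma_two]

lemma isCubic_one : IsCubic (fun _ => 1) :=
  IsCubic.of_pow_mul continuousOn_const fun t ht => by
    have : 0 ≤ t ^ 3 := by positivity
    simpa using this

/-- A factor e^{itx} only replaces r by r - ix in the exponential, so the transform comes from the
Laplace integrals of 1 and t. -/
lemma integral_kernel {r : ℂ} (hr : 0 < r.re) (x : ℝ) :
    IntegrableOn (fun t : ℝ => Complex.exp (t * x * Complex.I) *
        (((‖r‖ ^ 2 : ℝ) - r.re * (r ^ 2 * t)) * Complex.exp (-(r * t)))) (Set.Ioi 0) ∧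
      ∫ t in Set.Ioi (0 : ℝ), Complex.exp (t * x * Complex.I) *
        (((‖r‖ ^ 2 : ℝ) - r.re * (r ^ 2 * t)) * Complex.exp (-(r * t))) =
      (‖r‖ ^ 2 : ℝ) * (1 / (r - x * Complex.I)) -
        r.re * (r ^ 2 * (1 / (r - x * Complex.I) ^ 2)) := by
  have hw : 0 < (r - x * Complex.I).re := by simpa using hr
  have h1 := isCubic_one.integrableOn hw
  have h2 := isCubic_one.integrableOn' hw
  have e : ∀ t : ℝ, Complex.exp (t * x * Complex.I) *
        (((‖r‖ ^ 2 : ℝ) - r.re * (r ^ 2 * t)) * Complex.exp (-(r * t))) =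
      ((‖r‖ ^ 2 : ℝ) : ℂ) * (1 * Complex.exp (-((r - x * Complex.I) * t))) -
        r.re * r ^ 2 * ((t : ℂ) * 1 * Complex.exp (-((r - x * Complex.I) * t))) := by
    intro t
    have : Complex.exp (-((r - x * Complex.I) * t)) =
        Complex.exp (t * x * Complex.I) * Complex.exp (-(r * t)) := by
      rw [← Complex.exp_add]; congr 1; ring
    rw [this]; ring
  simp_rw [e]
  refine ⟨(h1.const_mul _).sub (h2.const_mul _), ?_⟩
  rw [integral_sub (h1.const_mul _) (h2.const_mul _), integral_const_mul, integral_const_mul]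
  have e1 := halfLaplace_one hw
  have e2 := halfLaplace_id hw
  simp only [halfLaplace, one_mul] at e1 e2
  simp only [mul_one, one_mul]
  rw [integral_const_mul, e1, e2]
  ring

/-- The basic inequality for exponents of compound Poisson laws. -/
lemma IsCharFun.re_integral_kernel_nonpos {g : ℝ → ℂ} (hg : IsCharFun g) {r : ℂ} (hr : 0 < r.re) :
    (∫ t in Set.Ioi (0 : ℝ), (1 - g t) *
      (((‖r‖ ^ 2 : ℝ) - r.re * (r ^ 2 * t)) * Complex.exp (-(r * t)))).re ≤ 0 := by
  obtain ⟨ν, hν, rfl⟩ := hg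
  set k : ℝ → ℂ := fun t => (((‖r‖ ^ 2 : ℝ) - r.re * (r ^ 2 * t)) * Complex.exp (-(r * t))) with hk
  have hki : IntegrableOn k (Set.Ioi 0) := by
    have := (integral_kernel hr 0).1
    simp only [Complex.ofReal_zero, mul_zero, zero_mul, Complex.exp_zero, one_mul] at this
    exact this
  have hg : ∀ t : ℝ, (1 - charFun ν t) * k t =
      ∫ x : ℝ, (1 - Complex.exp (t * x * Complex.I)) * k t ∂ν := by
    intro t
    rw [integral_mul_const, integral_sub (integrable_const _) (integrable_char t),
      charFun_apply_real]
    simp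
  have hprod : Integrable (Function.uncurry fun t x : ℝ =>
      (1 - Complex.exp (t * x * Complex.I)) * k t) ((volume.restrict (Set.Ioi 0)).prod ν) := by
    have h1 : Integrable (fun p : ℝ × ℝ => k p.1) ((volume.restrict (Set.Ioi 0)).prod ν) :=
      Integrable.comp_fst hki ν
    refine (h1.norm.const_mul 2).mono' ?_ (Eventually.of_forall fun p => ?_)
    · refine AEStronglyMeasurable.mul (Continuous.aestronglyMeasurable ?_) h1.aestronglyMeasurable
      fun_prop
    · simp only [Function.uncurry]
      rw [norm_mul]
      gcongr
      refine (norm_sub_le _ _).trans ?_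
      rw [← Complex.ofReal_mul, Complex.norm_exp_ofReal_mul_I, norm_one]
      norm_num
  change (∫ t in Set.Ioi (0 : ℝ), (1 - charFun ν t) * k t).re ≤ 0
  simp_rw [hg]
  rw [integral_integral_swap hprod]
  have hin : ∀ x : ℝ, ∫ t in Set.Ioi (0 : ℝ), (1 - Complex.exp (t * x * Complex.I)) * k t =
      ((‖r‖ ^ 2 : ℝ) * (1 / r) - r.re * (r ^ 2 * (1 / r ^ 2))) -
      ((‖r‖ ^ 2 : ℝ) * (1 / (r - x * Complex.I)) -
        r.re * (r ^ 2 * (1 / (r - x * Complex.I) ^ 2))) := by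
    intro x
    have h0 := integral_kernel hr 0
    have h1 := integral_kernel hr x
    rw [← h1.2]
    simp only [Complex.ofReal_zero, mul_zero, zero_mul, Complex.exp_zero, one_mul, sub_zero] at h0
    rw [← h0.2, ← integral_sub h0.1 h1.1]
    refine integral_congr_ae (Eventually.of_forall fun t => ?_)
    simp only [hk]; ring
  have hint : Integrable (fun x : ℝ => ∫ t in Set.Ioi (0 : ℝ),
      (1 - Complex.exp (t * x * Complex.I)) * k t) ν := hprod.integral_prod_right
  have hre : ∫ x : ℝ, (∫ t in Set.Ioi (0 : ℝ), (1 - Complex.exp (t * x * Complex.I)) * k t).re ∂ν =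
      (∫ x : ℝ, (∫ t in Set.Ioi (0 : ℝ), (1 - Complex.exp (t * x * Complex.I)) * k t) ∂ν).re :=
    integral_re hint
  rw [← hre]
  refine integral_nonpos fun x => ?_
  simp only [Pi.zero_apply]
  rw [hin x, Complex.sub_re, re_kernel_zero hr, zero_sub]
  have := re_kernel_nonneg (r := r) (w := r - x * Complex.I) (by simp) hr
  linarith

end Kernel


/-! ### Parameter bounds and extension of exponents to the half-plane. -/

section ExponentLimit

/-- Pointwise limits, of quadratic growth, of multiples of `1 - G` with `G` a characteristic
function. -/
def IsCharExponentLimit (χ : ℝ → ℂ) : Prop :=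
  ∃ (c : ℕ → ℝ) (G : ℕ → ℝ → ℂ) (C : ℝ), (∀ n, 0 ≤ c n) ∧ (∀ n, IsCharFun (G n)) ∧
    (∀ᶠ n in atTop, ∀ t, ‖(c n : ℂ) * (1 - G n t)‖ ≤ C * (1 + t ^ 2)) ∧
    ∀ t, Tendsto (fun n => (c n : ℂ) * (1 - G n t)) atTop (𝓝 (χ t))

variable {χ : ℝ → ℂ}

lemma IsCharExponentLimit.isCubic (h : IsCharExponentLimit χ) (hc : Continuous χ) : IsCubic χ := by
  obtain ⟨c, G, C, hc0, hG, hb, hlim⟩ := h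
  refine ⟨hc.continuousOn, 2 * C, fun t ht => ?_⟩
  have h1 : ‖χ t‖ ≤ C * (1 + t ^ 2) := le_of_tendsto (hlim t).norm (hb.mono fun n hn => hn t)
  have hC : 0 ≤ C := by
    have h2 := (norm_nonneg _).trans h1
    by_contra! hneg
    nlinarith [sq_nonneg t]
  have h3 : 1 + t ^ 2 ≤ 2 * (1 + t ^ 3) := by
    nlinarith [sq_nonneg (t - 1), sq_nonneg (t + 1), mul_nonneg ht.le (sq_nonneg (t - 1)),
      sq_nonneg t]
  nlinarith [mul_le_mul_of_nonneg_left h3 hC]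

lemma IsCharExponentLimit.re_integral_kernel_nonpos (h : IsCharExponentLimit χ) {r : ℂ}
    (hr : 0 < r.re) : (∫ t in Set.Ioi (0 : ℝ), χ t *
      (((‖r‖ ^ 2 : ℝ) - r.re * (r ^ 2 * t)) * Complex.exp (-(r * t)))).re ≤ 0 := by
  obtain ⟨c, G, C, hc0, hG, hb, hlim⟩ := h
  set k : ℝ → ℂ := fun t => (((‖r‖ ^ 2 : ℝ) - r.re * (r ^ 2 * t)) * Complex.exp (-(r * t))) with hk
  have hC : IsCubic fun t : ℝ => ((C * (1 + t ^ 2) : ℝ) : ℂ) := by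
    refine ⟨by fun_prop, 2 * |C|, fun t ht => ?_⟩
    have h3 : 1 + t ^ 2 ≤ 2 * (1 + t ^ 3) := by
      nlinarith [sq_nonneg (t - 1), sq_nonneg (t + 1), mul_nonneg ht.le (sq_nonneg (t - 1)),
        sq_nonneg t]
    rw [Complex.norm_real, norm_mul, Real.norm_eq_abs, Real.norm_of_nonneg (by positivity)]
    nlinarith [mul_le_mul_of_nonneg_left h3 (abs_nonneg C)]
  have hdom : IntegrableOn (fun t : ℝ => C * (1 + t ^ 2) * ‖k t‖) (Set.Ioi 0) := by
    have h1 := ((hC.integrableOn hr).const_mul ((‖r‖ ^ 2 : ℝ) : ℂ)).sub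
      ((hC.integrableOn' hr).const_mul (r.re * r ^ 2))
    have h2 : IntegrableOn (fun t : ℝ => ((C * (1 + t ^ 2) : ℝ) : ℂ) * k t) (Set.Ioi 0) := by
      refine h1.congr (Eventually.of_forall fun t => ?_)
      simp only [hk, Pi.sub_apply]
      ring
    have h3 := h2.norm
    by_cases hC0 : 0 ≤ C
    · refine h3.congr (Eventually.of_forall fun t => ?_)
      simp only
      rw [norm_mul, Complex.norm_real, Real.norm_of_nonneg (by positivity)]
    · refine h3.neg.congr (Eventually.of_forall fun t => ?_)
      simp only [Pi.neg_apply]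
      have : C * (1 + t ^ 2) ≤ 0 :=
        mul_nonpos_of_nonpos_of_nonneg (not_le.1 hC0).le (by positivity)
      rw [norm_mul, Complex.norm_real, Real.norm_of_nonpos this]
      ring
  have hT : Tendsto (fun n => ∫ t in Set.Ioi (0 : ℝ), (c n : ℂ) * (1 - G n t) * k t) atTop
      (𝓝 (∫ t in Set.Ioi (0 : ℝ), χ t * k t)) := by
    refine tendsto_integral_filter_of_dominated_convergence _ ?_ ?_ hdom ?_
    · refine Eventually.of_forall fun n => ?_
      have := (hG n).continuous
      refine Continuous.aestronglyMeasurable ?_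
      fun_prop
    · refine hb.mono fun n hn => Eventually.of_forall fun t => ?_
      rw [norm_mul]
      exact mul_le_mul_of_nonneg_right (hn t) (norm_nonneg _)
    · exact Eventually.of_forall fun t => (hlim t).mul_const _
  refine le_of_tendsto ((Complex.continuous_re.tendsto _).comp hT) (Eventually.of_forall fun n => ?_)
  simp only [Function.comp, mul_assoc]
  rw [integral_const_mul, Complex.re_ofReal_mul]
  exact mul_nonpos_of_nonneg_of_nonpos (hc0 n) ((hG n).re_integral_kernel_nonpos hr)

/-- The inequality obtained by letting the kernel concentrate on a half-line. -/
lemma IsCharExponentLimit.re_boundary_nonpos (h : IsCharExponentLimit χ) (hc : Continuous χ)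
    {A B : ℂ → ℂ} {w : ℂ} (hw : w.re = 0) (hw0 : w ≠ 0) (hA : ContinuousAt A w)
    (hB : ContinuousAt B w) (hχA : ∀ r, 0 < r.re → halfLaplace χ r = A r)
    (hχB : ∀ r, 0 < r.re → halfLaplace (fun t => t * χ t) r = B r) : (A w).re ≤ 0 := by
  have hcub := h.isCubic hc
  have hineq : ∀ r : ℂ, 0 < r.re → ((‖r‖ ^ 2 : ℝ) * A r - r.re * (r ^ 2 * B r) : ℂ).re ≤ 0 := by
    intro r hr
    have h1 := h.re_integral_kernel_nonpos hr
    have e : ∀ t : ℝ, χ t * (((‖r‖ ^ 2 : ℝ) - r.re * (r ^ 2 * t)) * Complex.exp (-(r * t))) =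
        ((‖r‖ ^ 2 : ℝ) : ℂ) * (χ t * Complex.exp (-(r * t))) -
          r.re * r ^ 2 * (t * χ t * Complex.exp (-(r * t))) := fun t => by ring
    simp_rw [e] at h1
    rw [integral_sub ((hcub.integrableOn hr).const_mul _) ((hcub.integrableOn' hr).const_mul _),
      integral_const_mul, integral_const_mul] at h1
    have e1 := hχA r hr
    have e2 := hχB r hr
    simp only [halfLaplace] at e1 e2
    rw [e1, e2, mul_assoc] at h1
    exact h1
  set F : ℂ → ℂ := fun r => (‖r‖ ^ 2 : ℝ) * A r - r.re * (r ^ 2 * B r) with hF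
  have hFc : ContinuousAt F w := by
    refine ContinuousAt.sub (ContinuousAt.mul ?_ hA) (ContinuousAt.mul ?_
      (ContinuousAt.mul (by fun_prop) hB))
    · fun_prop
    · exact (Complex.continuous_ofReal.comp Complex.continuous_re).continuousAt
  have hseq : Tendsto (fun n : ℕ => w + ((1 / ((n : ℝ) + 1) : ℝ) : ℂ)) atTop (𝓝 w) := by
    have := (Complex.continuous_ofReal.tendsto _).comp
      (tendsto_one_div_add_atTop_nhds_zero_nat (𝕜 := ℝ))
    simpa [Function.comp_def] using this.const_add w
  have hlim := (Complex.continuous_re.tendsto _).comp (hFc.tendsto.comp hseq)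
  have h0 : (F w).re ≤ 0 := by
    refine le_of_tendsto hlim (Eventually.of_forall fun n => hineq _ ?_)
    rw [Complex.add_re, hw, Complex.ofReal_re, zero_add]
    positivity
  simp only [hF, hw, Complex.ofReal_zero, zero_mul, sub_zero, Complex.re_ofReal_mul] at h0
  have : 0 < ‖w‖ ^ 2 := by positivity
  nlinarith

lemma halfLaplace_congr {f g : ℝ → ℂ} (h : ∀ t, 0 < t → f t = g t) (r : ℂ) :
    halfLaplace f r = halfLaplace g r :=
  setIntegral_congr_fun measurableSet_Ioi fun t ht => by simp only [h t ht]

lemma IsCubic.halfLaplace_add {f g : ℝ → ℂ} (hf : IsCubic f) (hg : IsCubic g) (a b : ℂ) {r : ℂ}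
    (hr : 0 < r.re) : halfLaplace (fun t => a * f t + b * g t) r =
      a * halfLaplace f r + b * halfLaplace g r := by
  unfold halfLaplace
  rw [← integral_const_mul, ← integral_const_mul,
    ← integral_add ((hf.integrableOn hr).const_mul _) ((hg.integrableOn hr).const_mul _)]
  refine integral_congr_ae (Eventually.of_forall fun t => ?_)
  simp only
  ring

lemma re_mul_cpow {ζ t : ℂ} (hζ : ζ ≠ 0) (ht : t ≠ 0) (s : ℝ) :
    ∃ m : ℝ, 0 < m ∧ (ζ * t ^ (s : ℂ)).re = m * Real.cos (ζ.arg + s * t.arg) := by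
  refine ⟨‖ζ‖ * ‖t‖ ^ s, by positivity, ?_⟩
  have h1 : ζ * t ^ (s : ℂ) =
      ((‖ζ‖ * ‖t‖ ^ s : ℝ) : ℂ) * Complex.exp ((ζ.arg + s * t.arg : ℝ) * Complex.I) := by
    rw [Complex.cpow_def_of_ne_zero ht]
    nth_rewrite 1 [← Complex.norm_mul_exp_arg_mul_I ζ]
    have : (‖t‖ ^ s : ℝ) = Real.exp (Real.log ‖t‖ * s) := by
      rw [Real.rpow_def_of_pos (by positivity)]
    rw [this, Complex.log, mul_assoc, ← Complex.exp_add]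
    push_cast
    rw [mul_assoc, ← Complex.exp_add]
    congr 2
    ring
  rw [h1, Complex.re_ofReal_mul, Complex.exp_ofReal_mul_I_re]

/-- The boundary inequality at w = ±i. There w² = -1, so the drift contributes a purely imaginary
number and only the power term remains. -/
lemma IsCharExponentLimit.re_power_nonpos (h : IsCharExponentLimit χ) (hc : Continuous χ)
    {α : ℝ} (hα : 0 < α) (hα2 : α ≤ 2) {ζ : ℂ} {d : ℝ}
    (hform : ∀ t : ℝ, 0 < t → χ t = ζ * (t ^ α : ℝ) + Complex.I * d * t)
    {w : ℂ} (hw : w ^ 2 = -1) (hwre : w.re = 0) (hslit : w ∈ Complex.slitPlane) :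
    (ζ * w ^ ((-(α + 1) : ℝ) : ℂ)).re ≤ 0 := by
  have hw0 : w ≠ 0 := Complex.slitPlane_ne_zero hslit
  have hid : IsCubic fun t => (t : ℂ) := by
    simpa using isCubic_rpow (a := 1) zero_le_one (by norm_num)
  have key := h.re_boundary_nonpos hc (w := w)
    (A := fun r => ζ * ((Real.Gamma (α + 1) : ℂ) * r ^ (-(α + 1) : ℂ)) +
      Complex.I * d * (r ^ 2)⁻¹)
    (B := fun r => ζ * ((Real.Gamma (α + 1 + 1) : ℂ) * r ^ (-((α + 1 : ℝ) + 1) : ℂ)) +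
      Complex.I * d * ((Real.Gamma (2 + 1) : ℂ) * r ^ (-((2 : ℝ) + 1) : ℂ)))
    hwre hw0 ?_ ?_ ?_ ?_
  · rw [hw] at key
    have e : ζ * ((Real.Gamma (α + 1) : ℂ) * w ^ (-(α + 1) : ℂ)) + Complex.I * d * (-1)⁻¹ =
        (Real.Gamma (α + 1) : ℂ) * (ζ * w ^ ((-(α + 1) : ℝ) : ℂ)) - Complex.I * d := by
      push_cast
      ring
    rw [e, Complex.sub_re, Complex.re_ofReal_mul] at key
    have hG : 0 < Real.Gamma (α + 1) := Real.Gamma_pos_of_pos (by linarith)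
    have hd : (Complex.I * d).re = 0 := by simp
    rw [hd, sub_zero] at key
    by_contra! hpos
    linarith [mul_pos hG hpos]
  · exact (continuousAt_const.mul (continuousAt_const.mul
      (continuousAt_id.cpow continuousAt_const hslit))).add
      (continuousAt_const.mul ((continuousAt_id.pow 2).inv₀ (pow_ne_zero _ hw0)))
  · exact (continuousAt_const.mul (continuousAt_const.mul
      (continuousAt_id.cpow continuousAt_const hslit))).add
      (continuousAt_const.mul (continuousAt_const.mul
      (continuousAt_id.cpow continuousAt_const hslit)))
  · intro r hr
    rw [halfLaplace_congr hform, (isCubic_rpow hα.le (by linarith)).halfLaplace_add hid _ _ hr,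
      halfLaplace_rpow hα.le (by linarith) hr, halfLaplace_id hr, one_div]
  · intro r hr
    have e : ∀ t : ℝ, 0 < t → (t : ℂ) * χ t =
        ζ * ((t ^ (α + 1) : ℝ) : ℂ) + Complex.I * d * ((t ^ (2 : ℝ) : ℝ) : ℂ) := by
      intro t ht
      rw [hform t ht, Real.rpow_add_one ht.ne', Real.rpow_two]
      push_cast
      ring
    rw [halfLaplace_congr e, (isCubic_rpow (a := α + 1) (by linarith) (by linarith)).halfLaplace_add
      (isCubic_rpow (a := 2) (by norm_num) (by norm_num)) _ _ hr,
      halfLaplace_rpow (by linarith) (by linarith) hr,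
      halfLaplace_rpow (by norm_num) (by norm_num) hr]

/-- The inequalities at i and -i say that the cosines of arg ζ ∓ (α + 1)π/2 are nonpositive, which
confines |arg ζ| to min(α, 2 - α)π/2. This is the skewness bound, in the form that makes Re(ζ
t^{α-1}) ≥ 0 on the half-plane. -/
lemma IsCharExponentLimit.abs_arg_le (h : IsCharExponentLimit χ) (hc : Continuous χ)
    {α : ℝ} (hα : 0 < α) (hα2 : α ≤ 2) {ζ : ℂ} (hζ : 0 < ζ.re) {d : ℝ}
    (hform : ∀ t : ℝ, 0 < t → χ t = ζ * (t ^ α : ℝ) + Complex.I * d * t) :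
    |ζ.arg| + |α - 1| * (Real.pi / 2) ≤ Real.pi / 2 := by
  have hζ0 : ζ ≠ 0 := fun h => by simp [h] at hζ
  have hθ : |ζ.arg| < Real.pi / 2 := Complex.abs_arg_lt_pi_div_two_iff.2 (Or.inl hζ)
  have h1 := h.re_power_nonpos hc hα hα2 hform (w := Complex.I) Complex.I_sq Complex.I_re
    (by simp [Complex.mem_slitPlane_iff])
  have h2 := h.re_power_nonpos hc hα hα2 hform (w := -Complex.I) (by simp) (by simp)
    (by simp [Complex.mem_slitPlane_iff])
  obtain ⟨m, hm, e1⟩ := re_mul_cpow hζ0 Complex.I_ne_zero (-(α + 1))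
  obtain ⟨m', hm', e2⟩ := re_mul_cpow hζ0 (neg_ne_zero.2 Complex.I_ne_zero) (-(α + 1))
  rw [e1, Complex.arg_I] at h1
  rw [e2, Complex.arg_neg_I] at h2
  have c1 : Real.cos (ζ.arg + -(α + 1) * (Real.pi / 2)) ≤ 0 := by
    by_contra! hcon
    nlinarith [mul_pos hm hcon]
  have c2 : Real.cos (ζ.arg + -(α + 1) * (-(Real.pi / 2))) ≤ 0 := by
    by_contra! hcon
    nlinarith [mul_pos hm' hcon]
  have hpi := Real.pi_pos
  rw [abs_lt] at hθ
  set θ := ζ.arg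
  have b1 : θ ≤ α * (Real.pi / 2) := by
    by_contra! hcon
    exact absurd (Real.cos_pos_of_mem_Ioo (x := θ + -(α + 1) * (Real.pi / 2))
      ⟨by linarith, by nlinarith⟩) (not_lt.2 c1)
  have b2 : -(α * (Real.pi / 2)) ≤ θ := by
    by_contra! hcon
    exact absurd (Real.cos_pos_of_mem_Ioo (x := θ + -(α + 1) * (-(Real.pi / 2)))
      ⟨by nlinarith, by linarith⟩) (not_lt.2 c2)
  -- The bounds with α come from the arch of the cosine around 0, those with 2 - α from the arches
  -- around ±2π.
  have b3 : θ ≤ (2 - α) * (Real.pi / 2) := by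
    by_contra! hcon
    rw [← Real.cos_sub_two_pi] at c2
    exact absurd (Real.cos_pos_of_mem_Ioo
      (x := θ + -(α + 1) * (-(Real.pi / 2)) - 2 * Real.pi)
      ⟨by linarith, by nlinarith⟩) (not_lt.2 c2)
  have b4 : -((2 - α) * (Real.pi / 2)) ≤ θ := by
    by_contra! hcon
    rw [← Real.cos_add_two_pi] at c1
    exact absurd (Real.cos_pos_of_mem_Ioo
      (x := θ + -(α + 1) * (Real.pi / 2) + 2 * Real.pi)
      ⟨by nlinarith, by linarith⟩) (not_lt.2 c1)
  rcases abs_choice θ with h | h <;> rcases abs_choice (α - 1) with h' | h' <;> rw [h, h'] <;>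
    linarith

/-- Case α = 1 of the boundary inequality: at w² = -1 the real part of iβ log w is -β arg w. -/
lemma IsCharExponentLimit.re_log_nonpos (h : IsCharExponentLimit χ) (hc : Continuous χ)
    {ζ : ℂ} {β : ℝ}
    (hform : ∀ t : ℝ, 0 < t → χ t = ζ * t + Complex.I * β * (t * Real.log t : ℝ))
    {w : ℂ} (hw : w ^ 2 = -1) (hwre : w.re = 0) (hslit : w ∈ Complex.slitPlane) :
    -ζ.re - β * w.arg ≤ 0 := by
  have hw0 : w ≠ 0 := Complex.slitPlane_ne_zero hslit
  have hid : IsCubic fun t => (t : ℂ) := by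
    simpa using isCubic_rpow (a := 1) zero_le_one (by norm_num)
  obtain ⟨γ₁, h1⟩ := halfLaplace_pow_mul_log (m := 1) le_rfl one_le_two
  obtain ⟨γ₂, h2⟩ := halfLaplace_pow_mul_log (m := 2) one_le_two le_rfl
  have key := h.re_boundary_nonpos hc (w := w)
    (A := fun r => ζ * (r ^ 2)⁻¹ + Complex.I * β *
      ((γ₁ - (Real.Gamma ((1 : ℕ) + 1) : ℂ) * Complex.log r) * (r ^ (1 + 1))⁻¹))
    (B := fun r => ζ * ((Real.Gamma (2 + 1) : ℂ) * r ^ (-((2 : ℝ) + 1) : ℂ)) + Complex.I * β *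
      ((γ₂ - (Real.Gamma ((2 : ℕ) + 1) : ℂ) * Complex.log r) * (r ^ (2 + 1))⁻¹))
    hwre hw0 ?_ ?_ ?_ ?_
  · norm_num [hw, Real.Gamma_two, Complex.log_im] at key
    linarith
  · exact (continuousAt_const.mul ((continuousAt_id.pow 2).inv₀ (pow_ne_zero _ hw0))).add
      (continuousAt_const.mul ((continuousAt_const.sub (continuousAt_const.mul
        (continuousAt_clog hslit))).mul ((continuousAt_id.pow _).inv₀ (pow_ne_zero _ hw0))))
  · exact (continuousAt_const.mul (continuousAt_const.mul
      (continuousAt_id.cpow continuousAt_const hslit))).add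
      (continuousAt_const.mul ((continuousAt_const.sub (continuousAt_const.mul
        (continuousAt_clog hslit))).mul ((continuousAt_id.pow _).inv₀ (pow_ne_zero _ hw0))))
  · intro r hr
    have e : ∀ t : ℝ, 0 < t → χ t =
        ζ * (t : ℂ) + Complex.I * β * ((t ^ 1 * Real.log t : ℝ) : ℂ) := fun t ht => by
      rw [hform t ht, pow_one]
    rw [halfLaplace_congr e, hid.halfLaplace_add (isCubic_pow_mul_log le_rfl one_le_two) _ _ hr,
      halfLaplace_id hr, h1 r hr, one_div]
  · intro r hr
    have e : ∀ t : ℝ, 0 < t → (t : ℂ) * χ t =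
        ζ * ((t ^ (2 : ℝ) : ℝ) : ℂ) + Complex.I * β * ((t ^ 2 * Real.log t : ℝ) : ℂ) := by
      intro t ht
      rw [hform t ht, Real.rpow_two]
      push_cast
      ring
    rw [halfLaplace_congr e, (isCubic_rpow (a := 2) (by norm_num) (by norm_num)).halfLaplace_add
      (isCubic_pow_mul_log one_le_two le_rfl) _ _ hr,
      halfLaplace_rpow (by norm_num) (by norm_num) hr, h2 r hr]

lemma IsCharExponentLimit.abs_mul_pi_le (h : IsCharExponentLimit χ) (hc : Continuous χ)
    {ζ : ℂ} {β : ℝ}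
    (hform : ∀ t : ℝ, 0 < t → χ t = ζ * t + Complex.I * β * (t * Real.log t : ℝ)) :
    |β| * (Real.pi / 2) ≤ ζ.re := by
  have h1 := h.re_log_nonpos hc hform (w := Complex.I) Complex.I_sq Complex.I_re
    (by simp [Complex.mem_slitPlane_iff])
  have h2 := h.re_log_nonpos hc hform (w := -Complex.I) (by simp) (by simp)
    (by simp [Complex.mem_slitPlane_iff])
  rw [Complex.arg_I] at h1
  rw [Complex.arg_neg_I] at h2
  rcases abs_choice β with h | h <;> rw [h] <;> linarith

lemma mul_re_add_mul_im (t q : ℂ) :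
    t.re * (t * q).re + t.im * (t * q).im = (t.re ^ 2 + t.im ^ 2) * q.re := by
  simp only [Complex.mul_re, Complex.mul_im]
  ring

lemma mem_slitPlane_of_re_nonneg {t : ℂ} (ht : 0 ≤ t.re) (ht0 : t ≠ 0) :
    t ∈ Complex.slitPlane := by
  rw [Complex.mem_slitPlane_iff]
  by_cases h : t.im = 0
  · left
    exact lt_of_le_of_ne ht fun h' => ht0 (Complex.ext h'.symm h)
  · exact Or.inr h

/-- A sufficient condition in terms of the quotient `q t = P t / t`. -/
lemma isHalfPlaneExponent_of_quot {P q : ℂ → ℂ} (hP : ∀ t, P t = t * q t)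
    (hq : ∀ t ∈ Complex.slitPlane, DifferentiableAt ℂ q t)
    (hq0 : ∀ t : ℂ, 0 ≤ t.re → t ≠ 0 → 0 ≤ (q t).re) (hqpos : ∀ t : ℂ, 0 < t.re → 0 < (q t).re)
    (hd : ∀ t : ℂ, 0 < t.re → 0 < (deriv P t).re) : IsHalfPlaneExponent P := by
  have hPd : ∀ t ∈ Complex.slitPlane, DifferentiableAt ℂ P t := fun t ht => by
    rw [show P = fun t => t * q t from funext hP]
    exact differentiableAt_id.mul (hq t ht)
  constructor
  · exact fun t ht => (hPd t (Or.inl ht)).differentiableWithinAt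
  · exact fun t ht =>
      (hPd t (mem_slitPlane_of_re_nonneg ht.1 ht.2)).continuousAt.continuousWithinAt
  · intro t ht ht0
    rw [hP t, mul_re_add_mul_im]
    exact mul_nonneg (by positivity) (hq0 t ht ht0)
  · exact fun t ht => (hd t ht).le
  · intro t ht h
    have := hd t ht
    simp [h] at this
  · intro t ht h
    have h1 := hqpos t ht
    rw [hP t, mul_eq_zero] at h
    rcases h with h | h
    · simp [h] at ht
    · simp [h] at h1

lemma abs_arg_le_pi_div_two {t : ℂ} (ht : 0 ≤ t.re) : |t.arg| ≤ Real.pi / 2 :=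
  Complex.abs_arg_le_pi_div_two_iff.2 ht

lemma re_mul_cpow_nonneg {ζ : ℂ} (hζ0 : ζ ≠ 0) {s : ℝ}
    (h : |ζ.arg| + |s| * (Real.pi / 2) ≤ Real.pi / 2) {t : ℂ} (ht : 0 ≤ t.re) (ht0 : t ≠ 0) :
    0 ≤ (ζ * t ^ (s : ℂ)).re := by
  obtain ⟨m, hm, e⟩ := re_mul_cpow hζ0 ht0 s
  rw [e]
  refine mul_nonneg hm.le (Real.cos_nonneg_of_mem_Icc ?_)
  rw [Set.mem_Icc, ← abs_le]
  refine (abs_add_le _ _).trans (le_trans ?_ h)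
  rw [abs_mul]
  gcongr
  exact abs_arg_le_pi_div_two ht

lemma re_mul_cpow_pos {ζ : ℂ} (hζ0 : ζ ≠ 0) {s : ℝ} (hs : s ≠ 0)
    (h : |ζ.arg| + |s| * (Real.pi / 2) ≤ Real.pi / 2) {t : ℂ} (ht : 0 < t.re) :
    0 < (ζ * t ^ (s : ℂ)).re := by
  have ht0 : t ≠ 0 := fun h => by simp [h] at ht
  obtain ⟨m, hm, e⟩ := re_mul_cpow hζ0 ht0 s
  rw [e]
  refine mul_pos hm (Real.cos_pos_of_mem_Ioo ?_)
  rw [Set.mem_Ioo, ← abs_lt]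
  refine (abs_add_le _ _).trans_lt (lt_of_lt_of_le ?_ h)
  rw [abs_mul]
  have : |t.arg| < Real.pi / 2 := Complex.abs_arg_lt_pi_div_two_iff.2 (Or.inl ht)
  have := mul_lt_mul_of_pos_left this (abs_pos.2 hs)
  linarith

/-- A self-similar limit of exponents extends to a half-plane exponent. -/
theorem IsCharExponentLimit.exists_halfPlaneExponent (h : IsCharExponentLimit χ)
    (hχ : IsCharExponent χ) (hc : Continuous χ) (hpos : ∀ t, 0 < t → 0 < (χ t).re)
    (hss : IsSelfSimilar χ (Set.Ioi 0)) :
    ∃ P : ℂ → ℂ, IsHalfPlaneExponent P ∧ (∀ t : ℂ, 0 < t.re → 0 < (deriv P t).re) ∧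
      (∀ x : ℝ, 0 < x → 0 < (P x).re) ∧ ∀ x : ℝ, 0 < x → P x = χ x := by
  have h0 : Tendsto χ (𝓝[>] 0) (𝓝 0) := by
    have := hc.tendsto 0
    rw [hχ.map_zero] at this
    exact this.mono_left nhdsWithin_le_nhds
  obtain ⟨α, hα, hα2, ζ, hζ, hform⟩ := hss.form hc.continuousOn h0 hpos (by
    simpa using hχ.re_two_mul_le 1)
  suffices hP : ∃ P : ℂ → ℂ, IsHalfPlaneExponent P ∧ (∀ t : ℂ, 0 < t.re → 0 < (deriv P t).re) ∧
      ∀ x : ℝ, 0 < x → P x = χ x by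
    obtain ⟨P, h1, h2, h3⟩ := hP
    exact ⟨P, h1, h2, fun x hx => by rw [h3 x hx]; exact hpos x hx, h3⟩
  have hζ0 : ζ ≠ 0 := fun h => by simp [h] at hζ
  rcases hform with ⟨hα1, d, hform⟩ | ⟨rfl, β, hform⟩
  -- Up to an imaginary constant both P(t)/t and P'(t) are positive multiples of ζ t^{α-1}, so this
  -- one bound on arguments gives both positivity properties; α ≠ 1 makes them strict inside the
  -- half-plane.
  · have harg := h.abs_arg_le hc hα hα2 hζ hform
    have hα1' : α - 1 ≠ 0 := sub_ne_zero.2 hα1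
    have hexp : ((α - 1 : ℝ) : ℂ) = (α : ℂ) - 1 := by push_cast; ring
    have hder : ∀ t : ℂ, 0 < t.re →
        0 < (deriv (fun t : ℂ => ζ * t ^ (α : ℂ) + Complex.I * d * t) t).re := by
      intro t ht
      have h1 : HasDerivAt (fun t : ℂ => ζ * t ^ (α : ℂ) + Complex.I * d * t)
          (ζ * ((α : ℂ) * t ^ ((α : ℂ) - 1) * 1) + Complex.I * d * 1) t :=
        (((hasDerivAt_id t).cpow_const (c := (α : ℂ)) (Or.inl ht)).const_mul ζ).add
          ((hasDerivAt_id t).const_mul (Complex.I * d))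
      rw [h1.deriv, ← hexp]
      have h2 := re_mul_cpow_pos hζ0 hα1' harg ht
      have e : ζ * ((α : ℂ) * t ^ ((α - 1 : ℝ) : ℂ) * 1) + Complex.I * d * 1 =
          (α : ℂ) * (ζ * t ^ ((α - 1 : ℝ) : ℂ)) + Complex.I * d := by ring
      rw [e, Complex.add_re, Complex.re_ofReal_mul]
      simpa using mul_pos hα h2
    refine ⟨fun t => ζ * t ^ (α : ℂ) + Complex.I * d * t, isHalfPlaneExponent_of_quot
      (q := fun t => ζ * t ^ ((α - 1 : ℝ) : ℂ) + Complex.I * d) (fun t => ?_) (fun t ht => ?_)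
      (fun t ht ht0 => ?_) (fun t ht => ?_) hder, hder, fun x hx => ?_⟩
    · rcases eq_or_ne t 0 with rfl | ht0
      · have : (α : ℂ) ≠ 0 := by exact_mod_cast hα.ne'
        simp [Complex.zero_cpow this]
      · rw [hexp, Complex.cpow_sub _ _ ht0, Complex.cpow_one]
        field_simp
    · exact (((differentiableAt_id.cpow_const ht).const_mul ζ).add_const _)
    · simpa using re_mul_cpow_nonneg hζ0 harg ht ht0
    · simpa using re_mul_cpow_pos hζ0 hα1' harg ht
    · simp only
      rw [hform x hx, Complex.ofReal_cpow hx.le]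
  · have hβ := h.abs_mul_pi_le hc hform
    have hqpos : ∀ t : ℂ, 0 < t.re → 0 < ζ.re - β * t.arg := by
      intro t ht
      have h1 : |t.arg| < Real.pi / 2 := Complex.abs_arg_lt_pi_div_two_iff.2 (Or.inl ht)
      have h2 := le_abs_self (β * t.arg)
      rw [abs_mul] at h2
      rcases eq_or_ne β 0 with rfl | hβ0
      · simpa using hζ
      · have := mul_lt_mul_of_pos_left h1 (abs_pos.2 hβ0)
        linarith
    have hder : ∀ t : ℂ, 0 < t.re →
        0 < (deriv (fun t : ℂ => t * (ζ + Complex.I * β * Complex.log t)) t).re := by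
      intro t ht
      have ht0 : t ≠ 0 := fun h => by simp [h] at ht
      have h1 : HasDerivAt (fun t : ℂ => t * (ζ + Complex.I * β * Complex.log t))
          (1 * (ζ + Complex.I * β * Complex.log t) + t * (Complex.I * β * t⁻¹)) t :=
        (hasDerivAt_id t).mul
          (((Complex.hasDerivAt_log (Or.inl ht)).const_mul (Complex.I * β)).const_add ζ)
      rw [h1.deriv]
      have e : 1 * (ζ + Complex.I * β * Complex.log t) + t * (Complex.I * β * t⁻¹) =
          ζ + Complex.I * β * (Complex.log t + 1) := by field_simp; ring
      rw [e]
      have := hqpos t ht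
      simp [Complex.log_im]
      linarith
    refine ⟨fun t => t * (ζ + Complex.I * β * Complex.log t), isHalfPlaneExponent_of_quot
      (q := fun t => ζ + Complex.I * β * Complex.log t) (fun t => rfl) (fun t ht => ?_)
      (fun t ht ht0 => ?_) (fun t ht => ?_) hder, hder, fun x hx => ?_⟩
    · exact ((Complex.differentiableAt_log ht).const_mul _).const_add _
    · have h1 := abs_arg_le_pi_div_two ht
      have h2 := le_abs_self (β * t.arg)
      rw [abs_mul] at h2
      have := mul_le_mul_of_nonneg_left h1 (abs_nonneg β)
      simp [Complex.log_im]
      linarith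
    · have := hqpos t ht
      simp [Complex.log_im]
      linarith
    · simp only
      rw [hform x hx, Complex.ofReal_mul, Complex.ofReal_log hx.le]
      ring

end ExponentLimit


/-! ### Convergence of types and time changes of subsequential limits. -/

section Types

/-- Subsequential pointwise limits. -/
def IsSubLimit (z : ℕ → ℝ → ℂ) (χ : ℝ → ℂ) : Prop :=
  ∃ σ : ℕ → ℕ, Tendsto σ atTop atTop ∧ ∀ t, Tendsto (fun n => z (σ n) t) atTop (𝓝 (χ t))

/-- Convergence of types: scales relating two nondegenerate limits stay away from `0` and `∞`. -/
lemma exists_scale_subseq {ρ ρ' : ℕ → ℝ → ℝ} {R R' : ℝ → ℝ}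
    (hρ : ∀ (τ : ℕ → ℕ) (u : ℕ → ℝ) (t : ℝ), Tendsto τ atTop atTop → Tendsto u atTop (𝓝 t) →
      Tendsto (fun j => ρ (τ j) (u j)) atTop (𝓝 (R t)))
    (hρ' : ∀ (τ : ℕ → ℕ) (u : ℕ → ℝ) (t : ℝ), Tendsto τ atTop atTop → Tendsto u atTop (𝓝 t) →
      Tendsto (fun j => ρ' (τ j) (u j)) atTop (𝓝 (R' t)))
    (hR0 : R 0 = 0) (hR0' : R' 0 = 0) (hR : ∃ t, R t ≠ 0) (hR' : ∃ t, R' t ≠ 0)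
    {γ s : ℕ → ℝ} {s₀ : ℝ} (hγ : ∀ j, 0 < γ j) (hs : Tendsto s atTop (𝓝 s₀)) (hs0 : 0 < s₀)
    (hrel : ∀ j t, ρ' j t = s j * ρ j (γ j * t)) :
    ∃ (τ : ℕ → ℕ) (c : ℝ), StrictMono τ ∧ 0 < c ∧ Tendsto (fun j => γ (τ j)) atTop (𝓝 c) := by
  -- This compactifies (0, ∞) to [0, 1]. The limit κ = 1, where γ → ∞, would force R = 0, and κ = 0,
  -- where γ → 0, would force R' = 0.
  have hmem : ∀ j, γ j / (1 + γ j) ∈ Set.Icc (0 : ℝ) 1 := fun j => by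
    have := hγ j
    exact ⟨by positivity, (div_le_one (by positivity)).2 (by linarith)⟩
  obtain ⟨κ, hκ, τ, hτ, hlim⟩ := isCompact_Icc.tendsto_subseq hmem
  have hγx : ∀ j, γ j = (γ j / (1 + γ j)) / (1 - γ j / (1 + γ j)) := fun j => by
    have := hγ j
    have h1 : 1 + γ j ≠ 0 := by positivity
    field_simp
    ring_nf
  have hγx' : ∀ j, (γ j)⁻¹ = (1 - γ j / (1 + γ j)) / (γ j / (1 + γ j)) := fun j => by
    have h := hγx j
    nth_rewrite 1 [h]
    rw [inv_div]
  simp only [Function.comp_def] at hlim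
  rcases eq_or_ne κ 1 with rfl | hκ1
  · exfalso
    have h0 : Tendsto (fun j => (γ (τ j))⁻¹) atTop (𝓝 0) := by
      have := (hlim.const_sub 1).div hlim one_ne_zero
      simp only [sub_self, zero_div] at this
      exact this.congr fun j => (hγx' _).symm
    obtain ⟨t, ht⟩ := hR
    apply ht
    have h1 := hρ' τ (fun j => (γ (τ j))⁻¹ * t) 0 hτ.tendsto_atTop (by simpa using h0.mul_const t)
    have h2 := hρ τ (fun _ => t) t hτ.tendsto_atTop tendsto_const_nhds
    have h3 : Tendsto (fun j => s (τ j) * ρ (τ j) t) atTop (𝓝 (s₀ * R t)) :=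
      (hs.comp hτ.tendsto_atTop).mul h2
    have h4 : s₀ * R t = R' 0 := by
      refine tendsto_nhds_unique (h3.congr fun j => ?_) h1
      rw [hrel, mul_inv_cancel_left₀ (hγ _).ne']
    rw [hR0', mul_eq_zero] at h4
    exact h4.resolve_left hs0.ne'
  · have h0 : Tendsto (fun j => γ (τ j)) atTop (𝓝 (κ / (1 - κ))) := by
      have := hlim.div (hlim.const_sub 1) (sub_ne_zero.2 hκ1.symm)
      exact this.congr fun j => (hγx _).symm
    rcases eq_or_ne κ 0 with rfl | hκ0
    · exfalso
      rw [zero_div] at h0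
      obtain ⟨t, ht⟩ := hR'
      apply ht
      have h1 := hρ τ (fun j => γ (τ j) * t) 0 hτ.tendsto_atTop (by simpa using h0.mul_const t)
      have h2 := hρ' τ (fun _ => t) t hτ.tendsto_atTop tendsto_const_nhds
      have h3 := (hs.comp hτ.tendsto_atTop).mul h1
      rw [hR0, mul_zero] at h3
      exact tendsto_nhds_unique (h2.congr fun j => hrel _ _) h3
    · refine ⟨τ, κ / (1 - κ), hτ, ?_, h0⟩
      have h1 := lt_of_le_of_ne hκ.1 hκ0.symm
      have h2 := lt_of_le_of_ne hκ.2 hκ1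
      exact div_pos h1 (by linarith)

variable {g : ℝ → ℂ} {a b : ℕ → ℝ}

lemma one_sub_norm_sq (w : ℂ) : 1 - ‖w‖ ^ 2 = 2 * (1 - w).re - ‖1 - w‖ ^ 2 := by
  rw [Complex.sq_norm, Complex.sq_norm, Complex.normSq_apply, Complex.normSq_apply]
  simp only [Complex.sub_re, Complex.sub_im, Complex.one_re, Complex.one_im]
  ring

/-- The squared modulus does not see the centring, and n(1 - |w|²) has the limit 2 Re ζ because |1 -
w|² is of order n^{-2}. Scales can thus be compared before the drifts are known to converge. -/
lemma tendsto_mul_one_sub_norm_sq {n : ℕ → ℕ} (hn : Tendsto n atTop atTop) {w : ℕ → ℂ} {ζ : ℂ}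
    (h : Tendsto (fun j => (n j : ℂ) * (1 - w j)) atTop (𝓝 ζ)) :
    Tendsto (fun j => (n j : ℝ) * (1 - ‖w j‖ ^ 2)) atTop (𝓝 (2 * ζ.re)) := by
  have h1 := ((Complex.continuous_re.tendsto _).comp h).const_mul 2
  have h2 : Tendsto (fun j => ‖(n j : ℂ) * (1 - w j)‖ ^ 2 / (n j : ℝ)) atTop (𝓝 0) :=
    (h.norm.pow 2).div_atTop (tendsto_natCast_atTop_atTop.comp hn)
  have h3 := h1.sub h2
  rw [sub_zero] at h3
  refine h3.congr' ?_
  filter_upwards [hn.eventually_ge_atTop 1] with j hj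
  have hj0 : (n j : ℝ) ≠ 0 := by
    have : n j ≠ 0 := by omega
    exact_mod_cast this
  rw [one_sub_norm_sq, norm_mul, Complex.norm_natCast]
  simp only [Function.comp]
  rw [← Complex.ofReal_natCast, Complex.re_ofReal_mul]
  field_simp

lemma normalizedCharFun_change {n m : ℕ} (hn : 0 < a n) (t : ℝ) :
    normalizedCharFun g (a m) (b m) t = normalizedCharFun g (a n) (b n) (a n / a m * t) *
      Complex.exp (-(Complex.I * (t * (b m - a n / a m * b n) : ℝ))) := by
  unfold normalizedCharFun
  have h1 : a n / a m * t / a n = t / a m := by field_simp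
  rw [h1, mul_assoc, ← Complex.exp_add]
  congr 2
  push_cast
  ring

lemma norm_normalizedCharFun (a b t : ℝ) : ‖normalizedCharFun g a b t‖ = ‖g (t / a)‖ := by
  unfold normalizedCharFun
  rw [norm_mul, Complex.norm_exp]
  simp

lemma isCharFun_exp_neg (β : ℝ) :
    IsCharFun fun t => Complex.exp (-(Complex.I * (t * β : ℝ))) := by
  convert isCharFun_one.affine 1 (-β) using 2 with t
  rw [one_mul]
  congr 1
  push_cast
  ring

/-- Limits along index sequences of asymptotically proportional size are related by a change
of scale and drift. -/
lemma exists_scale_of_limits (ha : ∀ n, 0 < a n)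
    (hz : TightExponents (rowExponent g a b)) {n m : ℕ → ℕ} (hn : Tendsto n atTop atTop)
    (hm : Tendsto m atTop atTop) {s : ℝ} (hs : 0 < s)
    (hmn : Tendsto (fun j => (m j : ℝ) / n j) atTop (𝓝 s)) {χ χ' : ℝ → ℂ}
    (hχ : ∀ t, Tendsto (fun j => rowExponent g a b (n j) t) atTop (𝓝 (χ t)))
    (hχ' : ∀ t, Tendsto (fun j => rowExponent g a b (m j) t) atTop (𝓝 (χ' t)))
    (hne : ∃ t, (χ t).re ≠ 0) (hne' : ∃ t, (χ' t).re ≠ 0) :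
    ∃ c D : ℝ, 0 < c ∧ ∀ t, χ' t = s * χ (c * t) + Complex.I * D * t := by
  have hzn := hz.comp hn
  have hzm := hz.comp hm
  have hE := hzn.isCharExponent_limit hχ
  have hE' := hzm.isCharExponent_limit hχ'
  have hconv : ∀ {n : ℕ → ℕ} {χ : ℝ → ℂ}, Tendsto n atTop atTop →
      (∀ t, Tendsto (fun j => rowExponent g a b (n j) t) atTop (𝓝 (χ t))) →
      ∀ (τ : ℕ → ℕ) (u : ℕ → ℝ) (t : ℝ), Tendsto τ atTop atTop → Tendsto u atTop (𝓝 t) →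
      Tendsto (fun j => (n (τ j) : ℝ) *
        (1 - ‖normalizedCharFun g (a (n (τ j))) (b (n (τ j))) (u j)‖ ^ 2)) atTop
        (𝓝 (2 * (χ t).re)) := by
    intro n χ hn hχ τ u t hτ hu
    refine tendsto_mul_one_sub_norm_sq (hn.comp hτ) ?_
    exact (hz.comp (hn.comp hτ)).tendsto_moving (fun t => (hχ t).comp hτ) hu
  -- discard the finitely many indices with `n j = 0`
  obtain ⟨J, hJ⟩ := eventually_atTop.1 (hn.eventually_ge_atTop 1)
  set n₁ : ℕ → ℕ := fun j => n (j + J) with hn₁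
  set m₁ : ℕ → ℕ := fun j => m (j + J) with hm₁
  have hsh : Tendsto (fun j : ℕ => j + J) atTop atTop := tendsto_add_atTop_nat J
  obtain ⟨τ, c, hτ, hc, hγ⟩ := exists_scale_subseq
    (ρ := fun j t => (n₁ j : ℝ) * (1 - ‖normalizedCharFun g (a (n₁ j)) (b (n₁ j)) t‖ ^ 2))
    (ρ' := fun j t => (m₁ j : ℝ) * (1 - ‖normalizedCharFun g (a (m₁ j)) (b (m₁ j)) t‖ ^ 2))
    (hconv (hn.comp hsh) fun t => (hχ t).comp hsh) (hconv (hm.comp hsh) fun t => (hχ' t).comp hsh)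
    (by simp [hE.map_zero]) (by simp [hE'.map_zero])
    (by simpa using hne) (by simpa using hne')
    (γ := fun j => a (n₁ j) / a (m₁ j)) (s := fun j => (m₁ j : ℝ) / n₁ j)
    (fun j => div_pos (ha _) (ha _)) (hmn.comp hsh) hs fun j t => by
      have h1 : (n₁ j : ℝ) ≠ 0 := by
        have : 1 ≤ n₁ j := hJ _ (by omega)
        have : n₁ j ≠ 0 := by omega
        exact_mod_cast this
      have h2 := (ha (n₁ j)).ne'
      simp only [norm_normalizedCharFun]
      have h3 : a (n₁ j) / a (m₁ j) * t / a (n₁ j) = t / a (m₁ j) := by field_simp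
      rw [h3]
      field_simp
  have hτ' : Tendsto (fun j => τ j + J) atTop atTop := hsh.comp hτ.tendsto_atTop
  set N : ℕ → ℕ := fun j => n (τ j + J) with hN
  set M : ℕ → ℕ := fun j => m (τ j + J) with hM
  have hNt : Tendsto N atTop atTop := hn.comp hτ'
  have hMt : Tendsto M atTop atTop := hm.comp hτ'
  set β : ℕ → ℝ := fun j => b (M j) - a (N j) / a (M j) * b (N j) with hβ
  have hMN : Tendsto (fun j => ((M j : ℝ) / N j : ℝ)) atTop (𝓝 s) := hmn.comp hτ'
  -- the rescaled exponents
  have h1 : ∀ t, Tendsto (fun j => rowExponent g a b (N j) (a (N j) / a (M j) * t)) atTop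
      (𝓝 (χ (c * t))) := fun t =>
    (hz.comp hNt).tendsto_moving (fun t => (hχ t).comp hτ') (hγ.mul_const t)
  have h2 : ∀ t, Tendsto (fun j => (M j : ℂ) *
      (1 - normalizedCharFun g (a (N j)) (b (N j)) (a (N j) / a (M j) * t))) atTop
      (𝓝 (s * χ (c * t))) := by
    intro t
    have := ((Complex.continuous_ofReal.tendsto _).comp hMN).mul (h1 t)
    refine this.congr fun j => ?_
    have hN0 : (N j : ℂ) ≠ 0 := by
      have : 1 ≤ N j := hJ _ (by omega)
      have : N j ≠ 0 := by omega
      exact_mod_cast this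
    simp only [Function.comp, rowExponent]
    push_cast
    field_simp
  have hG1 : ∀ t, Tendsto (fun j => normalizedCharFun g (a (N j)) (b (N j)) (a (N j) / a (M j) * t))
      atTop (𝓝 1) := by
    intro t
    have h0 : Tendsto (fun j => ‖rowExponent g a b (N j) (a (N j) / a (M j) * t)‖ / (N j : ℝ)) atTop
        (𝓝 0) := (h1 t).norm.div_atTop (tendsto_natCast_atTop_atTop.comp hNt)
    rw [tendsto_iff_norm_sub_tendsto_zero]
    refine h0.congr fun j => ?_
    rw [norm_sub_rev, norm_one_sub_normalizedCharFun (hJ _ (by omega))]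
  -- Since g_M(t) = G e^{-itβ} with G → 1, subtracting M(1 - G) and dividing by G isolates the
  -- exponent of a pure translation, whose convergence follows although nothing is known about β.
  have h3 : ∀ t, Tendsto (fun j => (M j : ℂ) * (1 - Complex.exp (-(Complex.I * (t * β j : ℝ)))))
      atTop (𝓝 (χ' t - s * χ (c * t))) := by
    intro t
    have hχt : Tendsto (fun j => rowExponent g a b (M j) t) atTop (𝓝 (χ' t)) := (hχ' t).comp hτ'
    have := (hχt.sub (h2 t)).div (hG1 t) one_ne_zero
    rw [div_one] at this
    refine this.congr' ?_
    filter_upwards [(hG1 t).eventually_ne one_ne_zero] with j hj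
    simp only [rowExponent, Pi.div_apply]
    rw [div_eq_iff hj, normalizedCharFun_change (n := N j) (m := M j) (ha _)]
    ring
  have hEc : IsCharExponent fun t => χ' t - s * χ (c * t) :=
    IsCharExponent.of_tendsto (Eventually.of_forall fun j => by
      have := (isCharFun_exp_neg (β j)).isCharExponent (Nat.cast_nonneg (α := ℝ) (M j))
      simp only [Complex.ofReal_natCast] at this
      exact this) h3
  -- The translation factor has modulus one, so the real part of its limiting exponent vanishes, and
  -- the exponent is linear.
  have hre : ∀ t, (χ' t - s * χ (c * t)).re = 0 := by
    intro t
    have h4 := tendsto_mul_one_sub_norm_sq hMt (h3 t)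
    have h5 : ∀ j, ‖Complex.exp (-(Complex.I * (t * β j : ℝ)))‖ = 1 := fun j => by
      rw [Complex.norm_exp]; simp
    simp only [h5, one_pow, sub_self, mul_zero] at h4
    have := tendsto_nhds_unique h4 tendsto_const_nhds
    linarith
  obtain ⟨D, hD⟩ := hEc.linear_of_re_eq_zero
    ((hzm.continuous_limit hχ').sub (continuous_const.mul
      ((hzn.continuous_limit hχ).comp (continuous_const.mul continuous_id)))) hre
  exact ⟨c, D, hc, fun t => by rw [← hD t]; ring⟩

/-- The set of subsequential limits is stable under all time changes. -/
lemma exists_isSubLimit_scale (ha : ∀ n, 0 < a n)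
    (hz : TightExponents (rowExponent g a b))
    (hnd : ∀ χ, IsSubLimit (rowExponent g a b) χ → ∃ t, (χ t).re ≠ 0) {χ : ℝ → ℂ}
    (hχ : IsSubLimit (rowExponent g a b) χ) {s : ℝ} (hs : 0 < s) :
    ∃ c D : ℝ, 0 < c ∧
      IsSubLimit (rowExponent g a b) (fun t => s * χ (c * t) + Complex.I * D * t) := by
  have hχ0 := hχ
  obtain ⟨n, hn, hlim⟩ := hχ
  -- Taking ⌊sn⌋ summands in place of n multiplies the exponent by s; the change of norming
  -- constants shows up as the scale c and the drift D.
  set m : ℕ → ℕ := fun j => ⌊s * n j⌋₊ with hm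
  have hm1 : Tendsto m atTop atTop := tendsto_nat_floor_atTop.comp
    ((tendsto_natCast_atTop_atTop.comp hn).const_mul_atTop hs)
  obtain ⟨τ, χ', hτ, hχ'⟩ := (hz.comp hm1).exists_subseq
  have hsub : IsSubLimit (rowExponent g a b) χ' := ⟨_, hm1.comp hτ.tendsto_atTop, hχ'⟩
  have hmn : Tendsto (fun j => (m (τ j) : ℝ) / n (τ j)) atTop (𝓝 s) :=
    (tendsto_nat_floor_mul_div_atTop hs.le).comp
      ((tendsto_natCast_atTop_atTop (R := ℝ)).comp (hn.comp hτ.tendsto_atTop))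
  obtain ⟨c, D, hc, h⟩ := exists_scale_of_limits ha hz (hn.comp hτ.tendsto_atTop)
    (hm1.comp hτ.tendsto_atTop) hs hmn (fun t => (hlim t).comp hτ.tendsto_atTop) hχ'
    (hnd χ hχ0) (hnd χ' hsub)
  refine ⟨c, D, hc, ?_⟩
  rwa [← show χ' = fun t => s * χ (c * t) + Complex.I * D * t from funext h]

end Types


/-! ### Rigidity of lifts through the Laplace transform. -/

section Rigidity

variable {μ : Measure ℝ} [IsProbabilityMeasure μ]

lemma analyticAt_laplace (hμ : μ (Set.Iio 0) = 0) {z : ℂ} (hz : 0 < z.re) :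
    AnalyticAt ℂ (laplaceTransform μ) z :=
  (differentiableOn_laplace hμ).analyticAt (isOpen_rightHalf.mem_nhds hz)

/-- Critical points of the Laplace transform are isolated. -/
lemma eventually_deriv_laplace_ne_zero (hμ : μ (Set.Iio 0) = 0) (hμ0 : μ ≠ Measure.dirac 0)
    {z : ℂ} (hz : 0 < z.re) : ∀ᶠ w in 𝓝[≠] z, deriv (laplaceTransform μ) w ≠ 0 := by
  rcases (analyticAt_laplace hμ hz).deriv.eventually_eq_zero_or_eventually_ne_zero with h | h
  · exfalso
    obtain ⟨ε, hε, hb⟩ := Metric.eventually_nhds_iff_ball.1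
      (h.and (isOpen_rightHalf.mem_nhds hz))
    refine laplace_not_eventually_const hμ hμ0 hz (laplaceTransform μ z) ?_
    filter_upwards [Metric.ball_mem_nhds z hε] with w hw
    refine (Metric.isOpen_ball (x := z) (ε := ε)).is_const_of_deriv_eq_zero
      (convex_ball z ε).isPreconnected (fun u hu => ?_) (fun u hu => (hb u hu).1) hw
      (Metric.mem_ball_self hε)
    exact (analyticAt_laplace hμ (hb u hu).2).differentiableAt.differentiableWithinAt
  · exact h

/-- The Laplace transform is injective near a noncritical point. -/
lemma exists_injOn_laplace (hμ : μ (Set.Iio 0) = 0) {z : ℂ} (hz : 0 < z.re)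
    (hd : deriv (laplaceTransform μ) z ≠ 0) :
    ∃ U ∈ 𝓝 z, Set.InjOn (laplaceTransform μ) U := by
  have hs : HasStrictDerivAt (laplaceTransform μ) (deriv (laplaceTransform μ) z) z :=
    (analyticAt_laplace hμ hz).hasStrictDerivAt
  have := (hs.hasStrictFDerivAt_equiv hd).eventually_left_inverse
  exact ⟨_, this, fun x hx y hy hxy => by
    have h1 : _ = x := hx
    have h2 : _ = y := hy
    rw [← h1, ← h2, hxy]⟩

/-- Along a half-plane exponent the Laplace transform is nowhere locally constant. -/
lemma IsHalfPlaneExponent.eventually_laplace_ne (hμ : μ (Set.Iio 0) = 0)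
    (hμ0 : μ ≠ Measure.dirac 0) {P : ℂ → ℂ} (hP : IsHalfPlaneExponent P)
    (hPr : ∀ x : ℝ, 0 < x → 0 < (P x).re) {x : ℝ} (hx : 0 < x) :
    ∀ᶠ y : ℝ in 𝓝[≠] x, laplaceTransform μ (P y) ≠ laplaceTransform μ (P x) := by
  have hx' : 0 < ((x : ℂ)).re := by simpa using hx
  have han := analyticAt_laplace_comp hμ hP hx' (hPr x hx)
  rcases han.eventually_eq_or_eventually_ne analyticAt_const
    (g := fun _ => laplaceTransform μ (P x)) with h | h
  · exfalso
    -- P' ≠ 0 makes P locally onto, so constancy of φ∘P near x would make φ locally constant.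
    have hs : HasStrictDerivAt P (deriv P x) x :=
      (hP.diff.analyticAt (isOpen_rightHalf.mem_nhds hx')).hasStrictDerivAt
    have hmap := hs.map_nhds_eq (hP.deriv_ne_zero x hx')
    refine laplace_not_eventually_const hμ hμ0 (hPr x hx) (laplaceTransform μ (P x)) ?_
    rw [← hmap]
    exact eventually_map.2 h
  · have hlim : Tendsto (fun y : ℝ => (y : ℂ)) (𝓝[≠] x) (𝓝[≠] (x : ℂ)) := by
      refine tendsto_nhdsWithin_iff.2 ⟨?_, ?_⟩
      · exact (Complex.continuous_ofReal.tendsto x).mono_left nhdsWithin_le_nhds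
      · filter_upwards [self_mem_nhdsWithin] with y hy
        simpa using hy
    exact hlim.eventually h

/-- Two continuous lifts through a map that is locally injective along one of them agree on a
connected set as soon as they agree at a point. -/
lemma eqOn_of_locally_injOn {φ : ℂ → ℂ} {u v : ℝ → ℂ} (hu : Continuous u) (hv : Continuous v)
    {S : Set ℝ} (hS : IsPreconnected S) (heq : ∀ t, φ (u t) = φ (v t))
    (hinj : ∀ t ∈ S, ∃ U ∈ 𝓝 (v t), Set.InjOn φ U) {t₀ : ℝ} (ht₀ : t₀ ∈ S) (h0 : u t₀ = v t₀) :
    Set.EqOn u v S := by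
  have hopen : ∀ t ∈ S, u t = v t → ∀ᶠ s in 𝓝 t, u s = v s := by
    intro t ht h
    obtain ⟨U, hU, hUi⟩ := hinj t ht
    have h1 := hu.continuousAt (x := t)
    rw [ContinuousAt, h] at h1
    filter_upwards [h1 hU, hv.continuousAt hU] with s hs1 hs2
    exact hUi hs1 hs2 (heq s)
  intro t ht
  by_contra hne
  have hclosed : IsClosed {t | u t = v t} := isClosed_eq hu hv
  obtain ⟨s, hsS, hs1, hs2⟩ := hS (interior {t | u t = v t}) {t | u t = v t}ᶜ isOpen_interior
    hclosed.isOpen_compl (fun s hs => by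
      by_cases h : u s = v s
      · exact Or.inl (mem_interior_iff_mem_nhds.2 (hopen s hs h))
      · exact Or.inr h) ⟨t₀, ht₀, mem_interior_iff_mem_nhds.2 (hopen t₀ ht₀ h0)⟩ ⟨t, ht, hne⟩
  exact hs2 (interior_subset hs1)

/-- Pointwise convergent lifts of a nowhere locally constant function are eventually equal to
their limit, locally uniformly. -/
lemma eventually_eqOn_of_tendsto (hμ : μ (Set.Iio 0) = 0) (hμ0 : μ ≠ Measure.dirac 0)
    {w : ℕ → ℝ → ℂ} {v : ℝ → ℂ} (hw : ∀ j, Continuous (w j)) (hv : Continuous v)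
    (heq : ∀ j t, laplaceTransform μ (w j t) = laplaceTransform μ (v t))
    (hlim : ∀ t, Tendsto (fun j => w j t) atTop (𝓝 (v t))) {p q : ℝ}
    (hre : ∀ t ∈ Set.Icc p q, 0 < (v t).re)
    (hne : ∀ t ∈ Set.Icc p q,
      ∀ᶠ s in 𝓝[≠] t, laplaceTransform μ (v s) ≠ laplaceTransform μ (v t)) :
    ∀ᶠ j in atTop, ∀ t ∈ Set.Icc p q, w j t = v t := by
  refine isCompact_Icc.induction_on (p := fun S => ∀ᶠ j in atTop, ∀ t ∈ S, w j t = v t) (by simp)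
    (fun s t hst h => h.mono fun j hj x hx => hj x (hst hx))
    (fun s t hs ht => (hs.and ht).mono fun j hj x hx => hx.elim (hj.1 x) (hj.2 x)) fun t ht => ?_
  -- The curve v leaves its value at t immediately and critical points of φ are isolated, so near t
  -- only s = t itself can be critical. The two sides of t are treated separately.
  have h1 : ∀ᶠ s in 𝓝[≠] t, deriv (laplaceTransform μ) (v s) ≠ 0 := by
    have hvt : Tendsto v (𝓝[≠] t) (𝓝[≠] (v t)) := by
      refine tendsto_nhdsWithin_iff.2 ⟨(hv.tendsto t).mono_left nhdsWithin_le_nhds, ?_⟩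
      filter_upwards [hne t ht] with s hs h
      exact hs (by rw [h])
    exact hvt.eventually (eventually_deriv_laplace_ne_zero hμ hμ0 (hre t ht))
  have h2 : ∀ᶠ s in 𝓝 t, 0 < (v s).re :=
    (Complex.continuous_re.comp hv).continuousAt.eventually_const_lt (hre t ht)
  obtain ⟨ε, hε, hb⟩ := Metric.eventually_nhds_iff.1
    (h2.and (eventually_nhdsWithin_iff.1 h1))
  set η := ε / 2
  have hη : 0 < η := half_pos hε
  have hinj : ∀ s, |s - t| ≤ η → s ≠ t → ∃ U ∈ 𝓝 (v s), Set.InjOn (laplaceTransform μ) U := by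
    intro s hs hst
    have := hb (y := s) (by rw [Real.dist_eq]; exact hs.trans_lt (half_lt_self hε))
    exact exists_injOn_laplace hμ this.1 (this.2 hst)
  have hend : ∀ s, |s - t| ≤ η → s ≠ t → ∀ᶠ j in atTop, w j s = v s := by
    intro s hs hst
    obtain ⟨U, hU, hUi⟩ := hinj s hs hst
    filter_upwards [(hlim s) hU] with j hj
    exact hUi hj (mem_of_mem_nhds hU) (heq j s)
  refine ⟨Set.Icc (t - η) (t + η), mem_nhdsWithin_of_mem_nhds
    (Icc_mem_nhds (by linarith) (by linarith)), ?_⟩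
  filter_upwards [hend (t + η) (by simp [abs_of_pos hη]) (by linarith),
    hend (t - η) (by simp [abs_of_pos hη]) (by linarith)] with j hj1 hj2
  have hr : Set.EqOn (w j) v (Set.Ioc t (t + η)) :=
    eqOn_of_locally_injOn (hw j) hv isPreconnected_Ioc (heq j)
      (fun s hs => hinj s (by rw [abs_le]; constructor <;> linarith [hs.1, hs.2]) hs.1.ne')
      ⟨by linarith, le_rfl⟩ hj1
  have hl : Set.EqOn (w j) v (Set.Ico (t - η) t) :=
    eqOn_of_locally_injOn (hw j) hv isPreconnected_Ico (heq j)
      (fun s hs => hinj s (by rw [abs_le]; constructor <;> linarith [hs.1, hs.2]) hs.2.ne)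
      ⟨le_rfl, by linarith⟩ hj2
  -- At t itself φ may not be locally injective; equality comes by continuity from the right.
  have ht0 : w j t = v t := by
    have := hr.closure (hw j) hv
    rw [closure_Ioc (by linarith : t ≠ t + η)] at this
    exact this ⟨le_rfl, by linarith⟩
  intro s hs
  rcases lt_trichotomy s t with h | h | h
  · exact hl ⟨hs.1, h⟩
  · rw [h]; exact ht0
  · exact hr ⟨h, hs.2⟩

end Rigidity

/-! ### Iterating a scaling relation on a bounded interval. -/

section Iteration

variable {χ : ℝ → ℂ}

/-- The drifts accumulate as a geometric sum. Only orbit points before the last step need lie in K.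
-/
lemma iterate_scale {K : Set ℝ} {s c e : ℝ}
    (h : ∀ u ∈ K, χ u = s * χ (c * u) + Complex.I * e * u) (i : ℕ) {u : ℝ}
    (hu : ∀ l < i, c ^ l * u ∈ K) : χ u = (s ^ i : ℝ) * χ (c ^ i * u) +
      Complex.I * (e * ∑ l ∈ Finset.range i, (s * c) ^ l : ℝ) * u := by
  induction i with
  | zero => simp
  | succ i ih =>
    rw [ih fun l hl => hu l (by omega), h _ (hu i (by omega)), Finset.sum_range_succ, ← mul_assoc,
      ← pow_succ']
    push_cast
    rw [pow_succ, mul_pow]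
    ring

/-- Iterates stay in the region where the scaling relation holds as long as the accumulated
factor is at most `k`. -/
lemma iterate_mem {ρ : ℝ → ℝ} {p₀ p q m k s c : ℝ} (hp₀ : 0 < p₀) (hp : p₀ < p)
    (hm : ∀ u ∈ Set.Icc p q, m ≤ ρ u) (hm0 : 0 < m)
    (hsmall : ∀ v, 0 < v → v ≤ p₀ → ρ v < m / k) (hk : 0 < k) (hs : 1 ≤ s)
    (hc : 0 < c) (hc1 : c ≤ 1) (hrel : ∀ u ∈ Set.Icc p₀ q, ρ u = s * ρ (c * u)) {u : ℝ}
    (hu : u ∈ Set.Icc p q) (i : ℕ) (hi : s ^ i ≤ k) :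
    ρ u = s ^ i * ρ (c ^ i * u) ∧ c ^ i * u ∈ Set.Ioc p₀ q := by
  have hu0 : 0 < u := hp₀.trans (hp.trans_le hu.1)
  induction i with
  | zero => simpa using ⟨hp.trans_le hu.1, hu.2⟩
  | succ i ih =>
    have hs' : s ^ i ≤ k := (pow_le_pow_right₀ hs (Nat.le_succ i)).trans hi
    obtain ⟨h1, h2⟩ := ih hs'
    have h3 : ρ u = s ^ (i + 1) * ρ (c ^ (i + 1) * u) := by
      rw [h1, hrel _ ⟨h2.1.le, h2.2⟩, pow_succ, pow_succ', mul_assoc, mul_assoc]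
    refine ⟨h3, ?_, ?_⟩
    -- Falling to p₀ or below would give ρ(u) < k · (m / k) = m, against the lower bound at u.
    · by_contra! hle
      have h4 := hsmall _ (by positivity) hle
      have h5 := hm u hu
      have h6 : 0 < s ^ (i + 1) := by positivity
      rw [h3] at h5
      have h7 : s ^ (i + 1) * ρ (c ^ (i + 1) * u) < s ^ (i + 1) * (m / k) := by gcongr
      have h8 : s ^ (i + 1) * (m / k) ≤ k * (m / k) := by gcongr
      rw [mul_div_cancel₀ _ hk.ne'] at h8
      linarith
    · rw [pow_succ', mul_assoc]
      have : 0 < c ^ i * u := by positivity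
      nlinarith [h2.2]

/-- The scale factors of a relation with `s > 1` are less than one. -/
lemma scale_lt_one {ρ : ℝ → ℝ} {p₀ p q m k s c M : ℝ} (hp₀ : 0 < p₀) (hp : p₀ < p) (hpq : p ≤ q)
    (hm : ∀ u ∈ Set.Icc p q, m ≤ ρ u) (hm0 : 0 < m)
    (hsmall : ∀ v, 0 < v → v ≤ p₀ → ρ v < m / k) (hk : 1 ≤ k) (hs : 1 < s)
    (hc : 0 < c) (hrel : ∀ u ∈ Set.Icc (p₀ / 2) q, ρ u = s * ρ (c * u))
    (hM : ∀ u ∈ Set.Icc p₀ q, ρ u ≤ M) (hc2 : c ≤ 2) : c < 1 := by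
  -- For c ≥ 1, going backwards from q along q / c^i multiplies ρ by s at every step while the
  -- points stay above p₀, contradicting the bound M. The condition c ≤ 2 keeps each next point
  -- above p₀ / 2, where the relation still holds.
  by_contra! hc1
  have key : ∀ i : ℕ, ρ (q / c ^ i) = s ^ i * ρ q ∧ q / c ^ i ∈ Set.Icc p₀ q := by
    intro i
    induction i with
    | zero => simpa using hp.le.trans hpq
    | succ i ih =>
      obtain ⟨h1, h2⟩ := ih
      have hq0 : 0 < q := hp₀.trans (hp.trans_le hpq)
      have e : q / c ^ (i + 1) = q / c ^ i / c := by rw [pow_succ, div_div]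
      have h3 : q / c ^ i / c ∈ Set.Icc (p₀ / 2) q := by
        refine ⟨?_, (div_le_self (by positivity) hc1).trans h2.2⟩
        rw [le_div_iff₀ hc]
        nlinarith [h2.1]
      have h4 := hrel _ h3
      rw [mul_div_cancel₀ _ hc.ne'] at h4
      rw [e]
      refine ⟨by rw [h4, h1, pow_succ']; ring, ?_, h3.2⟩
      by_contra! hlt
      have h5 := hsmall _ (by positivity) hlt.le
      have h6 := hm q ⟨hpq, le_rfl⟩
      have h7 : 1 ≤ s ^ (i + 1) := one_le_pow₀ hs.le
      rw [h4, h1, ← mul_assoc, ← pow_succ'] at h5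
      have h8 : m / k ≤ m := div_le_self hm0.le hk
      nlinarith
  have hq : 0 < ρ q := hm0.trans_le (hm q ⟨hpq, le_rfl⟩)
  obtain ⟨i, hi⟩ := pow_unbounded_of_one_lt (M / ρ q) hs
  rw [div_lt_iff₀ hq] at hi
  have := hM _ (key i).2
  rw [(key i).1] at this
  linarith

end Iteration


/-! ### Subsequential limits are self-similar and coincide with ψ. -/

section SelfSimilarLimit

variable {χ : ℝ → ℂ}

/-- Relations for `k^{1/N}` with scales tending to one accumulate to a relation for `k`. -/
lemma exists_scale_of_roots (hc : Continuous χ) (h0 : χ 0 = 0) {u₀ : ℝ}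
    (hu₀ : u₀ ∈ positivityRange χ) {k : ℝ} (hk : 1 < k) {N : ℕ → ℕ} {S C E : ℕ → ℝ}
    (hS : ∀ j, 1 < S j) (hSN : ∀ j, S j ^ N j = k) (hC : ∀ j, 0 < C j)
    (hC1 : Tendsto C atTop (𝓝 1))
    (hrel : ∀ p q : ℝ, 0 < p → q ∈ positivityRange χ → ∀ᶠ j in atTop, ∀ u ∈ Set.Icc p q,
      χ u = S j * χ (C j * u) + Complex.I * E j * u) :
    ∃ c F : ℝ, 0 < c ∧ c < 1 ∧ ∀ u ∈ positivityRange χ,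
      χ u = k * χ (c * u) + Complex.I * F * u := by
  set F : ℕ → ℝ := fun j => E j * ∑ l ∈ Finset.range (N j), (S j * C j) ^ l with hF
  have hk0 : 0 < k := by linarith
  have key : ∀ u ∈ positivityRange χ, ∃ p₀ : ℝ, 0 < p₀ ∧ ∀ᶠ j in atTop,
      χ u = k * χ (C j ^ N j * u) + Complex.I * F j * u ∧
        C j ^ N j * u ∈ Set.Icc p₀ u := by
    intro u hu
    have hu0 : 0 < u := hu.1
    set m := (χ u).re with hm
    have hm0 : 0 < m := hu.2 u hu0 le_rfl
    have hρc : Continuous fun v => (χ v).re := Complex.continuous_re.comp hc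
    obtain ⟨δ, hδ, hsmall⟩ : ∃ δ : ℝ, 0 < δ ∧ ∀ v, |v| < δ → (χ v).re < m / k := by
      have h1 : ∀ᶠ v in 𝓝 (0 : ℝ), (χ v).re < m / k :=
        hρc.continuousAt.eventually_lt_const (by simpa [h0] using div_pos hm0 hk0)
      obtain ⟨ε, hε, h⟩ := Metric.eventually_nhds_iff.1 h1
      exact ⟨ε, hε, fun v hv => h (by simpa [Real.dist_eq] using hv)⟩
    -- Below p₀ the real part is less than m / k, so an orbit whose total factor is at most k never
    -- gets there. This keeps the scales C_j^{N_j} away from 0.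
    set p₀ := min (δ / 2) (u / 2) with hp₀
    have hp₀0 : 0 < p₀ := lt_min (by positivity) (by positivity)
    have hp₀u : p₀ < u := (min_le_right _ _).trans_lt (by linarith)
    have hsm : ∀ v, 0 < v → v ≤ p₀ → (χ v).re < m / k := fun v hv hvp => hsmall v (by
      rw [abs_of_pos hv]
      linarith [hvp.trans (min_le_left (δ / 2) (u / 2))])
    obtain ⟨M, hM⟩ := (isCompact_Icc (a := p₀) (b := u)).exists_bound_of_continuousOn
      hρc.continuousOn
    refine ⟨p₀, hp₀0, ?_⟩
    filter_upwards [hrel (p₀ / 2) u (by positivity) hu,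
      hC1.eventually_le_const (show (1 : ℝ) < 2 by norm_num)] with j hj hj2
    have hre : ∀ v ∈ Set.Icc (p₀ / 2) u, (χ v).re = S j * (χ (C j * v)).re := fun v hv => by
      have := congrArg Complex.re (hj v hv)
      simpa using this
    have hmm : ∀ v ∈ Set.Icc u u, m ≤ (χ v).re := fun v hv => by
      rw [le_antisymm hv.2 hv.1]
    have hlt := scale_lt_one (ρ := fun v => (χ v).re) hp₀0 hp₀u le_rfl hmm hm0 hsm hk.le (hS j)
      (hC j) hre (fun v hv => (le_abs_self _).trans (hM v hv)) hj2
    have hsub : ∀ v ∈ Set.Icc p₀ u, v ∈ Set.Icc (p₀ / 2) u := fun v hv =>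
      ⟨by linarith [hv.1], hv.2⟩
    have hit : ∀ i, i ≤ N j → C j ^ i * u ∈ Set.Ioc p₀ u := fun i hi =>
      (iterate_mem (ρ := fun v => (χ v).re) hp₀0 hp₀u hmm hm0 hsm hk0 (hS j).le (hC j) hlt.le
        (fun v hv => hre v (hsub v hv)) ⟨le_rfl, le_rfl⟩ i
        ((pow_le_pow_right₀ (hS j).le hi).trans (hSN j).le)).2
    have h1 := iterate_scale (K := Set.Icc (p₀ / 2) u) hj (N j) (u := u) fun l hl =>
      hsub _ ⟨(hit l hl.le).1.le, (hit l hl.le).2⟩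
    rw [hSN j] at h1
    exact ⟨h1, (hit _ le_rfl).1.le, (hit _ le_rfl).2⟩
  obtain ⟨p₀, hp₀, hev⟩ := key u₀ hu₀
  have hu₀0 : 0 < u₀ := hu₀.1
  have hmem : ∀ᶠ j in atTop, C j ^ N j ∈ Set.Icc (p₀ / u₀) 1 := hev.mono fun j hj =>
    ⟨(div_le_iff₀ hu₀0).2 hj.2.1, by
      have := hj.2.2
      nlinarith⟩
  obtain ⟨c, hcm, τ, hτ, hlim⟩ := isCompact_Icc.tendsto_subseq' hmem.frequently
  simp only [Function.comp_def] at hlim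
  have hlimχ : ∀ u, Tendsto (fun j => χ (C (τ j) ^ N (τ j) * u)) atTop (𝓝 (χ (c * u))) := fun u =>
    (hc.tendsto _).comp (hlim.mul_const u)
  -- The accumulated drifts need no separate estimate: the relation at the single point u₀
  -- determines them.
  have hF1 : Tendsto (fun j => F (τ j)) atTop (𝓝 ((χ u₀ - k * χ (c * u₀)).im / u₀)) := by
    have h1 := (((Complex.continuous_im.tendsto _).comp
      (((hlimχ u₀).const_mul (k : ℂ)).const_sub (χ u₀)))).div_const u₀
    refine h1.congr' ?_
    filter_upwards [hτ.tendsto_atTop.eventually hev] with j hj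
    simp only [Function.comp]
    nth_rewrite 1 [hj.1]
    rw [add_sub_cancel_left]
    simp
    field_simp
  set F₀ := (χ u₀ - k * χ (c * u₀)).im / u₀
  have hfin : ∀ u ∈ positivityRange χ, χ u = k * χ (c * u) + Complex.I * F₀ * u := by
    intro u hu
    obtain ⟨_, _, h⟩ := key u hu
    have h1 : Tendsto (fun j => (k : ℂ) * χ (C (τ j) ^ N (τ j) * u) + Complex.I * F (τ j) * u) atTop
        (𝓝 (k * χ (c * u) + Complex.I * F₀ * u)) :=
      ((hlimχ u).const_mul _).add
        ((((Complex.continuous_ofReal.tendsto _).comp hF1).const_mul _).mul_const _)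
    refine tendsto_nhds_unique (tendsto_const_nhds.congr' ?_) h1
    filter_upwards [hτ.tendsto_atTop.eventually h] with j hj
    exact hj.1
  -- c = 1 would give Re χ(u₀) = k Re χ(u₀) with k > 1 and Re χ(u₀) > 0.
  refine ⟨c, F₀, (div_pos hp₀ hu₀0).trans_le hcm.1, lt_of_le_of_ne hcm.2 fun hc1 => ?_, hfin⟩
  have h1 := congrArg Complex.re (hfin u₀ hu₀)
  rw [hc1, one_mul] at h1
  simp at h1
  have := hu₀.2 u₀ hu₀0 le_rfl
  nlinarith

variable {μ : Measure ℝ} [IsProbabilityMeasure μ] {g : ℝ → ℂ} {a b : ℕ → ℝ} {z : ℕ → ℝ → ℂ}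

lemma IsSubLimit.isCharExponent (hz : TightExponents z) (hχ : IsSubLimit z χ) :
    IsCharExponent χ := by
  obtain ⟨σ, hσ, h⟩ := hχ
  exact (hz.comp hσ).isCharExponent_limit h

lemma IsSubLimit.continuous (hz : TightExponents z) (hχ : IsSubLimit z χ) : Continuous χ := by
  obtain ⟨σ, hσ, h⟩ := hχ
  exact (hz.comp hσ).continuous_limit h

lemma TightExponents.of_subLimits (hz : TightExponents z) {X : ℕ → ℝ → ℂ}
    (hX : ∀ j, IsSubLimit z (X j)) : TightExponents X where
  exponent j := (hX j).isCharExponent hz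
  small r hr := by
    obtain ⟨τ, hτ, h⟩ := hz.limit_small hr
    refine ⟨τ, hτ, Eventually.of_forall fun j t ht => ?_⟩
    obtain ⟨σ, hσ, hl⟩ := hX j
    exact h σ (X j) hσ hl t ht

/-- An exponent with the same Laplace transform as a nondegenerate half-plane exponent is
nondegenerate. -/
lemma IsHalfPlaneExponent.re_ne_zero_of_agree (hμ : μ (Set.Iio 0) = 0)
    (hμ0 : μ ≠ Measure.dirac 0) {P : ℂ → ℂ} (hP : IsHalfPlaneExponent P)
    (hPs : ∀ t : ℂ, 0 < t.re → 0 < (deriv P t).re) (hPr : ∀ x : ℝ, 0 < x → 0 < (P x).re)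
    (hχ : IsCharExponent χ) (hc : Continuous χ)
    (h : ∀ x : ℝ, 0 < x → laplaceTransform μ (P x) = laplaceTransform μ (χ x)) :
    ∃ t, (χ t).re ≠ 0 := by
  by_contra! hre
  obtain ⟨D, hD⟩ := hχ.linear_of_re_eq_zero hc hre
  exact hP.not_agree_linear hμ hμ0 hPs hPr D fun x hx => by rw [h x hx, hD x]

/-- Subsequential limits obtained from χ by time changes s → 1 converge, along a subsequence, to a
function that is χ up to scale and drift. All are lifts of φ(ψ), so rigidity makes the approximate
relations exact from some index on, and iterating the relation for k^{1/N} gives the one for k. -/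
lemma exists_scale_of_subLimit (hμ : μ (Set.Iio 0) = 0) (hμ0 : μ ≠ Measure.dirac 0)
    (ha : ∀ n, 0 < a n) (hz : TightExponents (rowExponent g a b))
    {ψ : ℝ → ℂ} {P : ℂ → ℂ} (hP : IsHalfPlaneExponent P)
    (hPs : ∀ t : ℂ, 0 < t.re → 0 < (deriv P t).re) (hPr : ∀ x : ℝ, 0 < x → 0 < (P x).re)
    (hPψ : ∀ x : ℝ, 0 < x → P x = ψ x)
    (hf : ∀ χ, IsSubLimit (rowExponent g a b) χ →
      ∀ t, laplaceTransform μ (χ t) = laplaceTransform μ (ψ t))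
    (hχ : IsSubLimit (rowExponent g a b) χ) {k : ℕ} (hk : 2 ≤ k) :
    ∃ c F : ℝ, 0 < c ∧ c < 1 ∧ ∀ u ∈ positivityRange χ,
      χ u = k * χ (c * u) + Complex.I * F * u := by
  have hnd : ∀ χ, IsCharExponent χ → Continuous χ →
      (∀ t, laplaceTransform μ (χ t) = laplaceTransform μ (ψ t)) → ∃ t, (χ t).re ≠ 0 :=
    fun χ h1 h2 h3 => hP.re_ne_zero_of_agree hμ hμ0 hPs hPr h1 h2 fun x hx => by
      rw [hPψ x hx, h3]
  have hnd' : ∀ χ, IsSubLimit (rowExponent g a b) χ → ∃ t, (χ t).re ≠ 0 := fun χ h =>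
    hnd χ (h.isCharExponent hz) (h.continuous hz) (hf χ h)
  have hχE := hχ.isCharExponent hz
  have hχc := hχ.continuous hz
  obtain ⟨B, hB, hBpos⟩ := hχE.exists_pos_interval hχc (hnd' χ hχ)
  have hk1 : (1 : ℝ) < k := by exact_mod_cast (by omega : 1 < k)
  -- The exponent 1/(j + 1) avoids dividing by zero at j = 0; s_j tends to 1 and its power j + 1 is
  -- k.
  set s : ℕ → ℝ := fun j => (k : ℝ) ^ (1 / ((j : ℝ) + 1)) with hs
  have hs1 : ∀ j, 1 < s j := fun j => Real.one_lt_rpow hk1 (by positivity)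
  have hsN : ∀ j, s j ^ (j + 1) = k := fun j => by
    rw [hs, ← Real.rpow_natCast, ← Real.rpow_mul (by positivity)]
    push_cast
    rw [one_div_mul_cancel (by positivity), Real.rpow_one]
  have hslim : Tendsto s atTop (𝓝 1) := by
    have h1 := tendsto_one_div_add_atTop_nhds_zero_nat (𝕜 := ℝ)
    have h2 := (Real.continuous_const_rpow (by positivity : (k : ℝ) ≠ 0)).tendsto 0
    rw [Real.rpow_zero] at h2
    exact h2.comp h1
  choose γ D hγ hX using fun j =>
    exists_isSubLimit_scale ha hz hnd' hχ (zero_lt_one.trans (hs1 j))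
  set X : ℕ → ℝ → ℂ := fun j t => s j * χ (γ j * t) + Complex.I * D j * t with hXdef
  have hXt : TightExponents X := hz.of_subLimits hX
  obtain ⟨τ₀, χ', hτ₀, hχ'⟩ := hXt.exists_subseq
  have hXt₀ := hXt.comp hτ₀.tendsto_atTop
  have hχ'E := hXt₀.isCharExponent_limit hχ'
  have hχ'c := hXt₀.continuous_limit hχ'
  have hχ'f : ∀ t, laplaceTransform μ (χ' t) = laplaceTransform μ (ψ t) := fun t => by
    have h1 := tendsto_laplace_of_row hμ (fun n => (hXt₀.exponent n).re_nonneg t) (hχ' t)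
    exact tendsto_nhds_unique h1 (tendsto_const_nhds.congr fun n => (hf _ (hX _) t).symm)
  -- Re X_j(t) = s_j Re χ(γ_j t), with both limits nondegenerate, so the γ_j accumulate in (0, ∞).
  obtain ⟨τ₁, γ₀, hτ₁, hγ₀, hγlim⟩ := exists_scale_subseq
    (ρ := fun _ t => (χ t).re) (ρ' := fun j t => (X (τ₀ j) t).re) (R := fun t => (χ t).re)
    (R' := fun t => (χ' t).re)
    (fun _ u t _ hu => ((Complex.continuous_re.comp hχc).tendsto t).comp hu)
    (fun τ u t hτ hu => (Complex.continuous_re.tendsto _).comp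
      ((hXt₀.comp hτ).tendsto_moving (fun t => (hχ' t).comp hτ) hu))
    (by simp [hχE.map_zero]) (by simp [hχ'E.map_zero]) (hnd' χ hχ) (hnd χ' hχ'E hχ'c hχ'f)
    (γ := fun j => γ (τ₀ j)) (s := fun j => s (τ₀ j)) (fun j => hγ _)
    (hslim.comp hτ₀.tendsto_atTop) one_pos (fun j t => by simp [hXdef])
  set τ : ℕ → ℕ := fun j => τ₀ (τ₁ j) with hτ
  have hτt : Tendsto τ atTop atTop := hτ₀.tendsto_atTop.comp hτ₁.tendsto_atTop
  have hXlim : ∀ t, Tendsto (fun j => X (τ j) t) atTop (𝓝 (χ' t)) := fun t =>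
    (hχ' t).comp hτ₁.tendsto_atTop
  have hχlim : ∀ t, Tendsto (fun j => (s (τ j) : ℂ) * χ (γ (τ j) * t)) atTop
      (𝓝 (χ (γ₀ * t))) := fun t => by
    have h1 := (Complex.continuous_ofReal.tendsto _).comp (hslim.comp hτt)
    have h2 := (hχc.tendsto _).comp (hγlim.mul_const t)
    simpa [Function.comp_def] using h1.mul h2
  have hdrift : ∀ t : ℝ, Tendsto (fun j => Complex.I * (D (τ j) : ℂ) * t) atTop
      (𝓝 (χ' t - χ (γ₀ * t))) := fun t =>
    ((hXlim t).sub (hχlim t)).congr fun j => by simp only [hXdef, add_sub_cancel_left]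
  obtain ⟨D₀, hD₀⟩ : ∃ D₀ : ℝ, Tendsto (fun j => D (τ j)) atTop (𝓝 D₀) :=
    ⟨_, ((Complex.continuous_im.tendsto _).comp (hdrift 1)).congr fun j => by simp⟩
  have hχ'eq : ∀ t, χ' t = χ (γ₀ * t) + Complex.I * D₀ * t := fun t => by
    have h1 : Tendsto (fun j => Complex.I * (D (τ j) : ℂ) * t) atTop (𝓝 (Complex.I * D₀ * t)) :=
      (((Complex.continuous_ofReal.tendsto _).comp hD₀).const_mul _).mul_const _
    rw [tendsto_nhds_unique h1 (hdrift t)]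
    ring
  have hu₀ : B / 2 ∈ positivityRange χ :=
    ⟨by positivity, fun s hs hsB => hBpos s hs (by linarith)⟩
  refine exists_scale_of_roots hχc hχE.map_zero hu₀ hk1 (N := fun j => τ j + 1)
    (S := fun j => s (τ j)) (C := fun j => γ (τ j) / γ₀) (E := fun j => (D (τ j) - D₀) / γ₀)
    (fun j => hs1 _) (fun j => hsN _) (fun j => div_pos (hγ _) hγ₀)
    (by simpa [div_self hγ₀.ne'] using hγlim.div_const γ₀) fun p q hp hq => ?_
  have hIcc : ∀ t ∈ Set.Icc (p / γ₀) (q / γ₀), 0 < t ∧ γ₀ * t ≤ q := fun t ht =>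
    ⟨(div_pos hp hγ₀).trans_le ht.1, by
      have := ht.2
      rw [le_div_iff₀ hγ₀] at this
      linarith⟩
  -- The real part of the limit lift at t is Re χ(γ₀ t), positive because γ₀ t lies in the
  -- positivity range. There φ is analytic, and φ along the lift equals φ∘P, which is nowhere
  -- locally constant.
  have hev := eventually_eqOn_of_tendsto hμ hμ0 (w := fun j => X (τ j)) (v := χ')
    (fun j => (hX _).continuous hz) hχ'c (fun j t => by rw [hf _ (hX _) t, hχ'f t]) hXlim
    (p := p / γ₀) (q := q / γ₀) (fun t ht => by
      rw [hχ'eq t]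
      have := hq.2 (γ₀ * t) (mul_pos hγ₀ (hIcc t ht).1) (hIcc t ht).2
      simpa using this)
    (fun t ht => by
      have ht0 := (hIcc t ht).1
      have h1 := hP.eventually_laplace_ne hμ hμ0 hPr ht0
      have h2 : ∀ᶠ y : ℝ in 𝓝[≠] t, 0 < y :=
        mem_nhdsWithin_of_mem_nhds (lt_mem_nhds ht0)
      filter_upwards [h1, h2] with y hy hy0
      rwa [hχ'f y, hχ'f t, ← hPψ y hy0, ← hPψ t ht0])
  filter_upwards [hev] with j hj u hu
  have h1 := hj (u / γ₀) ⟨by gcongr; exact hu.1, by gcongr; exact hu.2⟩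
  rw [hχ'eq, mul_div_cancel₀ _ hγ₀.ne'] at h1
  simp only [hXdef] at h1
  have h2 : γ (τ j) * (u / γ₀) = γ (τ j) / γ₀ * u := by ring
  rw [h2] at h1
  have h3 : χ u = s (τ j) * χ (γ (τ j) / γ₀ * u) + Complex.I * D (τ j) * (u / γ₀ : ℝ) -
      Complex.I * D₀ * (u / γ₀ : ℝ) := by
    rw [h1]; ring
  rw [h3]
  push_cast
  ring

/-- Every subsequential limit is the given exponent. -/
theorem IsSubLimit.eq_of_laplace_eq (hμ : μ (Set.Iio 0) = 0) (hμ0 : μ ≠ Measure.dirac 0)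
    (hg : IsCharFun g) (ha : ∀ n, 0 < a n) (hz : TightExponents (rowExponent g a b))
    {ψ : ℝ → ℂ} (hψ : IsCharExponent ψ) {P : ℂ → ℂ} (hP : IsHalfPlaneExponent P)
    (hPs : ∀ t : ℂ, 0 < t.re → 0 < (deriv P t).re) (hPr : ∀ x : ℝ, 0 < x → 0 < (P x).re)
    (hPψ : ∀ x : ℝ, 0 < x → P x = ψ x)
    (hf : ∀ χ, IsSubLimit (rowExponent g a b) χ →
      ∀ t, laplaceTransform μ (χ t) = laplaceTransform μ (ψ t))
    (hχ : IsSubLimit (rowExponent g a b) χ) : χ = ψ := by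
  have hχE := hχ.isCharExponent hz
  have hχc := hχ.continuous hz
  have hscale := fun k (hk : 2 ≤ k) =>
    exists_scale_of_subLimit hμ hμ0 ha hz hP hPs hPr hPψ hf hχ hk
  obtain ⟨B, hB, hBpos⟩ := hχE.exists_pos_interval hχc
    (hP.re_ne_zero_of_agree hμ hμ0 hPs hPr hχE hχc fun x hx => by rw [hPψ x hx, hf χ hχ])
  have hrange : positivityRange χ = Set.Ioi 0 := by
    obtain ⟨c, F, hc0, hc1, h⟩ := hscale 2 le_rfl
    refine positivityRange_eq hχc hB hBpos hc0 hc1 two_pos (e := -F) fun u hu => ?_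
    rw [h u hu]
    push_cast
    ring
  have hpos : ∀ t, 0 < t → 0 < (χ t).re := fun t ht => by
    have : t ∈ positivityRange χ := hrange ▸ ht
    exact this.2 t ht le_rfl
  have hss : IsSelfSimilar χ (Set.Ioi 0) := fun k hk => by
    obtain ⟨c, F, hc0, hc1, h⟩ := hscale k hk
    refine ⟨c, -F, hc0, fun u hu => ?_⟩
    rw [h u (hrange ▸ hu)]
    push_cast
    ring
  have hlim : IsCharExponentLimit χ := by
    obtain ⟨σ, hσ, h⟩ := hχ
    obtain ⟨C, _, hC⟩ := (hz.comp hσ).growth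
    refine ⟨fun n => (σ n : ℝ), fun n => normalizedCharFun g (a (σ n)) (b (σ n)), C,
      fun n => Nat.cast_nonneg _, fun n => hg.normalized _ _, ?_, ?_⟩
    · simpa only [Complex.ofReal_natCast, rowExponent] using hC
    · simpa only [Complex.ofReal_natCast, rowExponent] using h
  obtain ⟨Q, hQ, hQs, hQr, hQχ⟩ := hlim.exists_halfPlaneExponent hχE hχc hpos hss
  have hag := agreeNearReal_of_pos hμ hP hQ hPr hQr fun x hx => by
    rw [hPψ x hx, hQχ x hx, hf χ hχ]
  have heq : ∀ x : ℝ, 0 < x → χ x = ψ x := fun x hx => by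
    rw [← hPψ x hx, ← hQχ x hx]
    exact (hP.eq_of_agree hμ hμ0 hQ hPs hPr hag (by simpa using hx)).symm
  funext t
  rcases lt_trichotomy t 0 with ht | rfl | ht
  · rw [← neg_neg t, hχE.map_neg, hψ.map_neg, heq _ (by linarith)]
  · rw [hχE.map_zero, hψ.map_zero]
  · exact heq t ht

end SelfSimilarLimit

/-! ### Assembling the theorem. -/

section Main

variable {μ : Measure ℝ} [IsProbabilityMeasure μ] {ψ : ℝ → ℂ}

/-- ψ is the limit of (n + 1)(1 - e^{-ψ/(n+1)}) with ChFs by infinite divisibility; |1 - e^{-w}| ≤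
2|w| for Re w ≥ 0 passes the quadratic growth of ψ to the approximants. -/
lemma IsStableCharFun.isCharExponentLimit (hψ : IsStableCharFun fun t => Complex.exp (-ψ t))
    (hc : Continuous ψ) (h0 : ψ 0 = 0) : IsCharExponentLimit ψ := by
  have hE := hψ.isCharExponent hc h0
  have hroot : ∀ n : ℕ, IsCharFun fun t => Complex.exp (-(ψ t / (n + 1 : ℕ))) := by
    intro n
    obtain ⟨c, e, hc0, h⟩ := hψ.exponent_scale hc h0 (k := n + 1) (by omega)
    convert hψ.1.affine c (e / (n + 1 : ℕ)) using 2 with t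
    have hn0 : ((n + 1 : ℕ) : ℂ) ≠ 0 := by exact_mod_cast Nat.succ_ne_zero n
    rw [← Complex.exp_add]
    congr 1
    rw [h t]
    simp only [Complex.ofReal_mul, Complex.ofReal_div, Complex.ofReal_natCast]
    field_simp
    ring
  obtain ⟨τ, hτ, hb⟩ : ∃ τ : ℝ, 0 < τ ∧ ∀ t, |t| ≤ τ → ‖ψ t‖ ≤ 1 := by
    have h1 : ∀ᶠ t in 𝓝 (0 : ℝ), ‖ψ t‖ < 1 :=
      hc.norm.continuousAt.eventually_lt_const (by simp [h0])
    obtain ⟨ε, hε, h⟩ := Metric.eventually_nhds_iff.1 h1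
    exact ⟨ε / 2, by positivity, fun t ht => (h (by rw [Real.dist_eq, sub_zero]; linarith)).le⟩
  refine ⟨fun n => ((n + 1 : ℕ) : ℝ), fun n t => Complex.exp (-(ψ t / (n + 1 : ℕ))),
    2 * (1 + 4 / τ ^ 2), fun n => Nat.cast_nonneg _, hroot, Eventually.of_forall fun n t => ?_,
    fun t => ?_⟩
  · have hn : (0 : ℝ) < ((n + 1 : ℕ) : ℝ) := by positivity
    have h1 : ∀ w : ℂ, 0 ≤ w.re → ‖1 - Complex.exp (-w)‖ ≤ 2 * ‖w‖ := by
      intro w hw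
      rw [norm_sub_rev]
      rcases le_total ‖w‖ 1 with h | h
      · simpa using Complex.norm_exp_sub_one_le (x := -w) (by simpa using h)
      · have h2 : ‖Complex.exp (-w)‖ ≤ 1 := by
          rw [Complex.norm_exp, Real.exp_le_one_iff, Complex.neg_re]; linarith
        calc ‖Complex.exp (-w) - 1‖ ≤ ‖Complex.exp (-w)‖ + ‖(1 : ℂ)‖ := norm_sub_le _ _
          _ ≤ 2 * ‖w‖ := by rw [norm_one]; linarith
    have hre : 0 ≤ (ψ t / (n + 1 : ℕ)).re := by
      rw [Complex.div_natCast_re]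
      exact div_nonneg (hE.re_nonneg t) hn.le
    have h2 := h1 _ hre
    have h3 := hE.norm_le_growth hτ hb t
    rw [norm_div, Complex.norm_natCast] at h2
    rw [norm_mul, Complex.norm_real, Real.norm_of_nonneg hn.le]
    have h4 : ((n + 1 : ℕ) : ℝ) * ‖1 - Complex.exp (-(ψ t / (n + 1 : ℕ)))‖ ≤ 2 * ‖ψ t‖ := by
      calc _ ≤ ((n + 1 : ℕ) : ℝ) * (2 * (‖ψ t‖ / ((n + 1 : ℕ) : ℝ))) := by gcongr
        _ = 2 * ‖ψ t‖ := by field_simp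
    have h5 : 1 * (1 + 4 * (t / τ) ^ 2) ≤ (1 + 4 / τ ^ 2) * (1 + t ^ 2) := by
      have : 0 ≤ 4 / τ ^ 2 := by positivity
      have e : 4 * (t / τ) ^ 2 = 4 / τ ^ 2 * t ^ 2 := by rw [div_pow]; ring
      rw [e]
      nlinarith [sq_nonneg t]
    linarith
  · have := (tendsto_mul_one_sub_exp (ψ t)).comp (tendsto_add_atTop_nat 1)
    simpa only [Complex.ofReal_natCast, Function.comp_def] using this

lemma IsStableCharFun.isSelfSimilar (hψ : IsStableCharFun fun t => Complex.exp (-ψ t))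
    (hc : Continuous ψ) (h0 : ψ 0 = 0) (I : Set ℝ) : IsSelfSimilar ψ I := fun k hk => by
  obtain ⟨c, e, hc0, h⟩ := hψ.exponent_scale hc h0 (k := k) (by omega)
  exact ⟨c, e, hc0, fun u _ => h u⟩

/-- Convergence of the Laplace transforms forces convergence of the exponents. -/
theorem IsCharFun.tendsto_row_of_laplace (hμ : μ (Set.Iio 0) = 0) (hμ0 : μ ≠ Measure.dirac 0)
    (hψc : Continuous ψ) (hψ0 : ψ 0 = 0) (hψ : IsStableCharFun fun t => Complex.exp (-ψ t))
    (hne : ∃ t, (ψ t).re ≠ 0) {g : ℝ → ℂ} (hg : IsCharFun g) {a b : ℕ → ℝ} (ha : ∀ n, 0 < a n)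
    (h : ∀ t, Tendsto (fun n => laplaceTransform μ (rowExponent g a b n t)) atTop
      (𝓝 (laplaceTransform μ (ψ t)))) (t : ℝ) :
    Tendsto (fun n => rowExponent g a b n t) atTop (𝓝 (ψ t)) := by
  have hE := hψ.isCharExponent hψc hψ0
  have hz := hg.tightExponents_of_laplace hμ hμ0 hψc hψ0 hE.re_nonneg h
  obtain ⟨P, hP, hPs, hPr, hPψ⟩ := (hψ.isCharExponentLimit hψc hψ0).exists_halfPlaneExponent hE hψc
    (fun t ht => hψ.re_pos hψc hψ0 hne ht) (hψ.isSelfSimilar hψc hψ0 _)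
  refine hz.tendsto_of_unique_limit (fun σ χ hσ hχ => ?_) t
  refine IsSubLimit.eq_of_laplace_eq hμ hμ0 hg ha hz hE hP hPs hPr hPψ (fun χ hχ t => ?_)
    ⟨σ, hσ.tendsto_atTop, hχ⟩
  obtain ⟨σ, hσ, hχ⟩ := hχ
  exact tendsto_nhds_unique
    (tendsto_laplace_of_row hμ (fun n => (hg.isCharExponent_row _).re_nonneg t) (hχ t))
    ((h t).comp hσ)

end Main

theorem theorem4p4 (μ : Measure ℝ) [IsProbabilityMeasure μ] (hμ : μ (Set.Iio 0) = 0)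
    (hμ0 : μ ≠ Measure.dirac 0)
    (ψ : ℝ → ℂ) (hψc : Continuous ψ) (hψ0 : ψ 0 = 0)
    (hψ : IsStableCharFun (fun t => Complex.exp (-ψ t))) :
    domainOfPhiAttraction (laplaceTransform μ) (fun t => laplaceTransform μ (ψ t)) =
      domainOfAttraction (fun t => Complex.exp (-ψ t)) := by
  have hE := hψ.isCharExponent hψc hψ0
  by_cases hne : ∃ t, (ψ t).re ≠ 0
  · ext g
    constructor
    · rintro ⟨hg, a, b, ha, h⟩
      exact ⟨hg, a, b, ha, fun t => hg.tendsto_pow_of_row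
        (hg.tendsto_row_of_laplace hμ hμ0 hψc hψ0 hψ hne ha h t)⟩
    · rintro ⟨hg, a, b, ha, h⟩
      exact ⟨hg, a, b, ha, fun t => tendsto_laplace_of_row hμ
        (fun n => (hg.isCharExponent_row n).re_nonneg t) (hg.tendsto_row_of_pow hψc hψ0 h t)⟩
  -- Degenerate case: no equivalence of convergence is needed, since every ChF can be normed so that
  -- its row exponents converge to iDt, which puts it in both domains.
  · push Not at hne
    obtain ⟨D, hD⟩ := hE.linear_of_re_eq_zero hψc hne
    have key : ∀ g, IsCharFun g →
        g ∈ domainOfPhiAttraction (laplaceTransform μ) (fun t => laplaceTransform μ (ψ t)) ∧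
          g ∈ domainOfAttraction (fun t => Complex.exp (-ψ t)) := fun g hg => by
      obtain ⟨a, b, ha, h⟩ := hg.exists_tendsto_row_linear D
      simp only [← hD] at h
      exact ⟨⟨hg, a, b, ha, fun t => tendsto_laplace_of_row hμ
        (fun n => (hg.isCharExponent_row n).re_nonneg t) (h t)⟩,
        hg, a, b, ha, fun t => hg.tendsto_pow_of_row (h t)⟩
    ext g
    exact ⟨fun h => (key g h.1).2, fun h => (key g h.1).1⟩
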